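/- Setting. Let $\mathcal B\subset\mathbb R^3$ be a compact domain with smooth boundary and unit normal $\boldsymbol n$, let $T>0$, and let $k\in\{f,s\}$ stand for fluid and solid. All fields are smooth up to the boundary of $[0,T]\times\mathcal B$. Let $\boldsymbol\varphi_k(t,\cdot):\mathcal B_k\to\mathcal B$ be smooth time-dependent diffeomorphisms from reference configurations $\mathcal B_k$ (compact domains with smooth boundary), and put $\boldsymbol u_k=\partial_t\boldsymbol\varphi_k\circ\boldsymbol\varphi_k^{-1}$, $\rho_k=(\rho_k^0\circ\boldsymbol\varphi_k^{-1})\,|\det\nabla\boldsymbol\varphi_k^{-1}|$ with $\rho_k^0>0$, and $b=(\nabla\boldsymbol\varphi_s\nabla\boldsymbol\varphi_s^{\mathsf T})\circ\boldsymbol\varphi_s^{-1}$. On $\partial\mathcal B$ impose either free slip ($\boldsymbol u_k\cdot\boldsymbol n=0$), or no slip ($\boldsymbol u_f=\boldsymbol u_s=0$), or no slip for the solid only ($\boldsymbol u_s=0$, $\boldsymbol u_f\cdot\boldsymbol n=0$). Further variables are the entropy densities $s_k$, scalar fields $\sigma_k,\gamma_k$, and the volume fraction $\phi\in(0,1)$.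 Given are friction forces $\boldsymbol f_k$, friction stresses $\boldsymbol\sigma_k$ and heat exchange fluxes $J_{fs}=J_{sf}$, $J_{ff}=J_{ss}=-J_{fs}$, as fields along the evolution (so they may depend on the state in any way). Let $\ell(\boldsymbol u_f,\boldsymbol u_s,\rho_f,\rho_s,s_f,s_s,b,\phi)$ be a smooth Lagrangian with functional derivatives $\delta\ell/\delta\boldsymbol u_k,\dots,\delta\ell/\delta\phi$ with respect to the $L^2$ pairing on $\mathcal B$ ($\delta\ell/\delta b$ symmetric), and assume that $\delta\ell/\delta s_k$ vanishes nowhere along the evolution. For vector fields $\boldsymbol\eta_k$ write $$D_t^kg=\partial_tg+\boldsymbol u_k\cdot\nabla g,\quad \bar D_t^kg=\partial_tg+\operatorname{div}(g\boldsymbol u_k),\quad D_\delta^kg=\delta g+\boldsymbol\eta_k\cdot\nabla g,\quad \bar D_\delta^kg=\delta g+\operatorname{div}(g\boldsymbol\eta_k),$$ $(\pounds_{\boldsymbol u}\boldsymbol m)_i=u_j\partial_jm_i+m_j\partial_iu_j+m_i\partial_ju_j$, $(\pounds_{\boldsymbol\eta}b)^{ij}=\eta^k\partial_kb^{ij}-b^{kj}\partial_k\eta^i-b^{ik}\partial_k\eta^j$,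 $(\operatorname{div}A)_i=\partial_jA_{ij}$, $A:\nabla\boldsymbol v=A_{ij}\partial_jv_i$, $(\Pi:\nabla b)_k=\Pi_{ij}\partial_kb^{ij}$. The evolution is called *critical* if it satisfies the phenomenological constraints $$\frac{\delta\ell}{\delta s_k}\bar D_t^k\sigma_k=\boldsymbol f_k\cdot\boldsymbol u_k-\boldsymbol\sigma_k:\nabla\boldsymbol u_k+\sum_lJ_{kl}D_t^l\gamma_l,\qquad k=f,s,$$ and if $$\delta\int_0^T\Big[\ell+\sum_{k=f,s}\int_{\mathcal B}(s_k-\sigma_k)D_t^k\gamma_k\,d^3\boldsymbol x\Big]dt=0$$ for all variations in which $\boldsymbol\eta_k=\delta\boldsymbol\varphi_k\circ\boldsymbol\varphi_k^{-1}$ obeys the chosen boundary condition, $\delta\boldsymbol u_k=\partial_t\boldsymbol\eta_k+\boldsymbol u_k\cdot\nabla\boldsymbol\eta_k-\boldsymbol\eta_k\cdot\nabla\boldsymbol u_k$, $\delta\rho_k=-\operatorname{div}(\rho_k\boldsymbol\eta_k)$, $\delta b=-\pounds_{\boldsymbol\eta_s}b$, $\delta s_k$ and $\delta\phi$ are free,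 $\boldsymbol\eta_k$ and $\delta\gamma_k$ vanish at $t=0,T$, and the variational constraints hold: $$\frac{\delta\ell}{\delta s_k}\bar D_\delta^k\sigma_k=\boldsymbol f_k\cdot\boldsymbol\eta_k-\boldsymbol\sigma_k:\nabla\boldsymbol\eta_k+\sum_lJ_{kl}D_\delta^l\gamma_l,\qquad k=f,s.$$ (I) If the evolution is critical, then on $[0,T]\times\mathcal B$ $$\begin{aligned} &\partial_t\tfrac{\delta\ell}{\delta\boldsymbol u_f}+\pounds_{\boldsymbol u_f}\tfrac{\delta\ell}{\delta\boldsymbol u_f}=\rho_f\nabla\tfrac{\delta\ell}{\delta\rho_f}+s_f\nabla\tfrac{\delta\ell}{\delta s_f}+\operatorname{div}\boldsymbol\sigma_f+\boldsymbol f_f,\\ &\partial_t\tfrac{\delta\ell}{\delta\boldsymbol u_s}+\pounds_{\boldsymbol u_s}\tfrac{\delta\ell}{\delta\boldsymbol u_s}=\rho_s\nabla\tfrac{\delta\ell}{\delta\rho_s}+s_s\nabla\tfrac{\delta\ell}{\delta s_s}-\tfrac{\delta\ell}{\delta b}:\nabla b+\operatorname{div}\big(\boldsymbol\sigma_s-2\tfrac{\delta\ell}{\delta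 b}\cdot b\big)+\boldsymbol f_s,\\ &\partial_t\rho_f+\operatorname{div}(\rho_f\boldsymbol u_f)=0,\quad\partial_t\rho_s+\operatorname{div}(\rho_s\boldsymbol u_s)=0,\quad\partial_tb+\pounds_{\boldsymbol u_s}b=0,\\ &\tfrac{\delta\ell}{\delta s_f}\bar D_t^fs_f=\boldsymbol f_f\cdot\boldsymbol u_f-\boldsymbol\sigma_f:\nabla\boldsymbol u_f-J_{fs}\big(\tfrac{\delta\ell}{\delta s_s}-\tfrac{\delta\ell}{\delta s_f}\big),\\ &\tfrac{\delta\ell}{\delta s_s}\bar D_t^ss_s=\boldsymbol f_s\cdot\boldsymbol u_s-\boldsymbol\sigma_s:\nabla\boldsymbol u_s-J_{sf}\big(\tfrac{\delta\ell}{\delta s_f}-\tfrac{\delta\ell}{\delta s_s}\big),\qquad\tfrac{\delta\ell}{\delta\phi}=0, \end{aligned}$$ together with $\bar D_t^k\sigma_k=\bar D_t^ks_k$ and $D_t^k\gamma_k=-\delta\ell/\delta s_k$, $k=f,s$. Under the no-slip condition for both constituents, conversely, these equations and conditions imply that the evolution is critical. (II) Let $\bar\rho_f=\rho_f/\phi$,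 $\bar\rho_s=\rho_s/(1-\phi)$, $\eta_k=s_k/\rho_k$, let $e_f(\bar\rho_f,\eta_f)$ and $e_s(\bar\rho_s,\eta_s,b)$ be smooth for positive density and symmetric positive definite $b$, and let $$\ell=\int_{\mathcal B}\Big[\tfrac12\rho_f|\boldsymbol u_f|^2-\rho_fe_f(\bar\rho_f,\eta_f)+\tfrac12\rho_s|\boldsymbol u_s|^2-\rho_se_s(\bar\rho_s,\eta_s,b)\Big]d^3\boldsymbol x.$$ This $\ell$ has functional derivatives, and $T_k:=-\delta\ell/\delta s_k=\partial e_k/\partial\eta_k$. If $T_k$ vanishes nowhere along the evolution and $\boldsymbol f_f=-\boldsymbol f_s=:\boldsymbol f$, $\boldsymbol\sigma_f=-\boldsymbol\sigma_s=:\boldsymbol\sigma$, then a critical evolution satisfies, with $\boldsymbol\sigma_{\rm el}=2\rho_s\frac{\partial e_s}{\partial b}\cdot b$, $$\begin{aligned} &\rho_f(\partial_t\boldsymbol u_f+\boldsymbol u_f\cdot\nabla\boldsymbol u_f)=-\phi\nabla p+\operatorname{div}\boldsymbol\sigma+\boldsymbol f,\\ &\rho_s(\partial_t\boldsymbol u_s+\boldsymbol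 u_s\cdot\nabla\boldsymbol u_s)=-(1-\phi)\nabla p+\operatorname{div}(\boldsymbol\sigma_{\rm el}-\boldsymbol\sigma)-\boldsymbol f,\\ &\partial_t\rho_f+\operatorname{div}(\rho_f\boldsymbol u_f)=0,\quad\partial_t\rho_s+\operatorname{div}(\rho_s\boldsymbol u_s)=0,\quad\partial_tb+\pounds_{\boldsymbol u_s}b=0,\\ &T_f\bar D_t^fs_f=-\boldsymbol f\cdot\boldsymbol u_f+\boldsymbol\sigma:\nabla\boldsymbol u_f-J_{fs}(T_s-T_f),\\ &T_s\bar D_t^ss_s=\boldsymbol f\cdot\boldsymbol u_s-\boldsymbol\sigma:\nabla\boldsymbol u_s-J_{sf}(T_f-T_s),\\ &p:=\bar\rho_f^2\frac{\partial e_f}{\partial\bar\rho_f}=\bar\rho_s^2\frac{\partial e_s}{\partial\bar\rho_s}, \end{aligned}$$ together with $\bar D_t^k\sigma_k=\bar D_t^ks_k$ and $D_t^k\gamma_k=T_k$. Under the no-slip condition for both constituents the converse holds as well. -/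

import Mathlib

open scoped ContDiff Topology
open Set

noncomputable section

namespace PorousMedia

/-! ### Vector calculus on Euclidean space of dimension three -/

/-- Physical space. -/
abbrev E3 := EuclideanSpace ℝ (Fin 3)

/-- Second-order tensors, by their components. -/
abbrev Mat3 := Fin 3 → Fin 3 → ℝ

/-- `f` is smooth on a neighbourhood of `A`: for a closed set `A` this is the usual notion of
smoothness on `A`, as the restriction of a smooth function. -/
def SmoothNear {E V : Type*} [NormedAddCommGroup E] [NormedSpace ℝ E] [NormedAddCommGroup V]
    [NormedSpace ℝ V] (f : E → V) (A : Set E) : Prop :=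
  ∃ U : Set E, IsOpen U ∧ A ⊆ U ∧ ContDiffOn ℝ ∞ f U

/-- A compact domain with smooth boundary `{g = 0}`, given as the sublevel set `{g ≤ 0}` of a smooth
function; `∇ g` is a nonzero outward normal along the boundary. -/
structure SmoothDomain where
  g : E3 → ℝ
  smooth : ContDiff ℝ ∞ g
  compact : IsCompact {x | g x ≤ 0}
  regular : ∀ x, g x = 0 → fderiv ℝ g x ≠ 0

/-- The points of the (closed) domain. -/
def SmoothDomain.pts (B : SmoothDomain) : Set E3 := {x | B.g x ≤ 0}

/-- The boundary points. -/
def SmoothDomain.bdry (B : SmoothDomain) : Set E3 := {x | B.g x = 0}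

/-- The partial derivative `∂ f / ∂ x_i`. -/
def pd (i : Fin 3) (f : E3 → ℝ) (x : E3) : ℝ := fderiv ℝ f x (EuclideanSpace.single i 1)

/-- The divergence of a vector field. -/
def dvg (v : E3 → E3) (x : E3) : ℝ := ∑ i, pd i (fun y => v y i) x

/-- The divergence of a tensor field, `(div A)_i = ∂_j A_ij`. -/
def dvgT (A : E3 → Mat3) (x : E3) : E3 :=
  WithLp.toLp 2 (fun i => ∑ j, pd j (fun y => A y i j) x)

/-- The Jacobian matrix `(∇ v)_ij = ∂_j v_i`. -/
def jac (v : E3 → E3) (x : E3) : Mat3 := fun i j => pd j (fun y => v y i) x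

/-- Full contraction `A : C`. -/
def ddot (A C : Mat3) : ℝ := ∑ i, ∑ j, A i j * C i j

/-- Matrix product `A · C`. -/
def mulT (A C : Mat3) : Mat3 := fun i j => ∑ k, A i k * C k j

/-- The covector `Π : ∇ b`, with components `Π_ij ∂_k b_ij`. -/
def contractGrad (Pi b : E3 → Mat3) (x : E3) : E3 :=
  WithLp.toLp 2 (fun k => ∑ i, ∑ j, Pi x i j * pd k (fun y => b y i j) x)

/-- The Lie derivative of a momentum density,
`(£_u m)_i = ∂_j m_i u_j + m_j ∂_i u_j + m_i ∂_j u_j`. -/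
def lieMomentum (u m : E3 → E3) (x : E3) : E3 :=
  WithLp.toLp 2 (fun i => ∑ j, (pd j (fun y => m y i) x * u x j
    + m x j * pd i (fun y => u y j) x + m x i * pd j (fun y => u y j) x))

/-- The Lie derivative of a two-contravariant tensor,
`(£_η b)^ij = ∂_k b^ij η^k - b^kj ∂_k η^i - b^ik ∂_k η^j`. -/
def lieTensor (η : E3 → E3) (b : E3 → Mat3) (x : E3) : Mat3 := fun i j =>
  ∑ k, (pd k (fun y => b y i j) x * η x k - b x k j * pd k (fun y => η y i) x
    - b x i k * pd k (fun y => η y j) x)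

/-- `D_t f = ∂_t f + u · ∇ f`. -/
def matD (u : ℝ → E3 → E3) (f : ℝ → E3 → ℝ) (t : ℝ) (x : E3) : ℝ :=
  deriv (fun τ => f τ x) t + fderiv ℝ (f t) x (u t x)

/-- `\bar D_t f = ∂_t f + div (f u)`. -/
def densD (u : ℝ → E3 → E3) (f : ℝ → E3 → ℝ) (t : ℝ) (x : E3) : ℝ :=
  deriv (fun τ => f τ x) t + dvg (fun y => f t y • u t y) x

/-- `D_δ f = δ f + η · ∇ f`. -/
def matVar (η : ℝ → E3 → E3) (δf f : ℝ → E3 → ℝ) (t : ℝ) (x : E3) : ℝ :=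
  δf t x + fderiv ℝ (f t) x (η t x)

/-- `\bar D_δ f = δ f + div (f η)`. -/
def densVar (η : ℝ → E3 → E3) (δf f : ℝ → E3 → ℝ) (t : ℝ) (x : E3) : ℝ :=
  δf t x + dvg (fun y => f t y • η t y) x

/-! ### Eulerian states, Lagrangians and functional derivatives -/

/-- The two constituents. -/
inductive Phase
  | fluid
  | solid

/-- The Eulerian fields `(u_f, u_s, ρ_f, ρ_s, s_f, s_s, b, φ)` at one instant; the same type holds
variations of such fields and functional derivatives with respect to them. Only the values on the
domain (and the germs there) matter. -/
structure State where
  u : Phase → E3 → E3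
  ρ : Phase → E3 → ℝ
  s : Phase → E3 → ℝ
  b : E3 → Mat3
  φ : E3 → ℝ

/-- Physical states: positive mass densities, volume fraction in `(0,1)`, symmetric positive definite
Finger tensor. -/
def State.Admissible (B : SmoothDomain) (X : State) : Prop :=
  ∀ x ∈ B.pts, (∀ k, 0 < X.ρ k x) ∧ 0 < X.φ x ∧ X.φ x < 1 ∧ (Matrix.of (X.b x)).PosDef

/-- The perturbed state `X + ε Y`. -/
def State.perturb (X Y : State) (ε : ℝ) : State where
  u k x := X.u k x + ε • Y.u k x
  ρ k x := X.ρ k x + ε * Y.ρ k x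
  s k x := X.s k x + ε * Y.s k x
  b x i j := X.b x i j + ε * Y.b x i j
  φ x := X.φ x + ε * Y.φ x

/-- The `L²` pairing over the domain. -/
def State.pairing (B : SmoothDomain) (D Y : State) : ℝ :=
  ∫ x in B.pts,
    (inner ℝ (D.u .fluid x) (Y.u .fluid x) + inner ℝ (D.u .solid x) (Y.u .solid x)
      + D.ρ .fluid x * Y.ρ .fluid x + D.ρ .solid x * Y.ρ .solid x
      + D.s .fluid x * Y.s .fluid x + D.s .solid x * Y.s .solid x
      + ddot (D.b x) (Y.b x) + D.φ x * Y.φ x)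

/-- The two-parameter family `Z` of states is smooth in the parameters and in space, near the
parameter `q` and near the domain. -/
structure SmoothFamilyAt (B : SmoothDomain) (Z : ℝ × ℝ → State) (q : ℝ × ℝ) : Prop where
  u : ∀ k, SmoothNear (fun p : (ℝ × ℝ) × E3 => (Z p.1).u k p.2) ({q} ×ˢ B.pts)
  ρ : ∀ k, SmoothNear (fun p : (ℝ × ℝ) × E3 => (Z p.1).ρ k p.2) ({q} ×ˢ B.pts)
  s : ∀ k, SmoothNear (fun p : (ℝ × ℝ) × E3 => (Z p.1).s k p.2) ({q} ×ˢ B.pts)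
  b : SmoothNear (fun p : (ℝ × ℝ) × E3 => (Z p.1).b p.2) ({q} ×ˢ B.pts)
  φ : SmoothNear (fun p : (ℝ × ℝ) × E3 => (Z p.1).φ p.2) ({q} ×ˢ B.pts)

/-- The derivative at `ε` of a curve of states. -/
def derivState (Z : ℝ → State) (ε : ℝ) : State where
  u k x := deriv (fun h => (Z h).u k x) ε
  ρ k x := deriv (fun h => (Z h).ρ k x) ε
  s k x := deriv (fun h => (Z h).s k x) ε
  b x i j := deriv (fun h => (Z h).b x i j) ε
  φ x := deriv (fun h => (Z h).φ x) ε

/-- `dℓ X = (δℓ/δu_f, …, δℓ/δφ)(X)` are the functional derivatives of the Lagrangian `ℓ`: along smooth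
families of admissible states the derivative of `ℓ` is the `L²` pairing with `dℓ`, `δℓ/δb` is symmetric
(it is dual to symmetric tensors), and `dℓ` takes smooth families to smooth families. -/
def IsFunctionalDerivative (B : SmoothDomain) (ℓ : State → ℝ) (dℓ : State → State) : Prop :=
  ∀ (Z : ℝ × ℝ → State) (t ε : ℝ), SmoothFamilyAt B Z (t, ε) →
    (∀ᶠ q in 𝓝 (t, ε), (Z q).Admissible B) →
      HasDerivAt (fun h => ℓ (Z (t, h)))
        (State.pairing B (dℓ (Z (t, ε))) (derivState (fun h => Z (t, h)) ε)) ε ∧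
      SmoothFamilyAt B (fun q => dℓ (Z q)) (t, ε) ∧
      ∀ x ∈ B.pts, ∀ i j, (dℓ (Z (t, ε))).b x i j = (dℓ (Z (t, ε))).b x j i

/-! ### Motions of the two constituents -/

/-- A space-time field is smooth on `[0,T] × A`. -/
def SmoothField {V : Type*} [NormedAddCommGroup V] [NormedSpace ℝ V] (T : ℝ) (A : Set E3)
    (f : ℝ → E3 → V) : Prop :=
  SmoothNear (fun p : ℝ × E3 => f p.1 p.2) (Icc 0 T ×ˢ A)

/-- A smooth time-dependent diffeomorphism of the reference configuration `R` onto `B`, with its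
inverse. -/
structure Motion (T : ℝ) (R B : SmoothDomain) where
  map : ℝ → E3 → E3
  inv : ℝ → E3 → E3
  smooth_map : SmoothField T R.pts map
  smooth_inv : SmoothField T B.pts inv
  mapsTo_map : ∀ t ∈ Icc 0 T, MapsTo (map t) R.pts B.pts
  mapsTo_inv : ∀ t ∈ Icc 0 T, MapsTo (inv t) B.pts R.pts
  invOn : ∀ t ∈ Icc 0 T, InvOn (inv t) (map t) R.pts B.pts

/-- The Eulerian velocity `∂_t φ ∘ φ⁻¹`. -/
def Motion.velocity {T : ℝ} {R B : SmoothDomain} (m : Motion T R B) (t : ℝ) (x : E3) : E3 :=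
  deriv (fun τ => m.map τ (m.inv t x)) t

/-- The transported density `(ρ₀ ∘ φ⁻¹) |det ∇ φ⁻¹|`. -/
def Motion.density {T : ℝ} {R B : SmoothDomain} (m : Motion T R B) (ρ₀ : E3 → ℝ) (t : ℝ) (x : E3) :
    ℝ :=
  ρ₀ (m.inv t x) * |(Matrix.of (jac (m.inv t) x)).det|

/-- The Finger deformation tensor `b = F Fᵀ` with `F = ∇ φ` at the label of `x`. -/
def Motion.finger {T : ℝ} {R B : SmoothDomain} (m : Motion T R B) (t : ℝ) (x : E3) : Mat3 :=
  fun i j => ∑ a, jac (m.map t) (m.inv t x) i a * jac (m.map t) (m.inv t x) j a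

/-- All variables of the variational formulation: the two motions with their reference mass densities,
the entropy densities `s_k`, the variables `σ_k` and `γ_k` (thermal displacements), and the volume
fraction `φ`. -/
structure Evolution (T : ℝ) (R : Phase → SmoothDomain) (B : SmoothDomain) where
  motion : ∀ k, Motion T (R k) B
  ρ₀ : Phase → E3 → ℝ
  s : Phase → ℝ → E3 → ℝ
  σ : Phase → ℝ → E3 → ℝ
  γ : Phase → ℝ → E3 → ℝ
  φ : ℝ → E3 → ℝ
  smooth_ρ₀ : ∀ k, SmoothNear (ρ₀ k) (R k).pts
  pos_ρ₀ : ∀ k, ∀ X ∈ (R k).pts, 0 < ρ₀ k X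
  smooth_s : ∀ k, SmoothField T B.pts (s k)
  smooth_σ : ∀ k, SmoothField T B.pts (σ k)
  smooth_γ : ∀ k, SmoothField T B.pts (γ k)
  smooth_φ : SmoothField T B.pts φ
  φ_mem : ∀ t ∈ Icc 0 T, ∀ x ∈ B.pts, φ t x ∈ Ioo (0 : ℝ) 1

/-- The friction forces `f_k`, the friction stresses, and the heat exchange flux `J_fs = J_sf`, as
space-time fields. -/
structure Friction (T : ℝ) (B : SmoothDomain) where
  f : Phase → ℝ → E3 → E3
  stress : Phase → ℝ → E3 → Mat3
  j : ℝ → E3 → ℝ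
  smooth_f : ∀ k, SmoothField T B.pts (f k)
  smooth_stress : ∀ k, SmoothField T B.pts (stress k)
  smooth_j : SmoothField T B.pts j

/-- The fluxes `J_kl`: `J_fs = J_sf` and `J_kk = - ∑_{l ≠ k} J_kl`. -/
def Friction.J {T : ℝ} {B : SmoothDomain} (F : Friction T B) : Phase → Phase → ℝ → E3 → ℝ
  | .fluid, .solid => F.j
  | .solid, .fluid => F.j
  | .fluid, .fluid => fun t x => - F.j t x
  | .solid, .solid => fun t x => - F.j t x

/-- Boundary conditions: free slip, no slip for both constituents, no slip for the solid only. -/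
inductive BoundaryCondition
  | freeSlip
  | noSlip
  | noSlipSolid

/-- The vector `v` at the boundary point `x` is compatible with the boundary condition for phase `k`:
tangent to the boundary (free slip), or zero (no slip). -/
def BoundaryCondition.Allows (B : SmoothDomain) : BoundaryCondition → Phase → E3 → E3 → Prop
  | .freeSlip, _, x, v => fderiv ℝ B.g x v = 0
  | .noSlip, _, _, v => v = 0
  | .noSlipSolid, .fluid, x, v => fderiv ℝ B.g x v = 0
  | .noSlipSolid, .solid, _, v => v = 0

section

variable {T : ℝ} {R : Phase → SmoothDomain} {B : SmoothDomain}

/-- The Eulerian velocity of phase `k`. -/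
def Evolution.u (P : Evolution T R B) (k : Phase) : ℝ → E3 → E3 := (P.motion k).velocity

/-- The Eulerian mass density of phase `k`. -/
def Evolution.ρ (P : Evolution T R B) (k : Phase) : ℝ → E3 → ℝ := (P.motion k).density (P.ρ₀ k)

/-- The Finger deformation tensor of the solid. -/
def Evolution.b (P : Evolution T R B) : ℝ → E3 → Mat3 := (P.motion .solid).finger

/-- The Eulerian state at time `t`. -/
def Evolution.state (P : Evolution T R B) (t : ℝ) : State where
  u k := P.u k t
  ρ k := P.ρ k t
  s k := P.s k t
  b := P.b t
  φ := P.φ t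

/-- The velocities satisfy the boundary condition. -/
def Evolution.SatisfiesBC (P : Evolution T R B) (bc : BoundaryCondition) : Prop :=
  ∀ t ∈ Icc 0 T, ∀ x ∈ B.bdry, ∀ k, bc.Allows B k x (P.u k t x)

/-! ### The variational formulation -/

/-- Free variations: `δφ_k` of the two diffeomorphisms, `δs_k`, `δσ_k`, `δγ_k` and `δφ` of the volume
fraction. -/
structure Variation where
  δmap : Phase → ℝ → E3 → E3
  δs : Phase → ℝ → E3 → ℝ
  δσ : Phase → ℝ → E3 → ℝ
  δγ : Phase → ℝ → E3 → ℝ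
  δφ : ℝ → E3 → ℝ

/-- `η_k = δφ_k ∘ φ_k⁻¹`. -/
def Variation.η (V : Variation) (P : Evolution T R B) (k : Phase) (t : ℝ) (x : E3) : E3 :=
  V.δmap k t ((P.motion k).inv t x)

/-- The induced (constrained) variation of the Eulerian state:
`δu_k = ∂_t η_k + u_k · ∇ η_k - η_k · ∇ u_k`, `δρ_k = - div (ρ_k η_k)`, `δb = - £_{η_s} b`, with
`δs_k` and `δφ` free. -/
def Variation.state (V : Variation) (P : Evolution T R B) (t : ℝ) : State where
  u k x := deriv (fun τ => V.η P k τ x) t + fderiv ℝ (V.η P k t) x (P.u k t x)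
    - fderiv ℝ (P.u k t) x (V.η P k t x)
  ρ k x := - dvg (fun y => P.ρ k t y • V.η P k t y) x
  s k := V.δs k t
  b x := - lieTensor (V.η P .solid t) (P.b t) x
  φ := V.δφ t

/-- The variational constraint for phase `k` at `(t,x)`. -/
def VariationalConstraint (dℓ : State → State) (F : Friction T B) (P : Evolution T R B)
    (V : Variation) (k : Phase) (t : ℝ) (x : E3) : Prop :=
  (dℓ (P.state t)).s k x * densVar (V.η P k) (V.δσ k) (P.σ k) t x
    = inner ℝ (F.f k t x) (V.η P k t x) - ddot (F.stress k t x) (jac (V.η P k t) x)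
      + (F.J k .fluid t x * matVar (V.η P .fluid) (V.δγ .fluid) (P.γ .fluid) t x
        + F.J k .solid t x * matVar (V.η P .solid) (V.δγ .solid) (P.γ .solid) t x)

/-- The phenomenological constraint for phase `k` at `(t,x)`. -/
def PhenomenologicalConstraint (dℓ : State → State) (F : Friction T B) (P : Evolution T R B)
    (k : Phase) (t : ℝ) (x : E3) : Prop :=
  (dℓ (P.state t)).s k x * densD (P.u k) (P.σ k) t x
    = inner ℝ (F.f k t x) (P.u k t x) - ddot (F.stress k t x) (jac (P.u k t) x)
      + (F.J k .fluid t x * matD (P.u .fluid) (P.γ .fluid) t x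
        + F.J k .solid t x * matD (P.u .solid) (P.γ .solid) t x)

/-- The variations over which the action is made stationary: smooth, compatible with the boundary
condition, with `δφ_k` and `δγ_k` vanishing at `t = 0, T`, and subject to the variational
constraints. -/
structure Variation.IsAllowed (V : Variation) (bc : BoundaryCondition) (dℓ : State → State)
    (F : Friction T B) (P : Evolution T R B) : Prop where
  smooth_map : ∀ k, SmoothField T (R k).pts (V.δmap k)
  smooth_s : ∀ k, SmoothField T B.pts (V.δs k)
  smooth_σ : ∀ k, SmoothField T B.pts (V.δσ k)
  smooth_γ : ∀ k, SmoothField T B.pts (V.δγ k)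
  smooth_φ : SmoothField T B.pts V.δφ
  boundary : ∀ t ∈ Icc 0 T, ∀ x ∈ B.bdry, ∀ k, bc.Allows B k x (V.η P k t x)
  map_ends : ∀ k, ∀ X ∈ (R k).pts, V.δmap k 0 X = 0 ∧ V.δmap k T X = 0
  γ_ends : ∀ k, ∀ x ∈ B.pts, V.δγ k 0 x = 0 ∧ V.δγ k T x = 0
  constraint : ∀ t ∈ Icc 0 T, ∀ x ∈ B.pts, ∀ k, VariationalConstraint dℓ F P V k t x

/-- The density `(s_k - σ_k) D_t^k γ_k` along the perturbed fields. -/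
def entropyDensity (P : Evolution T R B) (V : Variation) (ε : ℝ) (k : Phase) (t : ℝ) (x : E3) : ℝ :=
  ((P.s k t x + ε * V.δs k t x) - (P.σ k t x + ε * V.δσ k t x))
    * matD (fun τ => ((P.state τ).perturb (V.state P τ) ε).u k)
        (fun τ y => P.γ k τ y + ε * V.δγ k τ y) t x

/-- The action `∫₀ᵀ [ℓ + ∑_k ∫_B (s_k - σ_k) D_t^k γ_k dx] dt` at the fields perturbed by `ε` times
the variation. -/
def action (ℓ : State → ℝ) (P : Evolution T R B) (V : Variation) (ε : ℝ) : ℝ :=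
  ∫ t in (0 : ℝ)..T, (ℓ ((P.state t).perturb (V.state P t) ε)
    + ((∫ x in B.pts, entropyDensity P V ε .fluid t x)
      + ∫ x in B.pts, entropyDensity P V ε .solid t x))

/-- `P` solves the variational formulation: it satisfies the phenomenological constraints, and the
first variation of the action vanishes for all allowed variations. -/
structure IsCritical (bc : BoundaryCondition) (ℓ : State → ℝ) (dℓ : State → State)
    (F : Friction T B) (P : Evolution T R B) : Prop where
  phenomenological : ∀ t ∈ Icc 0 T, ∀ x ∈ B.pts, ∀ k, PhenomenologicalConstraint dℓ F P k t x
  stationary : ∀ V : Variation, V.IsAllowed bc dℓ F P → HasDerivAt (action ℓ P V) 0 0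

/-! ### The general system -/

/-- The conditions `\bar D_t^k σ_k = \bar D_t^k s_k` and `D_t^k γ_k = - δℓ/δs_k`. -/
def AuxiliaryConditions (dℓ : State → State) (P : Evolution T R B) : Prop :=
  ∀ t ∈ Icc 0 T, ∀ x ∈ B.pts, ∀ k,
    densD (P.u k) (P.σ k) t x = densD (P.u k) (P.s k) t x ∧
    matD (P.u k) (P.γ k) t x = - (dℓ (P.state t)).s k x

/-- The continuity equations for `ρ_f`, `ρ_s` and `b`. -/
structure ContinuityEquations (P : Evolution T R B) : Prop where
  mass : ∀ t ∈ Icc 0 T, ∀ x ∈ B.pts, ∀ k,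
    deriv (fun τ => P.ρ k τ x) t + dvg (fun y => P.ρ k t y • P.u k t y) x = 0
  finger : ∀ t ∈ Icc 0 T, ∀ x ∈ B.pts,
    deriv (fun τ => P.b τ x) t + lieTensor (P.u .solid t) (P.b t) x = 0

/-- The general system for the Lagrangian with functional derivatives `dℓ`. -/
structure GeneralSystem (dℓ : State → State) (F : Friction T B) (P : Evolution T R B) : Prop where
  momentum_fluid : ∀ t ∈ Icc 0 T, ∀ x ∈ B.pts,
    deriv (fun τ => (dℓ (P.state τ)).u .fluid x) t
        + lieMomentum (P.u .fluid t) ((dℓ (P.state t)).u .fluid) x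
      = P.ρ .fluid t x • gradient ((dℓ (P.state t)).ρ .fluid) x
        + P.s .fluid t x • gradient ((dℓ (P.state t)).s .fluid) x
        + dvgT (F.stress .fluid t) x + F.f .fluid t x
  momentum_solid : ∀ t ∈ Icc 0 T, ∀ x ∈ B.pts,
    deriv (fun τ => (dℓ (P.state τ)).u .solid x) t
        + lieMomentum (P.u .solid t) ((dℓ (P.state t)).u .solid) x
      = P.ρ .solid t x • gradient ((dℓ (P.state t)).ρ .solid) x
        + P.s .solid t x • gradient ((dℓ (P.state t)).s .solid) x
        - contractGrad (dℓ (P.state t)).b (P.b t) x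
        + dvgT (fun y => F.stress .solid t y
            - (2 : ℝ) • mulT ((dℓ (P.state t)).b y) (P.b t y)) x
        + F.f .solid t x
  continuity : ContinuityEquations P
  entropy_fluid : ∀ t ∈ Icc 0 T, ∀ x ∈ B.pts,
    (dℓ (P.state t)).s .fluid x * densD (P.u .fluid) (P.s .fluid) t x
      = inner ℝ (F.f .fluid t x) (P.u .fluid t x)
        - ddot (F.stress .fluid t x) (jac (P.u .fluid t) x)
        - F.J .fluid .solid t x
          * ((dℓ (P.state t)).s .solid x - (dℓ (P.state t)).s .fluid x)
  entropy_solid : ∀ t ∈ Icc 0 T, ∀ x ∈ B.pts,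
    (dℓ (P.state t)).s .solid x * densD (P.u .solid) (P.s .solid) t x
      = inner ℝ (F.f .solid t x) (P.u .solid t x)
        - ddot (F.stress .solid t x) (jac (P.u .solid t) x)
        - F.J .solid .fluid t x
          * ((dℓ (P.state t)).s .fluid x - (dℓ (P.state t)).s .solid x)
  volume_fraction : ∀ t ∈ Icc 0 T, ∀ x ∈ B.pts, (dℓ (P.state t)).φ x = 0

/-! ### The Lagrangian of the porous medium -/

/-- The specific internal energies `e_f(ρ̄_f, s_f/ρ_f)` and `e_s(ρ̄_s, s_s/ρ_s, b)`, smooth for positive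
density and symmetric positive definite `b`. -/
structure InternalEnergies where
  f : ℝ → ℝ → ℝ
  s : ℝ → ℝ → Mat3 → ℝ
  smooth_f : SmoothNear (fun p : ℝ × ℝ => f p.1 p.2) {p | 0 < p.1}
  smooth_s : SmoothNear (fun p : ℝ × ℝ × Mat3 => s p.1 p.2.1 p.2.2)
    {p | 0 < p.1 ∧ (Matrix.of p.2.2).PosDef}

/-- The actual density `ρ̄_f = ρ_f / φ`. -/
def State.barf (X : State) (x : E3) : ℝ := X.ρ .fluid x / X.φ x

/-- The actual density `ρ̄_s = ρ_s / (1 - φ)`. -/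
def State.bars (X : State) (x : E3) : ℝ := X.ρ .solid x / (1 - X.φ x)

/-- The specific entropy `s_k / ρ_k`. -/
def State.spec (X : State) (k : Phase) (x : E3) : ℝ := X.s k x / X.ρ k x

/-- The Lagrangian: kinetic energies minus internal energies. -/
def porousLagrangian (B : SmoothDomain) (e : InternalEnergies) (X : State) : ℝ :=
  ∫ x in B.pts,
    ((1 / 2 : ℝ) * X.ρ .fluid x * ‖X.u .fluid x‖ ^ 2
      - X.ρ .fluid x * e.f (X.barf x) (X.spec .fluid x)
      + (1 / 2 : ℝ) * X.ρ .solid x * ‖X.u .solid x‖ ^ 2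
      - X.ρ .solid x * e.s (X.bars x) (X.spec .solid x) (X.b x))

/-- `ρ̄_f² ∂e_f/∂ρ̄_f`. -/
def pressureFluid (e : InternalEnergies) (X : State) (x : E3) : ℝ :=
  X.barf x ^ 2 * deriv (fun r => e.f r (X.spec .fluid x)) (X.barf x)

/-- `ρ̄_s² ∂e_s/∂ρ̄_s`. -/
def pressureSolid (e : InternalEnergies) (X : State) (x : E3) : ℝ :=
  X.bars x ^ 2 * deriv (fun r => e.s r (X.spec .solid x) (X.b x)) (X.bars x)

/-- The temperatures `T_k = ∂e_k/∂η_k`, where `η_k` is the specific entropy. -/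
def temperature (e : InternalEnergies) (X : State) (x : E3) : Phase → ℝ
  | .fluid => deriv (fun h => e.f (X.barf x) h) (X.spec .fluid x)
  | .solid => deriv (fun h => e.s (X.bars x) h (X.b x)) (X.spec .solid x)

/-- `∂e_s/∂b`, the symmetric tensor that represents the derivative of `e_s` in the directions of
symmetric tensors. -/
def dedb (e : InternalEnergies) (X : State) (x : E3) : Mat3 := fun i j =>
  fderiv ℝ (fun c : Mat3 => e.s (X.bars x) (X.spec .solid x) c) (X.b x)
    (fun k l => (1 / 2 : ℝ) * ((if k = i ∧ l = j then 1 else 0) + (if k = j ∧ l = i then 1 else 0)))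

/-- The elastic stress `2 ρ_s ∂e_s/∂b · b`. -/
def elasticStress (e : InternalEnergies) (X : State) (x : E3) : Mat3 :=
  (2 * X.ρ .solid x) • mulT (dedb e X x) (X.b x)

/-- Friction with `f_f = - f_s = f` and `σ_f = - σ_s = σ`. -/
def Friction.IsInternal (F : Friction T B) : Prop :=
  ∀ t ∈ Icc 0 T, ∀ x ∈ B.pts,
    F.f .solid t x = - F.f .fluid t x ∧ F.stress .solid t x = - F.stress .fluid t x

/-- The system for the Lagrangian of the porous medium, with `f = F.f .fluid` and
`σ = F.stress .fluid`. The pressure `p` is the common value of the two terms in `pressure`. -/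
structure PorousSystem (e : InternalEnergies) (F : Friction T B) (P : Evolution T R B) : Prop where
  momentum_fluid : ∀ t ∈ Icc 0 T, ∀ x ∈ B.pts,
    P.ρ .fluid t x • (deriv (fun τ => P.u .fluid τ x) t
        + fderiv ℝ (P.u .fluid t) x (P.u .fluid t x))
      = - (P.φ t x • gradient (pressureFluid e (P.state t)) x)
        + dvgT (F.stress .fluid t) x + F.f .fluid t x
  momentum_solid : ∀ t ∈ Icc 0 T, ∀ x ∈ B.pts,
    P.ρ .solid t x • (deriv (fun τ => P.u .solid τ x) t
        + fderiv ℝ (P.u .solid t) x (P.u .solid t x))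
      = - ((1 - P.φ t x) • gradient (pressureFluid e (P.state t)) x)
        + dvgT (fun y => elasticStress e (P.state t) y - F.stress .fluid t y) x
        - F.f .fluid t x
  continuity : ContinuityEquations P
  entropy_fluid : ∀ t ∈ Icc 0 T, ∀ x ∈ B.pts,
    temperature e (P.state t) x .fluid * densD (P.u .fluid) (P.s .fluid) t x
      = - inner ℝ (F.f .fluid t x) (P.u .fluid t x)
        + ddot (F.stress .fluid t x) (jac (P.u .fluid t) x)
        - F.J .fluid .solid t x
          * (temperature e (P.state t) x .solid - temperature e (P.state t) x .fluid)
  entropy_solid : ∀ t ∈ Icc 0 T, ∀ x ∈ B.pts,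
    temperature e (P.state t) x .solid * densD (P.u .solid) (P.s .solid) t x
      = inner ℝ (F.f .fluid t x) (P.u .solid t x)
        - ddot (F.stress .fluid t x) (jac (P.u .solid t) x)
        - F.J .solid .fluid t x
          * (temperature e (P.state t) x .fluid - temperature e (P.state t) x .solid)
  pressure : ∀ t ∈ Icc 0 T, ∀ x ∈ B.pts,
    pressureFluid e (P.state t) x = pressureSolid e (P.state t) x

end

end PorousMedia

end

open PorousMedia

/-!
Up to boundary terms, which the no-slip condition removes, an evolution that satisfies the
phenomenological constraints is critical when the coefficients of its first variation vanish; the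
work lies in computing these coefficients and in recognizing them as the equations of motion.

*First variation.* Along an allowed variation the action is differentiable, by differentiation
under the integral over the compact space-time cylinder (`hasDerivAt_integral_lagrangian`,
`Variation.IsAllowed.hasDerivAt_action`). Multiplying out, the terms in `δσ` occur in the
combination `(δℓ/δs) (δσ + div (σ η))`, which the variational constraint replaces by forces and
stresses acting on `η`; since `J_ff = J_ss = - J_fs`, the exchange fluxes cancel in the sum over
the two constituents. Integration by parts (`slabIntegral_partsIntegrand`) removes the derivatives
from `η` and `δγ`. With the total momentum `M = δℓ/δu + (s - σ) ∇γ` there remain `δℓ/δφ`, `δℓ/δs +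
D_t γ`, the difference of the transport of `s` and of `σ`, and a momentum equation for `M` which
contains `σ ∇ δℓ/δs`; this is `Variation.IsAllowed.hasDerivAt_action_defects`. The divergence
theorem is needed only for functions that vanish on the boundary, and these have a Lipschitz
extension by zero (`SmoothDomain.integral_pd_eq_zero`).

*Criticality.* Because `δℓ/δs` has no zeros, the variational constraint can be solved for `δσ`, so
that `η`, `δγ`, `δs - δσ` and `δφ` may be prescribed freely (`exists_isAllowed`). Choosing for
them the coefficients of the first variation up to sign, for `η` and `δγ` multiplied by a weight
that vanishes on the boundary and at the end times, makes the first variation an integral of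
weighted squares; hence all coefficients vanish (`IsCritical.defectFree`). These test variations
are compatible with each of the boundary conditions. Conversely, under the no-slip condition all
boundary terms of the integration by parts vanish for every allowed variation
(`DefectFree.stationary`); under free slip the stresses may do work along the boundary.

*General system.* When `D_t γ = - δℓ/δs` and `s - σ` is conserved, the contribution of `(s - σ)
∇γ` to the momentum equation of `M` equals `- (s - σ) ∇ δℓ/δs`, which changes `σ ∇ δℓ/δs` into `s
∇ δℓ/δs` (`momentumDefect_eq`). The equations for `ρ` and `b` hold for every motion
(`Motion.density_continuity`, `Motion.finger_transport`): the Jacobians of the motion and of its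
inverse are stretched by the velocity gradient.

*Porous medium.* The Lagrangian has the functional derivatives `porousDeriv`
(`isFunctionalDerivative_porousDeriv`), and any others agree with them on the domain
(`IsFunctionalDerivative.eqOn`). By conservation of mass and the Gibbs relation
(`kinetic_identity`, `gibbs_identity`) the general system for these derivatives is the system of
the porous medium; `δℓ/δφ = 0` says that the two pressures agree.

Fields are smooth on a neighbourhood of the closed cylinder, so that derivatives on its boundary
are ordinary two-sided derivatives; they are determined by the values on the cylinder, which is
the closure of its interior (`SmoothField.uncurried_fderiv_eq`).
-/

open scoped ContDiff Topology
open Set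

noncomputable section

namespace PorousMedia

/-! ### Smooth fields -/

section SmoothNear

variable {E V W X : Type*} [NormedAddCommGroup E] [NormedSpace ℝ E] [NormedAddCommGroup V]
  [NormedSpace ℝ V] [NormedAddCommGroup W] [NormedSpace ℝ W]
  [NormedAddCommGroup X] [NormedSpace ℝ X]

/-- Smoothness on a neighbourhood of a set is local: this form is the one used for the closure
properties. -/
theorem smoothNear_iff {f : E → V} {A : Set E} :
    SmoothNear f A ↔ ∀ x ∈ A, ∀ᶠ y in 𝓝 x, ContDiffAt ℝ ∞ f y := by
  constructor
  · rintro ⟨U, hU, hAU, hf⟩ x hx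
    filter_upwards [hU.mem_nhds (hAU hx)] with y hy using hf.contDiffAt (hU.mem_nhds hy)
  · intro h
    refine ⟨{x | ∀ᶠ y in 𝓝 x, ContDiffAt ℝ ∞ f y}, isOpen_setOfPred_eventually_nhds, h, ?_⟩
    intro x hx
    exact (hx.self_of_nhds : ContDiffAt ℝ ∞ f x).contDiffWithinAt

variable {f g : E → V} {A : Set E}

theorem SmoothNear.contDiffAt (hf : SmoothNear f A) {x : E} (hx : x ∈ A) : ContDiffAt ℝ ∞ f x :=
  (smoothNear_iff.1 hf x hx).self_of_nhds

theorem SmoothNear.differentiableAt (hf : SmoothNear f A) {x : E} (hx : x ∈ A) :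
    DifferentiableAt ℝ f x :=
  (hf.contDiffAt hx).differentiableAt (by simp)

theorem SmoothNear.continuousAt (hf : SmoothNear f A) {x : E} (hx : x ∈ A) : ContinuousAt f x :=
  (hf.contDiffAt hx).continuousAt

theorem SmoothNear.continuousOn (hf : SmoothNear f A) : ContinuousOn f A :=
  fun _ hx => (hf.continuousAt hx).continuousWithinAt

theorem SmoothNear.of_contDiff (hf : ContDiff ℝ ∞ f) : SmoothNear f A :=
  smoothNear_iff.2 fun _ _ => .of_forall fun _ => hf.contDiffAt

theorem SmoothNear.congr (hf : SmoothNear f A) (h : ∀ x ∈ A, f =ᶠ[𝓝 x] g) : SmoothNear g A :=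
  smoothNear_iff.2 fun x hx => by
    filter_upwards [smoothNear_iff.1 hf x hx, (h x hx).eventuallyEq_nhds] with y hy h'
    exact hy.congr_of_eventuallyEq h'.symm

theorem SmoothNear.const (c : V) : SmoothNear (fun _ : E => c) A := .of_contDiff contDiff_const

theorem SmoothNear.add (hf : SmoothNear f A) (hg : SmoothNear g A) :
    SmoothNear (fun x => f x + g x) A :=
  smoothNear_iff.2 fun x hx => by
    filter_upwards [smoothNear_iff.1 hf x hx, smoothNear_iff.1 hg x hx] with y a b using a.add b

theorem SmoothNear.sub (hf : SmoothNear f A) (hg : SmoothNear g A) :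
    SmoothNear (fun x => f x - g x) A :=
  smoothNear_iff.2 fun x hx => by
    filter_upwards [smoothNear_iff.1 hf x hx, smoothNear_iff.1 hg x hx] with y a b using a.sub b

theorem SmoothNear.neg (hf : SmoothNear f A) : SmoothNear (fun x => - f x) A :=
  smoothNear_iff.2 fun x hx => by
    filter_upwards [smoothNear_iff.1 hf x hx] with y a using a.neg

theorem SmoothNear.smul {c : E → ℝ} (hc : SmoothNear c A) (hf : SmoothNear f A) :
    SmoothNear (fun x => c x • f x) A :=
  smoothNear_iff.2 fun x hx => by
    filter_upwards [smoothNear_iff.1 hc x hx, smoothNear_iff.1 hf x hx] with y a b using a.smul b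

theorem SmoothNear.mul {f g : E → ℝ} (hf : SmoothNear f A) (hg : SmoothNear g A) :
    SmoothNear (fun x => f x * g x) A :=
  smoothNear_iff.2 fun x hx => by
    filter_upwards [smoothNear_iff.1 hf x hx, smoothNear_iff.1 hg x hx] with y a b using a.mul b

theorem SmoothNear.sum {ι : Type*} {s : Finset ι} {f : ι → E → V}
    (hf : ∀ i, SmoothNear (f i) A) : SmoothNear (fun x => ∑ i ∈ s, f i x) A :=
  smoothNear_iff.2 fun x hx => by
    filter_upwards [(Filter.eventually_all_finset s).2 fun i _ => smoothNear_iff.1 (hf i) x hx]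
      with y a using ContDiffAt.sum fun i hi => a i hi

theorem SmoothNear.inv {f : E → ℝ} (hf : SmoothNear f A) (h0 : ∀ x ∈ A, f x ≠ 0) :
    SmoothNear (fun x => (f x)⁻¹) A :=
  smoothNear_iff.2 fun x hx => by
    filter_upwards [smoothNear_iff.1 hf x hx, (hf.continuousAt hx).eventually_ne (h0 x hx)]
      with y a b using a.inv b

theorem SmoothNear.div {f g : E → ℝ} (hf : SmoothNear f A) (hg : SmoothNear g A)
    (h0 : ∀ x ∈ A, g x ≠ 0) : SmoothNear (fun x => f x / g x) A := by
  simpa only [div_eq_mul_inv] using hf.mul (hg.inv h0)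

theorem SmoothNear.abs {f : E → ℝ} (hf : SmoothNear f A) (h0 : ∀ x ∈ A, f x ≠ 0) :
    SmoothNear (fun x => |f x|) A :=
  smoothNear_iff.2 fun x hx => by
    filter_upwards [smoothNear_iff.1 hf x hx, (hf.continuousAt hx).eventually_ne (h0 x hx)]
      with y a b using a.abs b

theorem SmoothNear.prodMk {g : E → W} (hf : SmoothNear f A) (hg : SmoothNear g A) :
    SmoothNear (fun x => (f x, g x)) A :=
  smoothNear_iff.2 fun x hx => by
    filter_upwards [smoothNear_iff.1 hf x hx, smoothNear_iff.1 hg x hx] with y a b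
      using a.prodMk b

theorem SmoothNear.comp {g : V → W} {B : Set V} (hg : SmoothNear g B) (hf : SmoothNear f A)
    (h : MapsTo f A B) : SmoothNear (fun x => g (f x)) A :=
  smoothNear_iff.2 fun x hx => by
    filter_upwards [smoothNear_iff.1 hf x hx,
      (hf.continuousAt hx).eventually (smoothNear_iff.1 hg _ (h hx))] with y a b
    exact ContDiffAt.comp y b a

theorem smoothNear_pi {ι : Type*} [Fintype ι] {f : E → ι → V} :
    SmoothNear f A ↔ ∀ i, SmoothNear (fun x => f x i) A := by
  simp only [smoothNear_iff, contDiffAt_pi]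
  constructor
  · intro h i x hx
    filter_upwards [h x hx] with y hy using hy i
  · intro h x hx
    exact Filter.eventually_all.2 fun i => h i x hx

theorem smoothNear_euclidean {f : E → E3} :
    SmoothNear f A ↔ ∀ i, SmoothNear (fun x => f x i) A := by
  simp only [smoothNear_iff, contDiffAt_euclidean]
  constructor
  · intro h i x hx
    filter_upwards [h x hx] with y hy using hy i
  · intro h x hx
    exact Filter.eventually_all.2 fun i => h i x hx

theorem smoothNear_mat {f : E → Mat3} :
    SmoothNear f A ↔ ∀ i j, SmoothNear (fun x => f x i j) A := by
  rw [smoothNear_pi]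
  exact forall_congr' fun i => smoothNear_pi

theorem SmoothNear.smooth_fderiv (hf : SmoothNear f A) : SmoothNear (fderiv ℝ f) A :=
  smoothNear_iff.2 fun x hx => by
    filter_upwards [smoothNear_iff.1 hf x hx] with y a
    exact a.fderiv_right (m := ∞) (by simp)

theorem SmoothNear.fderiv_apply (hf : SmoothNear f A) {v : E → E} (hv : SmoothNear v A) :
    SmoothNear (fun x => fderiv ℝ f x (v x)) A :=
  smoothNear_iff.2 fun x hx => by
    filter_upwards [smoothNear_iff.1 hf.smooth_fderiv x hx, smoothNear_iff.1 hv x hx] with y a b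
    exact a.clm_apply b

theorem SmoothNear.isSymmSndFDerivAt (hf : SmoothNear f A) {x : E} (hx : x ∈ A) :
    IsSymmSndFDerivAt ℝ f x :=
  (hf.contDiffAt hx).isSymmSndFDerivAt (by
    rw [minSmoothness_of_isRCLikeNormedField]; exact WithTop.coe_le_coe.2 le_top)

/-- Smooth functions that agree on a set with dense interior have the same derivative on it. -/
theorem SmoothNear.fderiv_eq (hf : SmoothNear f A) (hg : SmoothNear g A) (h : EqOn f g A)
    (hA : A ⊆ closure (interior A)) {x : E} (hx : x ∈ A) : fderiv ℝ f x = fderiv ℝ g x := by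
  have : EqOn (fderiv ℝ f) (fderiv ℝ g) A := by
    refine EqOn.of_subset_closure ?_ hf.smooth_fderiv.continuousOn hg.smooth_fderiv.continuousOn
      interior_subset hA
    intro y hy
    exact ((h.mono interior_subset).eventuallyEq_of_mem
      (isOpen_interior.mem_nhds hy)).fderiv_eq
  exact this hx

end SmoothNear

/-! ### Space-time fields on a domain -/

theorem SmoothDomain.isClosed_pts (B : SmoothDomain) : IsClosed B.pts := B.compact.isClosed

theorem SmoothDomain.isCompact_pts (B : SmoothDomain) : IsCompact B.pts := B.compact

theorem SmoothDomain.measurableSet_pts (B : SmoothDomain) : MeasurableSet B.pts :=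
  B.isClosed_pts.measurableSet

theorem SmoothDomain.bdry_subset (B : SmoothDomain) : B.bdry ⊆ B.pts := fun _ hx =>
  le_of_eq (α := ℝ) hx

theorem SmoothDomain.isOpen_neg (B : SmoothDomain) : IsOpen {x | B.g x < 0} :=
  isOpen_lt B.smooth.continuous continuous_const

theorem SmoothDomain.neg_subset_interior (B : SmoothDomain) : {x | B.g x < 0} ⊆ interior B.pts :=
  interior_maximal (fun _ hx => le_of_lt (α := ℝ) hx) B.isOpen_neg

/-- A boundary point is the limit of the points of `{g < 0}` on a ray along which `g` decreases. -/
theorem SmoothDomain.pts_subset_closure_neg (B : SmoothDomain) :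
    B.pts ⊆ closure {x | B.g x < 0} := by
  intro x hx
  rcases lt_or_eq_of_le (α := ℝ) hx with h | h
  · exact subset_closure h
  · obtain ⟨v, hv⟩ : ∃ v, fderiv ℝ B.g x v < 0 := by
      by_contra! hcon
      refine B.regular x h (ContinuousLinearMap.ext fun v => ?_)
      have h1 := hcon v
      have h2 := hcon (-v)
      simp only [map_neg] at h2
      simp only [zero_apply]
      linarith
    have hd : HasDerivAt (fun s : ℝ => B.g (x + s • v)) (fderiv ℝ B.g x v) 0 := by
      have := (B.smooth.differentiable (by simp) x).hasFDerivAt.hasLineDerivAt v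
      exact this
    have hslope := hd.tendsto_slope_zero_right
    have hev := hslope.eventually (gt_mem_nhds hv)
    have hlim : Filter.Tendsto (fun s : ℝ => x + s • v) (𝓝[>] 0) (𝓝 x) := by
      have : Filter.Tendsto (fun s : ℝ => x + s • v) (𝓝 0) (𝓝 (x + (0 : ℝ) • v)) := by
        apply Continuous.tendsto; fun_prop
      rw [zero_smul, add_zero] at this
      exact this.mono_left nhdsWithin_le_nhds
    refine mem_closure_of_tendsto hlim ?_
    filter_upwards [hev, self_mem_nhdsWithin] with s hs hs0
    have hs0' : (0 : ℝ) < s := hs0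
    simp only [zero_add, zero_smul, add_zero, h, sub_zero, smul_eq_mul] at hs
    show B.g (x + s • v) < 0
    by_contra! hc
    exact absurd hs (not_lt.2 (mul_nonneg (inv_nonneg.2 hs0'.le) hc))

theorem SmoothDomain.pts_subset_closure_interior (B : SmoothDomain) :
    B.pts ⊆ closure (interior B.pts) :=
  B.pts_subset_closure_neg.trans (closure_mono B.neg_subset_interior)

/-- The space-time cylinder `[0,T] × B`. -/
abbrev cyl (T : ℝ) (B : SmoothDomain) : Set (ℝ × E3) := Icc 0 T ×ˢ B.pts

theorem isCompact_cyl (T : ℝ) (B : SmoothDomain) : IsCompact (cyl T B) :=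
  isCompact_Icc.prod B.isCompact_pts

theorem cyl_subset_closure_interior {T : ℝ} (hT : 0 < T) (B : SmoothDomain) :
    cyl T B ⊆ closure (interior (cyl T B)) := by
  rw [interior_prod_eq, closure_prod_eq, interior_Icc, closure_Ioo hT.ne]
  exact prod_mono le_rfl B.pts_subset_closure_interior

section SmoothField

variable {V : Type*} [NormedAddCommGroup V] [NormedSpace ℝ V] {T : ℝ} {A : Set E3}
  {f g : ℝ → E3 → V} {t : ℝ} {x : E3}

theorem SmoothField.add (hf : SmoothField T A f)
    (hg : SmoothField T A g) : SmoothField T A (fun t x => f t x + g t x) := SmoothNear.add hf hg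

theorem SmoothField.sub (hf : SmoothField T A f) (hg : SmoothField T A g) :
    SmoothField T A (fun t x => f t x - g t x) := SmoothNear.sub hf hg

theorem SmoothField.neg (hf : SmoothField T A f) : SmoothField T A (fun t x => - f t x) :=
  SmoothNear.neg hf

theorem SmoothField.mul {f g : ℝ → E3 → ℝ} (hf : SmoothField T A f) (hg : SmoothField T A g) :
    SmoothField T A (fun t x => f t x * g t x) := SmoothNear.mul hf hg

theorem SmoothField.const (c : V) : SmoothField T A (fun _ _ => c) := SmoothNear.const c

theorem SmoothField.id : SmoothField T A (fun _ x => x) := .of_contDiff contDiff_snd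

theorem SmoothField.sum {ι : Type*} {s : Finset ι} {f : ι → ℝ → E3 → V}
    (hf : ∀ i, SmoothField T A (f i)) : SmoothField T A (fun t x => ∑ i ∈ s, f i t x) :=
  SmoothNear.sum hf

theorem SmoothField.div {f g : ℝ → E3 → ℝ} (hf : SmoothField T A f) (hg : SmoothField T A g)
    (h0 : ∀ t ∈ Icc 0 T, ∀ x ∈ A, g t x ≠ 0) : SmoothField T A (fun t x => f t x / g t x) :=
  SmoothNear.div hf hg fun p hp => h0 p.1 hp.1 p.2 hp.2

theorem SmoothField.smul {c : ℝ → E3 → ℝ} (hc : SmoothField T A c) (hf : SmoothField T A f) :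
    SmoothField T A (fun t x => c t x • f t x) := SmoothNear.smul hc hf

theorem smoothField_euclidean {f : ℝ → E3 → E3} :
    SmoothField T A f ↔ ∀ i, SmoothField T A (fun t x => f t x i) := smoothNear_euclidean

theorem smoothField_mat {f : ℝ → E3 → Mat3} :
    SmoothField T A f ↔ ∀ i j, SmoothField T A (fun t x => f t x i j) := smoothNear_mat

theorem SmoothField.apply {f : ℝ → E3 → E3} (hf : SmoothField T A f) (i : Fin 3) :
    SmoothField T A (fun t x => f t x i) := smoothField_euclidean.1 hf i

theorem SmoothField.apply₂ {f : ℝ → E3 → Mat3} (hf : SmoothField T A f) (i j : Fin 3) :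
    SmoothField T A (fun t x => f t x i j) := smoothField_mat.1 hf i j

theorem deriv_eq_fderiv_uncurried (h : DifferentiableAt ℝ (fun p : ℝ × E3 => f p.1 p.2) (t, x)) :
    deriv (fun τ => f τ x) t = fderiv ℝ (fun p : ℝ × E3 => f p.1 p.2) (t, x) (1, 0) := by
  have h1 : HasFDerivAt (fun τ : ℝ => (τ, x)) ((ContinuousLinearMap.id ℝ ℝ).prod 0) t :=
    (hasFDerivAt_id t).prodMk (hasFDerivAt_const x t)
  have := (h.hasFDerivAt.comp t h1).hasDerivAt
  have h2 : deriv (fun τ => f τ x) t = _ := this.deriv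
  rw [h2]; simp

theorem fderiv_eq_fderiv_uncurried (h : DifferentiableAt ℝ (fun p : ℝ × E3 => f p.1 p.2) (t, x))
    (w : E3) :
    fderiv ℝ (f t) x w = fderiv ℝ (fun p : ℝ × E3 => f p.1 p.2) (t, x) (0, w) := by
  have h1 : HasFDerivAt (fun y : E3 => (t, y))
      ((0 : E3 →L[ℝ] ℝ).prod (ContinuousLinearMap.id ℝ E3)) x :=
    (hasFDerivAt_const t x).prodMk (hasFDerivAt_id x)
  have := h.hasFDerivAt.comp x h1
  have h2 : fderiv ℝ (f t) x = _ := this.fderiv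
  rw [h2]; simp

theorem SmoothField.differentiableAt (hf : SmoothField T A f) (ht : t ∈ Icc 0 T) (hx : x ∈ A) :
    DifferentiableAt ℝ (fun p : ℝ × E3 => f p.1 p.2) (t, x) :=
  SmoothNear.differentiableAt hf (mk_mem_prod ht hx)

theorem SmoothField.differentiableAt_time (hf : SmoothField T A f) (ht : t ∈ Icc 0 T)
    (hx : x ∈ A) : DifferentiableAt ℝ (fun τ => f τ x) t := by
  have h := hf.differentiableAt ht hx
  exact h.comp t (f := fun τ : ℝ => (τ, x)) (by fun_prop)

theorem SmoothField.differentiableAt_space (hf : SmoothField T A f) (ht : t ∈ Icc 0 T)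
    (hx : x ∈ A) : DifferentiableAt ℝ (f t) x := by
  have h := hf.differentiableAt ht hx
  exact h.comp x (f := fun y : E3 => (t, y)) (by fun_prop)

theorem SmoothField.timeDeriv (hf : SmoothField T A f) :
    SmoothField T A (fun t x => deriv (fun τ => f τ x) t) := by
  refine (SmoothNear.fderiv_apply hf (SmoothNear.const (1, 0))).congr fun p hp => ?_
  filter_upwards [smoothNear_iff.1 hf p hp] with q hq
  exact (deriv_eq_fderiv_uncurried (hq.differentiableAt (by simp))).symm

theorem SmoothField.spaceDeriv (hf : SmoothField T A f) {w : ℝ → E3 → E3}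
    (hw : SmoothField T A w) : SmoothField T A (fun t x => fderiv ℝ (f t) x (w t x)) := by
  refine (SmoothNear.fderiv_apply hf (v := fun p => (0, w p.1 p.2))
    ((SmoothNear.const 0).prodMk hw)).congr fun p hp => ?_
  filter_upwards [smoothNear_iff.1 hf p hp] with q hq
  exact (fderiv_eq_fderiv_uncurried (hq.differentiableAt (by simp)) _).symm

theorem SmoothField.pderiv {f : ℝ → E3 → ℝ} (hf : SmoothField T A f) (i : Fin 3) :
    SmoothField T A (fun t x => pd i (f t) x) :=
  hf.spaceDeriv (w := fun _ _ => EuclideanSpace.single i 1) (SmoothNear.const _)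

theorem SmoothField.of_space {f : E3 → V} (hf : SmoothNear f A) :
    SmoothField T A (fun _ x => f x) :=
  SmoothNear.comp hf (.of_contDiff contDiff_snd) fun p (hp : p ∈ Icc 0 T ×ˢ A) => hp.2

/-- Partial derivatives in time and space commute. -/
theorem SmoothField.deriv_pd {f : ℝ → E3 → ℝ} (hf : SmoothField T A f) (ht : t ∈ Icc 0 T)
    (hx : x ∈ A) (i : Fin 3) :
    deriv (fun τ => pd i (f τ) x) t
      = pd i (fun y => deriv (fun τ => f τ y) t) x := by
  have hev := smoothNear_iff.1 hf (t, x) (mk_mem_prod ht hx)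
  have hd : DifferentiableAt ℝ (fderiv ℝ (fun p : ℝ × E3 => f p.1 p.2)) (t, x) :=
    (SmoothNear.smooth_fderiv hf).differentiableAt (mk_mem_prod ht hx)
  have key : ∀ v w : ℝ × E3, fderiv ℝ (fun p => fderiv ℝ
      (fun p : ℝ × E3 => f p.1 p.2) p v) (t, x) w
      = fderiv ℝ (fderiv ℝ (fun p : ℝ × E3 => f p.1 p.2)) (t, x) w v := by
    intro v w
    rw [fderiv_clm_apply hd (differentiableAt_const v)]
    simp
  have h1 := deriv_eq_fderiv_uncurried (f := fun t x => pd i (f t) x)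
    ((hf.pderiv i).differentiableAt ht hx)
  have h2 := fderiv_eq_fderiv_uncurried
    (f := fun t x => deriv (fun τ => f τ x) t) (hf.timeDeriv.differentiableAt ht hx)
    (EuclideanSpace.single i 1)
  show deriv (fun τ => pd i (f τ) x) t = fderiv ℝ _ x _
  rw [h1, h2]
  have e1 : (fun p : ℝ × E3 => pd i (f p.1) p.2) =ᶠ[𝓝 (t, x)]
      fun p => fderiv ℝ (fun p : ℝ × E3 => f p.1 p.2) p (0, EuclideanSpace.single i 1) := by
    filter_upwards [hev] with q hq
    exact fderiv_eq_fderiv_uncurried (hq.differentiableAt (by simp)) _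
  have e2 : (fun p : ℝ × E3 => deriv (fun τ => f τ p.2) p.1) =ᶠ[𝓝 (t, x)]
      fun p => fderiv ℝ (fun p : ℝ × E3 => f p.1 p.2) p (1, 0) := by
    filter_upwards [hev] with q hq
    exact deriv_eq_fderiv_uncurried (hq.differentiableAt (by simp))
  rw [e1.fderiv_eq, e2.fderiv_eq, key, key]
  exact (SmoothNear.isSymmSndFDerivAt hf (mk_mem_prod ht hx)) _ _

/-- Partial derivatives in space commute. -/
theorem SmoothField.pd_pd {f : ℝ → E3 → ℝ} (hf : SmoothField T A f) (ht : t ∈ Icc 0 T)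
    (hx : x ∈ A) (i j : Fin 3) :
    pd i (pd j (f t)) x = pd j (pd i (f t)) x := by
  have hs : SmoothNear (f t) A := SmoothNear.comp hf (f := fun y : E3 => (t, y))
    (.of_contDiff (by fun_prop)) fun y hy => mk_mem_prod ht hy
  have hd := hs.smooth_fderiv.differentiableAt hx
  have key : ∀ v w : E3, fderiv ℝ (fun p => fderiv ℝ (f t) p v) x w
      = fderiv ℝ (fderiv ℝ (f t)) x w v := by
    intro v w
    rw [fderiv_clm_apply hd (differentiableAt_const v)]
    simp
  show fderiv ℝ (fun p => fderiv ℝ (f t) p _) x _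
    = fderiv ℝ (fun p => fderiv ℝ (f t) p _) x _
  rw [key, key]
  exact hs.isSymmSndFDerivAt hx _ _

end SmoothField

section Agree

variable {V : Type*} [NormedAddCommGroup V] [NormedSpace ℝ V] {T : ℝ} {B : SmoothDomain}
  {f g : ℝ → E3 → V} {t : ℝ} {x : E3}

/-- Derivatives on the cylinder of a smooth field are determined by its values there. -/
theorem SmoothField.uncurried_fderiv_eq (hT : 0 < T) (hf : SmoothField T B.pts f)
    (hg : SmoothField T B.pts g) (h : ∀ t ∈ Icc 0 T, ∀ x ∈ B.pts, f t x = g t x)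
    (ht : t ∈ Icc 0 T) (hx : x ∈ B.pts) :
    fderiv ℝ (fun p : ℝ × E3 => f p.1 p.2) (t, x) = fderiv ℝ (fun p : ℝ × E3 => g p.1 p.2) (t, x) :=
  SmoothNear.fderiv_eq hf hg (fun p hp => h p.1 hp.1 p.2 hp.2)
    (cyl_subset_closure_interior hT B) (mk_mem_prod ht hx)

theorem SmoothField.deriv_eq (hT : 0 < T) (hf : SmoothField T B.pts f)
    (hg : SmoothField T B.pts g) (h : ∀ t ∈ Icc 0 T, ∀ x ∈ B.pts, f t x = g t x)
    (ht : t ∈ Icc 0 T) (hx : x ∈ B.pts) :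
    deriv (fun τ => f τ x) t = deriv (fun τ => g τ x) t := by
  rw [deriv_eq_fderiv_uncurried (hf.differentiableAt ht hx),
    deriv_eq_fderiv_uncurried (hg.differentiableAt ht hx), hf.uncurried_fderiv_eq hT hg h ht hx]

theorem SmoothField.fderiv_eq (hT : 0 < T) (hf : SmoothField T B.pts f)
    (hg : SmoothField T B.pts g) (h : ∀ t ∈ Icc 0 T, ∀ x ∈ B.pts, f t x = g t x)
    (ht : t ∈ Icc 0 T) (hx : x ∈ B.pts) : fderiv ℝ (f t) x = fderiv ℝ (g t) x := by
  ext w : 1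
  rw [fderiv_eq_fderiv_uncurried (hf.differentiableAt ht hx),
    fderiv_eq_fderiv_uncurried (hg.differentiableAt ht hx), hf.uncurried_fderiv_eq hT hg h ht hx]

theorem SmoothField.pd_eq (hT : 0 < T) {f g : ℝ → E3 → ℝ} (hf : SmoothField T B.pts f)
    (hg : SmoothField T B.pts g) (h : ∀ t ∈ Icc 0 T, ∀ x ∈ B.pts, f t x = g t x)
    (ht : t ∈ Icc 0 T) (hx : x ∈ B.pts) (i : Fin 3) : pd i (f t) x = pd i (g t) x := by
  unfold pd
  rw [hf.fderiv_eq hT hg h ht hx]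

end Agree

/-! ### Partial derivatives -/

section pd

variable {f g : E3 → ℝ} {x : E3} {i : Fin 3}

theorem pd_add (hf : DifferentiableAt ℝ f x) (hg : DifferentiableAt ℝ g x) :
    pd i (fun y => f y + g y) x = pd i f x + pd i g x := by
  simp [pd, fderiv_fun_add hf hg]

theorem pd_sub (hf : DifferentiableAt ℝ f x) (hg : DifferentiableAt ℝ g x) :
    pd i (fun y => f y - g y) x = pd i f x - pd i g x := by
  simp [pd, fderiv_fun_sub hf hg]

theorem pd_neg : pd i (fun y => - f y) x = - pd i f x := by
  simp [pd, fderiv_fun_neg]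

theorem pd_mul (hf : DifferentiableAt ℝ f x) (hg : DifferentiableAt ℝ g x) :
    pd i (fun y => f y * g y) x = pd i f x * g x + f x * pd i g x := by
  simp [pd, fderiv_fun_mul hf hg]; ring

theorem pd_const_mul (c : ℝ) (hf : DifferentiableAt ℝ f x) :
    pd i (fun y => c * f y) x = c * pd i f x := by
  simp [pd, fderiv_const_mul hf]

theorem pd_sum {ι : Type*} {s : Finset ι} {f : ι → E3 → ℝ}
    (hf : ∀ j, DifferentiableAt ℝ (f j) x) :
    pd i (fun y => ∑ j ∈ s, f j y) x = ∑ j ∈ s, pd i (f j) x := by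
  simp [pd, fderiv_fun_sum fun j _ => hf j]

/-- A directional derivative is the combination of the partial derivatives. -/
theorem fderiv_eq_sum_pd (f : E3 → ℝ) (x v : E3) : fderiv ℝ f x v = ∑ i, pd i f x * v i := by
  conv_lhs => rw [← (EuclideanSpace.basisFun (Fin 3) ℝ).sum_repr v]
  simp [pd, mul_comm]

theorem fderiv_comp_eq_sum_pd {f : E3 → E3} (hf : DifferentiableAt ℝ f x) (v : E3) (i : Fin 3) :
    fderiv ℝ f x v i = ∑ j, pd j (fun y => f y i) x * v j := by
  rw [← fderiv_eq_sum_pd]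
  have := (EuclideanSpace.proj i : E3 →L[ℝ] ℝ).hasFDerivAt.comp x
    hf.hasFDerivAt
  have h2 : fderiv ℝ (fun y => f y i) x = _ := this.fderiv
  rw [h2]; simp

theorem deriv_comp_apply {f : ℝ → E3} {t : ℝ} (hf : DifferentiableAt ℝ f t) (i : Fin 3) :
    deriv f t i = deriv (fun τ => f τ i) t := by
  have := (EuclideanSpace.proj i : E3 →L[ℝ] ℝ).hasFDerivAt.comp_hasDerivAt t
    hf.hasDerivAt
  exact this.deriv.symm

theorem deriv_apply₂ {f : ℝ → Mat3} {t : ℝ}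
    (hf : ∀ i j, DifferentiableAt ℝ (fun τ => f τ i j) t) (i j : Fin 3) :
    deriv f t i j = deriv (fun τ => f τ i j) t := by
  have h := hasDerivAt_pi.2 fun i => hasDerivAt_pi.2 fun j => (hf i j).hasDerivAt
  have h' : HasDerivAt f (fun i j => deriv (fun τ => f τ i j) t) t := h
  rw [h'.deriv]

theorem gradient_apply (f : E3 → ℝ) (x : E3) (i : Fin 3) : gradient f x i = pd i f x := by
  have h : inner ℝ (gradient f x) (EuclideanSpace.single i (1 : ℝ)) = pd i f x := by
    simp only [gradient, InnerProductSpace.toDual_symm_apply, pd]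
  rw [EuclideanSpace.inner_single_right] at h
  simpa only [one_mul, conj_trivial] using h

theorem inner_eq_sum (v w : E3) : inner ℝ v w = ∑ i, v i * w i := by
  simp [PiLp.inner_apply, mul_comm]

end pd

/-! ### Integration over the domain -/

open MeasureTheory

/-- The boundary is a null set: near it the identity agrees, along the boundary, with a map whose
differential is singular, since the defining function is constant there. -/
theorem SmoothDomain.volume_bdry (B : SmoothDomain) : volume B.bdry = 0 := by
  have hv : ∀ x : E3, ∃ v : E3, x ∈ B.bdry → fderiv ℝ B.g x v = 1 := by
    intro x
    by_cases hx : x ∈ B.bdry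
    · obtain ⟨v, hv⟩ : ∃ v, fderiv ℝ B.g x v ≠ 0 := by
        by_contra! hcon
        exact B.regular x hx (ContinuousLinearMap.ext hcon)
      exact ⟨(fderiv ℝ B.g x v)⁻¹ • v, fun _ => by simp [hv]⟩
    · exact ⟨0, fun h => absurd h hx⟩
  choose v hv using hv
  have key := addHaar_image_eq_zero_of_det_fderivWithin_eq_zero (volume : Measure E3)
    (s := B.bdry) (f := fun x => x)
    (f' := fun x => ContinuousLinearMap.id ℝ E3 - (fderiv ℝ B.g x).smulRight (v x)) ?_ ?_
  · simpa using key
  · intro x hx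
    have h1 : HasFDerivWithinAt (fun y => B.g y • v x) ((fderiv ℝ B.g x).smulRight (v x))
        B.bdry x :=
      ((B.smooth.differentiable (by simp) x).hasFDerivAt.smul_const (v x)).hasFDerivWithinAt
    have h2 := (hasFDerivWithinAt_id x B.bdry).sub h1
    refine h2.congr (fun y hy => ?_) ?_
    · simp [show B.g y = 0 from hy]
    · simp [show B.g x = 0 from hx]
  · intro x hx
    by_contra hdet
    have hker : (ContinuousLinearMap.id ℝ E3 - (fderiv ℝ B.g x).smulRight (v x)) (v x) = 0 := by
      simp [hv x hx]
    have hz : v x = 0 := by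
      let e := ContinuousLinearMap.toContinuousLinearEquivOfDetNeZero _ hdet
      have : e (v x) = 0 := hker
      exact e.map_eq_zero_iff.1 this
    have := hv x hx
    simp [hz] at this

/-- The extension by zero of a smooth function that vanishes on the boundary is Lipschitz. -/
theorem SmoothDomain.lipschitz_indicator (B : SmoothDomain) {w : E3 → ℝ}
    (hw : SmoothNear w B.pts) (h0 : ∀ x ∈ B.bdry, w x = 0) :
    ∃ C, LipschitzWith C (B.pts.indicator w) := by
  obtain ⟨C, hC⟩ : ∃ C, LipschitzOnWith C w B.pts := by
    refine LocallyLipschitzOn.exists_lipschitzOnWith_of_compact B.isCompact_pts fun x hx => ?_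
    obtain ⟨K, t, ht, hK⟩ := ((hw.contDiffAt hx).of_le (m := 1)
      (by exact_mod_cast le_top)).exists_lipschitzOnWith
    exact ⟨K, t, mem_nhdsWithin_of_mem_nhds ht, hK⟩
  -- A segment that leaves the domain meets the boundary, where `w` vanishes.
  have main : ∀ x ∈ B.pts, ∀ y ∉ B.pts, |w x| ≤ C * dist x y := by
    intro x hx y hy
    have hc : ContinuousOn (fun s : ℝ => B.g (AffineMap.lineMap x y s)) (Icc 0 1) :=
      (B.smooth.continuous.comp AffineMap.lineMap_continuous).continuousOn
    have hy' : 0 < B.g y := not_le.1 hy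
    obtain ⟨s, hs, hs0⟩ := intermediate_value_Icc (zero_le_one (α := ℝ)) hc
      (show (0 : ℝ) ∈ _ by simp only [AffineMap.lineMap_apply_zero, AffineMap.lineMap_apply_one]
                           exact ⟨hx, hy'.le⟩)
    set z := AffineMap.lineMap x y s with hz
    have hzb : z ∈ B.bdry := hs0
    have h1 := hC.dist_le_mul x hx z (B.bdry_subset hzb)
    rw [h0 z hzb, dist_zero_right, Real.norm_eq_abs] at h1
    refine h1.trans (mul_le_mul_of_nonneg_left ?_ C.2)
    rw [hz, dist_left_lineMap, Real.norm_eq_abs, abs_of_nonneg hs.1]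
    exact mul_le_of_le_one_left dist_nonneg hs.2
  refine ⟨C, LipschitzWith.of_dist_le_mul fun x y => ?_⟩
  by_cases hx : x ∈ B.pts <;> by_cases hy : y ∈ B.pts
  · rw [indicator_of_mem hx, indicator_of_mem hy]
    exact hC.dist_le_mul x hx y hy
  · rw [indicator_of_mem hx, indicator_of_notMem hy, dist_zero_right]
    exact main x hx y hy
  · rw [indicator_of_notMem hx, indicator_of_mem hy, dist_zero_left, dist_comm]
    exact main y hy x hx
  · rw [indicator_of_notMem hx, indicator_of_notMem hy, dist_self]
    positivity

/-- The divergence theorem for functions that vanish on the boundary. -/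
theorem SmoothDomain.integral_pd_eq_zero (B : SmoothDomain) {w : E3 → ℝ}
    (hw : SmoothNear w B.pts) (h0 : ∀ x ∈ B.bdry, w x = 0) (i : Fin 3) :
    ∫ x in B.pts, pd i w x = 0 := by
  obtain ⟨C, hC⟩ := B.lipschitz_indicator hw h0
  have hsupp : HasCompactSupport (B.pts.indicator w) :=
    HasCompactSupport.intro B.isCompact_pts fun x hx => indicator_of_notMem hx _
  have hconst : LipschitzWith 0 (fun _ : E3 => (1 : ℝ)) := LipschitzWith.const 1
  -- Integration by parts against the constant function `1`, for Lipschitz functions.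
  have key := hconst.integral_lineDeriv_mul_eq hC hsupp (μ := volume)
    (-(EuclideanSpace.single i (1 : ℝ)))
  simp only [neg_neg, mul_one] at key
  have hl : ∀ v : E3, ∀ x, lineDeriv ℝ (fun _ : E3 => (1 : ℝ)) x v = 0 := fun v x => by
    simp [lineDeriv]
  simp only [hl, zero_mul, integral_zero] at key
  rw [← integral_indicator B.measurableSet_pts, key]
  refine integral_congr_ae ?_
  have hnull : ∀ᵐ x : E3, x ∉ B.bdry := measure_eq_zero_iff_ae_notMem.1 B.volume_bdry
  -- Off the boundary the extension by zero is locally either `w` or `0`.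
  filter_upwards [hnull] with x hx
  rcases lt_trichotomy (B.g x) 0 with hlt | heq | hgt
  · have hx' : x ∈ B.pts := hlt.le
    have hev : B.pts.indicator w =ᶠ[𝓝 x] w := by
      filter_upwards [B.isOpen_neg.mem_nhds hlt] with y hy
      exact indicator_of_mem (show y ∈ B.pts from le_of_lt (α := ℝ) hy) _
    have hd : DifferentiableAt ℝ (B.pts.indicator w) x :=
      hev.differentiableAt_iff.2 (hw.differentiableAt hx')
    rw [indicator_of_mem hx', hd.lineDeriv_eq_fderiv, hev.fderiv_eq, pd]
  · exact absurd heq hx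
  · have hx' : x ∉ B.pts := not_le.2 hgt
    have hev : B.pts.indicator w =ᶠ[𝓝 x] fun _ => 0 := by
      filter_upwards [B.isClosed_pts.isOpen_compl.mem_nhds hx'] with y hy
      exact indicator_of_notMem hy _
    have hd : DifferentiableAt ℝ (B.pts.indicator w) x :=
      hev.differentiableAt_iff.2 (differentiableAt_const _)
    rw [indicator_of_notMem hx', hd.lineDeriv_eq_fderiv, hev.fderiv_eq]
    simp

/-! ### Integrals over compact sets depending on a parameter -/

section Parametric

variable {X Y : Type*} [TopologicalSpace X] [MeasurableSpace X] [OpensMeasurableSpace X]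
  {μ : Measure X} [IsFiniteMeasureOnCompacts μ] {K : Set X}

/-- Continuity of an integral over a compact set in a parameter. The integrand is bounded near the
parameter value because it is jointly continuous at the points of a compact set. -/
theorem continuousAt_setIntegral_of_compact [TopologicalSpace Y] [FirstCountableTopology Y]
    (hK : IsCompact K) (hm : MeasurableSet K)
    {f : Y → X → ℝ} {y₀ : Y} (h : ∀ x ∈ K, ContinuousAt (fun p : Y × X => f p.1 p.2) (y₀, x))
    (hc : ∀ᶠ y in 𝓝 y₀, ContinuousOn (f y) K) :
    ContinuousAt (fun y => ∫ x in K, f y x ∂μ) y₀ := by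
  obtain ⟨C, hC⟩ : ∃ C, ∀ x ∈ K, ‖f y₀ x‖ ≤ C :=
    hK.exists_bound_of_continuousOn hc.self_of_nhds
  have hb : ∀ᶠ y in 𝓝 y₀, ∀ x ∈ K, ‖f y x‖ ≤ C + 1 := by
    have hev : ∀ x ∈ K, ∀ᶠ p : Y × X in 𝓝 (y₀, x), ‖f p.1 p.2‖ < C + 1 := by
      intro x hx
      exact (h x hx).norm.eventually_lt_const (lt_of_le_of_lt (hC x hx) (lt_add_one C))
    have := hK.eventually_forall_of_forall_eventually (x₀ := y₀)
      (P := fun y x => ‖f y x‖ < C + 1) hev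
    filter_upwards [this] with y hy x hx using (hy x hx).le
  refine continuousAt_of_dominated (bound := fun _ => C + 1) ?_ ?_ ?_ ?_
  · filter_upwards [hc] with y hy using hy.aestronglyMeasurable hm
  · filter_upwards [hb] with y hy
    exact (ae_restrict_iff' hm).2 (.of_forall hy)
  · exact (integrableOn_const_iff).2 (Or.inr hK.measure_lt_top)
  · refine (ae_restrict_iff' hm).2 (.of_forall fun x hx => ?_)
    exact (h x hx).comp (f := fun y => (y, x)) (by fun_prop)

/-- Differentiation under the integral over a compact set. -/
theorem hasDerivAt_setIntegral_of_compact (hK : IsCompact K) (hm : MeasurableSet K)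
    {G g : ℝ → X → ℝ} {ε₀ : ℝ} (hG : ∀ᶠ ε in 𝓝 ε₀, ContinuousOn (G ε) K)
    (hd : ∀ᶠ ε in 𝓝 ε₀, ∀ x ∈ K, HasDerivAt (fun h => G h x) (g ε x) ε)
    (hg : ∀ x ∈ K, ContinuousAt (fun p : ℝ × X => g p.1 p.2) (ε₀, x))
    (hgm : ContinuousOn (g ε₀) K) :
    HasDerivAt (fun ε => ∫ x in K, G ε x ∂μ) (∫ x in K, g ε₀ x ∂μ) ε₀ := by
  obtain ⟨C, hC⟩ : ∃ C, ∀ x ∈ K, ‖g ε₀ x‖ ≤ C := hK.exists_bound_of_continuousOn hgm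
  have hb : ∀ᶠ y in 𝓝 ε₀, ∀ x ∈ K, ‖g y x‖ ≤ C + 1 := by
    have := hK.eventually_forall_of_forall_eventually (x₀ := ε₀)
      (P := fun y x => ‖g y x‖ < C + 1) fun x hx =>
        (hg x hx).norm.eventually_lt_const (by simpa using lt_of_le_of_lt (hC x hx) (lt_add_one C))
    filter_upwards [this] with y hy x hx using (hy x hx).le
  refine (hasDerivAt_integral_of_dominated_loc_of_deriv_le (hd.and hb)
    (bound := fun _ => C + 1) ?_ ?_ ?_ ?_ ?_ ?_).2
  · filter_upwards [hG] with y hy using hy.aestronglyMeasurable hm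
  · exact hG.self_of_nhds.integrableOn_compact' hK hm
  · exact hgm.aestronglyMeasurable hm
  · exact (ae_restrict_iff' hm).2 (.of_forall fun x hx ε hε => hε.2 x hx)
  · exact (integrableOn_const_iff).2 (Or.inr hK.measure_lt_top)
  · exact (ae_restrict_iff' hm).2 (.of_forall fun x hx ε hε => hε.1 x hx)

end Parametric

/-! ### Integration over the space-time cylinder -/

/-- The iterated integral over `[0,T] × B`. -/
def slabIntegral (T : ℝ) (B : SmoothDomain) (f : ℝ → E3 → ℝ) : ℝ :=
  ∫ t in (0 : ℝ)..T, ∫ x in B.pts, f t x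

section Slab

variable {T : ℝ} {B : SmoothDomain} {f g : ℝ → E3 → ℝ}

theorem SmoothField.slice {V : Type*} [NormedAddCommGroup V] [NormedSpace ℝ V] {A : Set E3}
    {f : ℝ → E3 → V} (hf : SmoothField T A f) {t : ℝ} (ht : t ∈ Icc 0 T) :
    SmoothNear (f t) A :=
  SmoothNear.comp hf (f := fun y : E3 => (t, y)) (.of_contDiff (by fun_prop))
    fun y hy => mk_mem_prod ht hy

theorem SmoothField.integrableOn (hf : SmoothField T B.pts f) :
    IntegrableOn (fun p : ℝ × E3 => f p.1 p.2) (cyl T B) (volume.prod volume) :=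
  (SmoothNear.continuousOn hf).integrableOn_compact (isCompact_cyl T B)

theorem slabIntegral_eq_setIntegral (hT : 0 < T) (hf : SmoothField T B.pts f) :
    slabIntegral T B f = ∫ p in cyl T B, f p.1 p.2 ∂(volume.prod volume) := by
  rw [slabIntegral, intervalIntegral.integral_of_le hT.le, ← integral_Icc_eq_integral_Ioc,
    setIntegral_prod _ hf.integrableOn]

theorem slabIntegral_congr (hT : 0 < T) (h : ∀ t ∈ Icc 0 T, ∀ x ∈ B.pts, f t x = g t x) :
    slabIntegral T B f = slabIntegral T B g := by
  refine intervalIntegral.integral_congr fun t ht => ?_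
  rw [uIcc_of_le hT.le] at ht
  exact setIntegral_congr_fun B.measurableSet_pts fun x hx => h t ht x hx

theorem slabIntegral_add (hT : 0 < T) (hf : SmoothField T B.pts f) (hg : SmoothField T B.pts g) :
    slabIntegral T B (fun t x => f t x + g t x) = slabIntegral T B f + slabIntegral T B g := by
  rw [slabIntegral_eq_setIntegral hT (hf.add hg), slabIntegral_eq_setIntegral hT hf,
    slabIntegral_eq_setIntegral hT hg]
  exact integral_add hf.integrableOn hg.integrableOn

/-- A time derivative integrates to zero if the field vanishes at the end times. -/
theorem slabIntegral_deriv_eq_zero (hT : 0 < T) (hf : SmoothField T B.pts f)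
    (h0 : ∀ x ∈ B.pts, f 0 x = 0) (h1 : ∀ x ∈ B.pts, f T x = 0) :
    slabIntegral T B (fun t x => deriv (fun τ => f τ x) t) = 0 := by
  have hint : Integrable (Function.uncurry fun t x => deriv (fun τ => f τ x) t)
      ((volume.restrict (Icc 0 T)).prod (volume.restrict B.pts)) := by
    rw [Measure.prod_restrict]
    exact hf.timeDeriv.integrableOn
  rw [slabIntegral, intervalIntegral.integral_of_le hT.le, ← integral_Icc_eq_integral_Ioc,
    integral_integral_swap hint]
  refine (setIntegral_congr_fun B.measurableSet_pts (g := fun _ => 0) fun x hx => ?_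
    ).trans (integral_zero _ _)
  show ∫ t in Icc 0 T, deriv (fun τ => f τ x) t = 0
  rw [integral_Icc_eq_integral_Ioc, ← intervalIntegral.integral_of_le hT.le,
    intervalIntegral.integral_deriv_eq_sub, h0 x hx, h1 x hx, sub_zero]
  · intro t ht
    rw [uIcc_of_le hT.le] at ht
    exact hf.differentiableAt_time ht hx
  · refine ContinuousOn.intervalIntegrable fun t ht => ?_
    rw [uIcc_of_le hT.le] at ht
    exact (hf.timeDeriv.differentiableAt_time ht hx).continuousAt.continuousWithinAt

/-- A space derivative integrates to zero if the field vanishes on the boundary. -/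
theorem slabIntegral_pd_eq_zero (hT : 0 < T) (hf : SmoothField T B.pts f)
    (h0 : ∀ t ∈ Icc 0 T, ∀ x ∈ B.bdry, f t x = 0) (i : Fin 3) :
    slabIntegral T B (fun t x => pd i (f t) x) = 0 := by
  have : slabIntegral T B (fun t x => pd i (f t) x) = ∫ t in (0 : ℝ)..T, (0 : ℝ) := by
    refine intervalIntegral.integral_congr fun t ht => ?_
    rw [uIcc_of_le hT.le] at ht
    exact B.integral_pd_eq_zero (hf.slice ht) (h0 t ht) i
  rw [this, intervalIntegral.integral_zero]

/-- A smooth nonnegative field with vanishing integral vanishes on the cylinder. -/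
theorem eq_zero_of_slabIntegral_eq_zero (hT : 0 < T) (hf : SmoothField T B.pts f)
    (hnn : ∀ t ∈ Icc 0 T, ∀ x ∈ B.pts, 0 ≤ f t x) (h : slabIntegral T B f = 0) :
    ∀ t ∈ Icc 0 T, ∀ x ∈ B.pts, f t x = 0 := by
  rw [slabIntegral_eq_setIntegral hT hf] at h
  have hm : MeasurableSet (cyl T B) := (isCompact_cyl T B).measurableSet
  have hae := (setIntegral_eq_zero_iff_of_nonneg_ae ((ae_restrict_iff' hm).2
    (.of_forall fun p hp => hnn p.1 hp.1 p.2 hp.2)) hf.integrableOn).1 h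
  have := Measure.eqOn_of_ae_eq hae (SmoothNear.continuousOn hf) continuousOn_const
    (cyl_subset_closure_interior hT B)
  intro t ht x hx
  exact this (mk_mem_prod ht hx)

end Slab

/-- A smooth nonnegative function with vanishing integral vanishes on the domain. -/
theorem SmoothDomain.eq_zero_of_integral_eq_zero (B : SmoothDomain) {f : E3 → ℝ}
    (hf : SmoothNear f B.pts) (hnn : ∀ x ∈ B.pts, 0 ≤ f x) (h : ∫ x in B.pts, f x = 0) :
    ∀ x ∈ B.pts, f x = 0 := by
  have hae := (setIntegral_eq_zero_iff_of_nonneg_ae ((ae_restrict_iff' B.measurableSet_pts).2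
    (.of_forall hnn)) (hf.continuousOn.integrableOn_compact B.isCompact_pts)).1 h
  exact Measure.eqOn_of_ae_eq hae hf.continuousOn continuousOn_const
    B.pts_subset_closure_interior

/-! ### Transport by the motions -/

section matD

variable {T : ℝ} {A : Set E3} {f g : ℝ → E3 → ℝ} {u : ℝ → E3 → E3} {t : ℝ} {x : E3}

theorem matD_eq_fderiv_uncurried (hf : SmoothField T A f) (ht : t ∈ Icc 0 T) (hx : x ∈ A) :
    matD u f t x = fderiv ℝ (fun p : ℝ × E3 => f p.1 p.2) (t, x) (1, u t x) := by
  rw [matD, deriv_eq_fderiv_uncurried (hf.differentiableAt ht hx),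
    fderiv_eq_fderiv_uncurried (hf.differentiableAt ht hx), ← map_add]
  simp

theorem matD_eq_sum (u : ℝ → E3 → E3) (f : ℝ → E3 → ℝ) (t : ℝ) (x : E3) :
    matD u f t x = deriv (fun τ => f τ x) t + ∑ i, pd i (f t) x * u t x i := by
  rw [matD, fderiv_eq_sum_pd]

/-- The material derivative is the derivative along a line in space-time. -/
theorem hasDerivAt_matD (hf : SmoothField T A f) (ht : t ∈ Icc 0 T) (hx : x ∈ A) :
    HasDerivAt (fun h : ℝ => f (t + h) (x + h • u t x)) (matD u f t x) 0 := by
  rw [matD_eq_fderiv_uncurried hf ht hx]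
  have := (hf.differentiableAt ht hx).hasFDerivAt.hasLineDerivAt (1, u t x)
  simpa [HasLineDerivAt] using this

theorem dvg_smul (hf : DifferentiableAt ℝ (f t) x) {v : E3 → E3}
    (hv : DifferentiableAt ℝ v x) :
    dvg (fun y => f t y • v y) x = fderiv ℝ (f t) x (v x) + f t x * dvg v x := by
  simp only [dvg, PiLp.smul_apply, smul_eq_mul]
  rw [fderiv_eq_sum_pd, Finset.mul_sum, ← Finset.sum_add_distrib]
  refine Finset.sum_congr rfl fun i _ => ?_
  exact pd_mul hf (differentiableAt_euclidean.1 hv i)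

theorem densD_eq (hf : SmoothField T A f) (hu : SmoothField T A u) (ht : t ∈ Icc 0 T)
    (hx : x ∈ A) : densD u f t x = matD u f t x + f t x * dvg (u t) x := by
  rw [densD, matD, dvg_smul (hf.differentiableAt_space ht hx) (hu.differentiableAt_space ht hx)]
  ring

end matD

section Motion

variable {T : ℝ} {R B : SmoothDomain} (m : Motion T R B)

variable {V : Type*} [NormedAddCommGroup V] [NormedSpace ℝ V]

theorem Motion.smooth_comp_inv {f : ℝ → E3 → V} (hf : SmoothField T R.pts f) :
    SmoothField T B.pts (fun t x => f t (m.inv t x)) :=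
  SmoothNear.comp hf (f := fun p : ℝ × E3 => (p.1, m.inv p.1 p.2))
    ((SmoothNear.of_contDiff contDiff_fst).prodMk m.smooth_inv)
    fun p hp => mk_mem_prod hp.1 (m.mapsTo_inv p.1 hp.1 hp.2)

theorem Motion.smooth_comp_map {f : ℝ → E3 → V} (hf : SmoothField T B.pts f) :
    SmoothField T R.pts (fun t x => f t (m.map t x)) :=
  SmoothNear.comp hf (f := fun p : ℝ × E3 => (p.1, m.map p.1 p.2))
    ((SmoothNear.of_contDiff contDiff_fst).prodMk m.smooth_map)
    fun p hp => mk_mem_prod hp.1 (m.mapsTo_map p.1 hp.1 hp.2)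

theorem Motion.smooth_velocity : SmoothField T B.pts m.velocity :=
  m.smooth_comp_inv m.smooth_map.timeDeriv

theorem Motion.map_inv {t : ℝ} (ht : t ∈ Icc 0 T) {x : E3} (hx : x ∈ B.pts) :
    m.map t (m.inv t x) = x := (m.invOn t ht).2 hx

theorem Motion.inv_map {t : ℝ} (ht : t ∈ Icc 0 T) {X : E3} (hX : X ∈ R.pts) :
    m.inv t (m.map t X) = X := (m.invOn t ht).1 hX

variable {t : ℝ} {x : E3}

/-- Labels are transported: `∂_t φ⁻¹ + u · ∇ φ⁻¹ = 0`. -/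
theorem Motion.fderiv_inv (hT : 0 < T) (ht : t ∈ Icc 0 T) (hx : x ∈ B.pts) :
    fderiv ℝ (fun p : ℝ × E3 => m.inv p.1 p.2) (t, x) (1, m.velocity t x) = 0 := by
  have hX := m.mapsTo_inv t ht hx
  have h1 : deriv (fun τ => m.inv τ (m.map τ (m.inv t x))) t = 0 := by
    have := (m.smooth_comp_map m.smooth_inv).deriv_eq hT
      (.of_contDiff (contDiff_snd : ContDiff ℝ ∞ fun p : ℝ × E3 => p.2))
      (fun t ht X hX => m.inv_map ht hX) ht hX
    simpa using this
  have hd := m.smooth_inv.differentiableAt ht hx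
  have hmap : HasDerivAt (fun τ => (τ, m.map τ (m.inv t x))) (1, m.velocity t x) t :=
    (hasDerivAt_id t).prodMk (m.smooth_map.differentiableAt_time ht hX).hasDerivAt
  rw [← m.map_inv ht hx] at hd
  have := hd.hasFDerivAt.comp_hasDerivAt t hmap
  rw [m.map_inv ht hx] at this
  rw [← h1]
  exact this.deriv.symm

/-- The material derivative of a field of the labels. -/
theorem Motion.matD_comp_inv (hT : 0 < T) {f : ℝ → E3 → ℝ} (hf : SmoothField T R.pts f)
    (ht : t ∈ Icc 0 T) (hx : x ∈ B.pts) :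
    matD m.velocity (fun t x => f t (m.inv t x)) t x = deriv (fun τ => f τ (m.inv t x)) t := by
  have hX := m.mapsTo_inv t ht hx
  rw [matD_eq_fderiv_uncurried (m.smooth_comp_inv hf) ht hx,
    deriv_eq_fderiv_uncurried (hf.differentiableAt ht hX)]
  have hΨ : HasFDerivAt (fun p : ℝ × E3 => (p.1, m.inv p.1 p.2)) _ (t, x) :=
    hasFDerivAt_fst.prodMk (m.smooth_inv.differentiableAt ht hx).hasFDerivAt
  have := HasFDerivAt.comp (t, x) (f := fun p : ℝ × E3 => (p.1, m.inv p.1 p.2))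
    (hf.differentiableAt ht hX).hasFDerivAt hΨ
  have h2 : fderiv ℝ (fun p : ℝ × E3 => f p.1 (m.inv p.1 p.2)) (t, x) = _ := this.fderiv
  rw [h2]
  simp only [ContinuousLinearMap.comp_apply, ContinuousLinearMap.prod_apply,
    ContinuousLinearMap.coe_fst', m.fderiv_inv hT ht hx]

theorem pd_comp {f : E3 → ℝ} {v : E3 → E3} (hf : DifferentiableAt ℝ f (v x))
    (hv : DifferentiableAt ℝ v x) (a : Fin 3) :
    pd a (fun y => f (v y)) x = ∑ j, pd j f (v x) * pd a (fun y => v y j) x := by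
  have h := (hf.hasFDerivAt.comp x hv.hasFDerivAt).fderiv
  have h2 : fderiv ℝ (fun y => f (v y)) x = _ := h
  rw [pd, h2, ContinuousLinearMap.comp_apply, fderiv_eq_sum_pd]
  refine Finset.sum_congr rfl fun j _ => ?_
  rw [fderiv_comp_eq_sum_pd hv]
  simp

/-- The Jacobians of the motion and of its inverse are inverse to each other. -/
theorem Motion.jac_mul_jac (hT : 0 < T) (ht : t ∈ Icc 0 T) (hx : x ∈ B.pts) :
    Matrix.of (jac (m.map t) (m.inv t x)) * Matrix.of (jac (m.inv t) x) = 1 := by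
  have hX := m.mapsTo_inv t ht hx
  ext i j
  have h1 := (m.smooth_comp_inv (m.smooth_map.apply i)).pd_eq hT
    (SmoothField.id.apply i)
    (fun t ht y hy => by rw [m.map_inv ht hy]) ht hx j
  rw [pd_comp ((m.smooth_map.apply i).differentiableAt_space ht hX)
    (m.smooth_inv.differentiableAt_space ht hx)] at h1
  simp only [Matrix.mul_apply, Matrix.of_apply, jac]
  have h2 : pd j (fun y : E3 => y i) x = fderiv ℝ (fun y : E3 => y) x (EuclideanSpace.single j 1) i := by
    rw [fderiv_comp_eq_sum_pd differentiableAt_fun_id, ← fderiv_eq_sum_pd, pd]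
  rw [h1, h2, fderiv_fun_id, Matrix.one_apply]
  simp

/-- Regularity of the Jacobian makes the absolute value in the density smooth. -/
theorem Motion.det_jac_inv_ne_zero (hT : 0 < T) (ht : t ∈ Icc 0 T) (hx : x ∈ B.pts) :
    (Matrix.of (jac (m.inv t) x)).det ≠ 0 := by
  have := congrArg Matrix.det (m.jac_mul_jac hT ht hx)
  rw [Matrix.det_mul, Matrix.det_one] at this
  exact right_ne_zero_of_mul_eq_one this

theorem Motion.det_jac_map_ne_zero (hT : 0 < T) (ht : t ∈ Icc 0 T) (hx : x ∈ B.pts) :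
    (Matrix.of (jac (m.map t) (m.inv t x))).det ≠ 0 := by
  have := congrArg Matrix.det (m.jac_mul_jac hT ht hx)
  rw [Matrix.det_mul, Matrix.det_one] at this
  exact left_ne_zero_of_mul_eq_one this

theorem Motion.smooth_jac_inv (a i : Fin 3) :
    SmoothField T B.pts (fun t x => jac (m.inv t) x a i) :=
  (m.smooth_inv.apply a).pderiv i

theorem Motion.smooth_det_jac_inv :
    SmoothField T B.pts (fun t x => (Matrix.of (jac (m.inv t) x)).det) := by
  have h := m.smooth_jac_inv
  simp only [Matrix.det_fin_three, Matrix.of_apply]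
  exact (((((((h 0 0).mul (h 1 1)).mul (h 2 2)).sub (((h 0 0).mul (h 1 2)).mul (h 2 1))).sub
    (((h 0 1).mul (h 1 0)).mul (h 2 2))).add (((h 0 1).mul (h 1 2)).mul (h 2 0))).add
    (((h 0 2).mul (h 1 0)).mul (h 2 1))).sub (((h 0 2).mul (h 1 1)).mul (h 2 0))

theorem Motion.smooth_density (hT : 0 < T) {ρ₀ : E3 → ℝ} (hρ : SmoothNear ρ₀ R.pts) :
    SmoothField T B.pts (m.density ρ₀) :=
  (m.smooth_comp_inv (SmoothField.of_space hρ)).mul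
    (SmoothNear.abs m.smooth_det_jac_inv fun _ hp => m.det_jac_inv_ne_zero hT hp.1 hp.2)

theorem Motion.density_pos (hT : 0 < T) {ρ₀ : E3 → ℝ} (hρ : ∀ X ∈ R.pts, 0 < ρ₀ X)
    (ht : t ∈ Icc 0 T) (hx : x ∈ B.pts) : 0 < m.density ρ₀ t x :=
  mul_pos (hρ _ (m.mapsTo_inv t ht hx)) (abs_pos.2 (m.det_jac_inv_ne_zero hT ht hx))

/-- The gradients of the labels are stretched by the velocity gradient. -/
theorem Motion.matD_jac_inv (hT : 0 < T) (ht : t ∈ Icc 0 T) (hx : x ∈ B.pts) (a i : Fin 3) :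
    matD m.velocity (fun t x => jac (m.inv t) x a i) t x
      = - ∑ j, jac (m.velocity t) x j i * jac (m.inv t) x a j := by
  have hψ := m.smooth_inv.apply a
  have hu := m.smooth_velocity
  have hsum : SmoothField T B.pts
      (fun t x => ∑ j, pd j (fun y => m.inv t y a) x * m.velocity t x j) :=
    .sum fun j => (hψ.pderiv j).mul (hu.apply j)
  have h0 := (hψ.timeDeriv.add hsum).pd_eq hT (SmoothField.const 0) (fun t ht x hx => by
    have := m.matD_comp_inv hT (f := fun _ X => X a)
      (SmoothField.id.apply a) ht hx
    rw [matD_eq_sum] at this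
    simpa using this) ht hx i
  rw [pd_add (hψ.timeDeriv.differentiableAt_space ht hx) (hsum.differentiableAt_space ht hx),
    pd_sum (fun j => ((hψ.pderiv j).mul (hu.apply j)).differentiableAt_space ht hx),
    ← hψ.deriv_pd ht hx] at h0
  have h1 : ∀ j, pd i (fun y => pd j (fun y => m.inv t y a) y * m.velocity t y j) x
      = pd j (pd i (fun y => m.inv t y a)) x * m.velocity t x j
        + pd j (fun y => m.inv t y a) x * pd i (fun y => m.velocity t y j) x := by
    intro j
    rw [pd_mul ((hψ.pderiv j).differentiableAt_space ht hx)
      ((hu.apply j).differentiableAt_space ht hx)]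
    congr 2
    exact hψ.pd_pd ht hx i j
  simp only [h1, Finset.sum_add_distrib] at h0
  rw [matD_eq_sum]
  have h2 : pd i (fun _ : E3 => (0 : ℝ)) x = 0 := by simp [pd]
  rw [h2] at h0
  simp only [jac]
  rw [← sub_eq_zero, sub_neg_eq_add, ← h0, add_assoc]
  congr 2
  exact Finset.sum_congr rfl fun j _ => mul_comm _ _

/-- Conservation of mass. -/
theorem Motion.density_continuity (hT : 0 < T) {ρ₀ : E3 → ℝ} (hρ : SmoothNear ρ₀ R.pts)
    (ht : t ∈ Icc 0 T) (hx : x ∈ B.pts) : densD m.velocity (m.density ρ₀) t x = 0 := by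
  rw [densD_eq (m.smooth_density hT hρ) m.smooth_velocity ht hx]
  have hc := hasDerivAt_matD (u := m.velocity) (m.smooth_comp_inv (SmoothField.of_space hρ)) ht hx
  rw [m.matD_comp_inv hT (SmoothField.of_space hρ) ht hx, deriv_const] at hc
  have h : ∀ a i, HasDerivAt (fun h : ℝ => jac (m.inv (t + h)) (x + h • m.velocity t x) a i)
      (- ∑ j, jac (m.velocity t) x j i * jac (m.inv t) x a j) 0 := fun a i => by
    have := hasDerivAt_matD (u := m.velocity) (m.smooth_jac_inv a i) ht hx
    rwa [m.matD_jac_inv hT ht hx] at this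
  have hdet : HasDerivAt (fun h : ℝ => (Matrix.of (jac (m.inv (t + h))
      (x + h • m.velocity t x))).det)
      (- dvg (m.velocity t) x * (Matrix.of (jac (m.inv t) x)).det) 0 := by
    simp only [Matrix.det_fin_three, Matrix.of_apply]
    refine ((((((((h 0 0).mul (h 1 1)).mul (h 2 2)).sub (((h 0 0).mul (h 1 2)).mul (h 2 1))).sub
      (((h 0 1).mul (h 1 0)).mul (h 2 2))).add (((h 0 1).mul (h 1 2)).mul (h 2 0))).add
      (((h 0 2).mul (h 1 0)).mul (h 2 1))).sub
      (((h 0 2).mul (h 1 1)).mul (h 2 0))).congr_deriv ?_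
    simp only [add_zero, zero_smul, Fin.sum_univ_three, dvg, jac, Pi.mul_apply]
    ring
  have hne : (Matrix.of (jac (m.inv (t + 0)) (x + (0 : ℝ) • m.velocity t x))).det ≠ 0 := by
    simpa using m.det_jac_inv_ne_zero hT ht hx
  -- The derivative of `|det|` is its sign times that of `det`.
  have hprod := hc.mul ((hasDerivAt_abs hne).comp 0 hdet)
  have huniq := (hasDerivAt_matD (u := m.velocity) (m.smooth_density hT hρ) ht hx).unique hprod
  rw [huniq]
  simp only [add_zero, zero_smul, Motion.density]
  rw [← sign_mul_self (Matrix.of (jac (m.inv t) x)).det]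
  ring

theorem Motion.smooth_jac_map (i a : Fin 3) :
    SmoothField T R.pts (fun t X => jac (m.map t) X i a) :=
  (m.smooth_map.apply i).pderiv a

theorem Motion.smooth_finger : SmoothField T B.pts m.finger :=
  smoothField_mat.2 fun i j => SmoothField.sum fun a =>
    (m.smooth_comp_inv (m.smooth_jac_map i a)).mul (m.smooth_comp_inv (m.smooth_jac_map j a))

theorem Motion.finger_symm (t : ℝ) (x : E3) (i j : Fin 3) :
    m.finger t x i j = m.finger t x j i :=
  Finset.sum_congr rfl fun _ _ => mul_comm _ _

theorem Motion.finger_eq (t : ℝ) (x : E3) : Matrix.of (m.finger t x)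
    = Matrix.of (jac (m.map t) (m.inv t x)) * (Matrix.of (jac (m.map t) (m.inv t x))).conjTranspose := by
  ext i j
  simp [Motion.finger, Matrix.mul_apply]

/-- The Finger tensor has the form `F Fᵀ` with an invertible `F`. -/
theorem Motion.finger_posDef (hdet : (Matrix.of (jac (m.map t) (m.inv t x))).det ≠ 0) :
    (Matrix.of (m.finger t x)).PosDef := by
  rw [m.finger_eq]
  refine Matrix.PosDef.mul_conjTranspose_self _ ?_
  rw [Matrix.vecMul_injective_iff_isUnit, Matrix.isUnit_iff_isUnit_det]
  exact hdet.isUnit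

/-- The deformation gradient is stretched by the velocity gradient. -/
theorem Motion.matD_jac_map (hT : 0 < T) (ht : t ∈ Icc 0 T) (hx : x ∈ B.pts) (i a : Fin 3) :
    matD m.velocity (fun t x => jac (m.map t) (m.inv t x) i a) t x
      = ∑ j, jac (m.velocity t) x i j * jac (m.map t) (m.inv t x) j a := by
  have hX := m.mapsTo_inv t ht hx
  rw [m.matD_comp_inv hT (m.smooth_jac_map i a) ht hx]
  have h1 := (m.smooth_map.timeDeriv.apply i).pd_eq hT
    ((m.smooth_comp_map m.smooth_velocity).apply i)
    (fun t ht X hX => by simp only [Motion.velocity, m.inv_map ht hX]) ht hX a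
  rw [pd_comp (f := fun y => m.velocity t y i) (v := m.map t)
    (by rw [m.map_inv ht hx]; exact (m.smooth_velocity.apply i).differentiableAt_space ht hx)
    (m.smooth_map.differentiableAt_space ht hX), m.map_inv ht hx] at h1
  simp only [jac]
  rw [← h1, (m.smooth_map.apply i).deriv_pd ht hX a]
  refine ((m.smooth_map.apply i).timeDeriv).pd_eq hT (m.smooth_map.timeDeriv.apply i)
    (fun t ht X hX => ?_) ht hX a
  exact (deriv_comp_apply (m.smooth_map.differentiableAt_time ht hX) i).symm

/-- Transport of the Finger tensor. -/
theorem Motion.finger_transport (hT : 0 < T) (ht : t ∈ Icc 0 T) (hx : x ∈ B.pts) :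
    deriv (fun τ => m.finger τ x) t + lieTensor (m.velocity t) (m.finger t) x = 0 := by
  ext i j
  have hb := m.smooth_finger.apply₂ i j
  have hd := deriv_apply₂ (fun i j => (m.smooth_finger.apply₂ i j).differentiableAt_time ht hx) i j
  have h : ∀ i a, HasDerivAt
      (fun h : ℝ => jac (m.map (t + h)) (m.inv (t + h) (x + h • m.velocity t x)) i a)
      (∑ j, jac (m.velocity t) x i j * jac (m.map t) (m.inv t x) j a) 0 := fun i a => by
    have := hasDerivAt_matD (u := m.velocity) (m.smooth_comp_inv (m.smooth_jac_map i a)) ht hx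
    rwa [m.matD_jac_map hT ht hx] at this
  have huniq := (hasDerivAt_matD (u := m.velocity) hb ht hx).unique
    (HasDerivAt.fun_sum fun a (_ : a ∈ Finset.univ) => (h i a).mul (h j a))
  rw [matD_eq_sum] at huniq
  show deriv (fun τ => m.finger τ x) t i j + lieTensor (m.velocity t) (m.finger t) x i j = 0
  rw [hd, lieTensor]
  simp only [Finset.sum_sub_distrib]
  rw [← add_sub_assoc, ← add_sub_assoc, huniq]
  simp only [add_zero, zero_smul, Fin.sum_univ_three, Motion.finger, jac]
  ring

end Motion

/-! ### Integration by parts for one constituent -/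

section Parts

variable {T : ℝ} {A : Set E3} {B : SmoothDomain}

theorem SmoothField.hasDerivAt_pd {f : ℝ → E3 → ℝ} (hf : SmoothField T A f) {t : ℝ}
    (ht : t ∈ Icc 0 T) {x : E3} (hx : x ∈ A) (i : Fin 3) :
    HasDerivAt (fun h : ℝ => f t (x + h • EuclideanSpace.single i (1 : ℝ))) (pd i (f t) x) 0 :=
  (hf.differentiableAt_space ht hx).hasFDerivAt.hasLineDerivAt _

theorem slabIntegral_const_mul (c : ℝ) (f : ℝ → E3 → ℝ) :
    slabIntegral T B (fun t x => c * f t x) = c * slabIntegral T B f := by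
  simp only [slabIntegral, MeasureTheory.integral_const_mul, intervalIntegral.integral_const_mul]

/-- The integrand collecting the terms of the first variation that contain derivatives of the
displacement `η` and of `θ = δγ`, together with what integration by parts turns them into. Here
`M` is the momentum, `A` a stress, `ρ` and `σ` are densities with conjugate fields `r` and `c`, and `d` is
the density conjugate to `θ`. -/
def partsIntegrand (M η u : Fin 3 → ℝ → E3 → ℝ) (A : Fin 3 → Fin 3 → ℝ → E3 → ℝ)
    (r ρ c σ d θ : ℝ → E3 → ℝ) (t : ℝ) (x : E3) : ℝ :=
  ∑ i, M i t x * (deriv (fun τ => η i τ x) t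
      + (∑ j, pd j (η i t) x * u j t x - ∑ j, pd j (u i t) x * η j t x))
    - r t x * ∑ j, pd j (fun y => ρ t y * η j t y) x
    - ∑ i, ∑ j, A i j t x * pd j (η i t) x
    - c t x * ∑ j, pd j (fun y => σ t y * η j t y) x
    + d t x * (deriv (fun τ => θ τ x) t + ∑ j, pd j (θ t) x * u j t x)
    + ∑ i, (deriv (fun τ => M i τ x) t
      + ∑ j, (pd j (M i t) x * u j t x + M j t x * pd i (u j t) x + M i t x * pd j (u j t) x)
      - ρ t x * pd i (r t) x - σ t x * pd i (c t) x - ∑ j, pd j (A i j t) x) * η i t x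
    + (deriv (fun τ => d τ x) t + ∑ j, pd j (fun y => d t y * u j t y) x) * θ t x

/-- Integration by parts: the integrand is a space-time divergence. Its flux through the boundary
involves `θ` only through `u θ`, which is why `θ` need not vanish there when `u` does. -/
theorem slabIntegral_partsIntegrand (hT : 0 < T) {M η u : Fin 3 → ℝ → E3 → ℝ}
    {A : Fin 3 → Fin 3 → ℝ → E3 → ℝ} {r ρ c σ d θ : ℝ → E3 → ℝ}
    (hM : ∀ i, SmoothField T B.pts (M i)) (hη : ∀ i, SmoothField T B.pts (η i))
    (hu : ∀ i, SmoothField T B.pts (u i)) (hA : ∀ i j, SmoothField T B.pts (A i j))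
    (hr : SmoothField T B.pts r) (hρ : SmoothField T B.pts ρ) (hc : SmoothField T B.pts c)
    (hσ : SmoothField T B.pts σ) (hd : SmoothField T B.pts d) (hθ : SmoothField T B.pts θ)
    (η_bdry : ∀ t ∈ Icc 0 T, ∀ x ∈ B.bdry, ∀ i, η i t x = 0)
    (θ_bdry : ∀ t ∈ Icc 0 T, ∀ x ∈ B.bdry, ∀ i, u i t x * θ t x = 0)
    (η_ends : ∀ x ∈ B.pts, ∀ i, η i 0 x = 0 ∧ η i T x = 0)
    (θ_ends : ∀ x ∈ B.pts, θ 0 x = 0 ∧ θ T x = 0) :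
    SmoothField T B.pts (partsIntegrand M η u A r ρ c σ d θ) ∧
      slabIntegral T B (partsIntegrand M η u A r ρ c σ d θ) = 0 := by
  -- The integrand is a space-time divergence, with these components.
  let Q : ℝ → E3 → ℝ := fun t x => (∑ i, M i t x * η i t x) + d t x * θ t x
  let W : Fin 3 → ℝ → E3 → ℝ := fun j t x => (∑ i, (M i t x * u j t x) * η i t x)
    + d t x * (u j t x * θ t x) - (r t x * ρ t x) * η j t x - (c t x * σ t x) * η j t x
    - ∑ i, A i j t x * η i t x
  have hQ : SmoothField T B.pts Q := (SmoothField.sum fun i => (hM i).mul (hη i)).add (hd.mul hθ)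
  have hW : ∀ j, SmoothField T B.pts (W j) := fun j =>
    (((((SmoothField.sum fun i => ((hM i).mul (hu j)).mul (hη i)).add
      (hd.mul ((hu j).mul hθ))).sub ((hr.mul hρ).mul (hη j))).sub
      ((hc.mul hσ).mul (hη j))).sub (.sum fun i => (hA i j).mul (hη i)))
  have key : ∀ t ∈ Icc 0 T, ∀ x ∈ B.pts, partsIntegrand M η u A r ρ c σ d θ t x
      = deriv (fun τ => Q τ x) t + ∑ j, pd j (W j t) x := by
    intro t ht x hx
    have eQ := ((HasDerivAt.fun_sum fun i (_ : i ∈ Finset.univ) =>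
      ((hM i).differentiableAt_time ht hx).hasDerivAt.mul
        ((hη i).differentiableAt_time ht hx).hasDerivAt).add
      ((hd.differentiableAt_time ht hx).hasDerivAt.mul
        (hθ.differentiableAt_time ht hx).hasDerivAt)).deriv
    have eW := fun j => ((hW j).hasDerivAt_pd ht hx j).unique
      (((((HasDerivAt.fun_sum fun i (_ : i ∈ Finset.univ) =>
        (((hM i).hasDerivAt_pd ht hx j).mul ((hu j).hasDerivAt_pd ht hx j)).mul
          ((hη i).hasDerivAt_pd ht hx j)).add
        ((hd.hasDerivAt_pd ht hx j).mul (((hu j).hasDerivAt_pd ht hx j).mul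
          (hθ.hasDerivAt_pd ht hx j)))).sub
        (((hr.hasDerivAt_pd ht hx j).mul (hρ.hasDerivAt_pd ht hx j)).mul
          ((hη j).hasDerivAt_pd ht hx j))).sub
        (((hc.hasDerivAt_pd ht hx j).mul (hσ.hasDerivAt_pd ht hx j)).mul
          ((hη j).hasDerivAt_pd ht hx j))).sub
        (HasDerivAt.fun_sum fun i (_ : i ∈ Finset.univ) =>
          ((hA i j).hasDerivAt_pd ht hx j).mul ((hη i).hasDerivAt_pd ht hx j)))
    have eQ' : deriv (fun τ => Q τ x) t = _ := eQ
    rw [eQ']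
    simp only [eW, partsIntegrand]
    have p1 : ∀ j, pd j (fun y => ρ t y * η j t y) x = _ := fun j =>
      pd_mul (hρ.differentiableAt_space ht hx) ((hη j).differentiableAt_space ht hx)
    have p2 : ∀ j, pd j (fun y => σ t y * η j t y) x = _ := fun j =>
      pd_mul (hσ.differentiableAt_space ht hx) ((hη j).differentiableAt_space ht hx)
    have p3 : ∀ j, pd j (fun y => d t y * u j t y) x = _ := fun j =>
      pd_mul (hd.differentiableAt_space ht hx) ((hu j).differentiableAt_space ht hx)
    simp only [p1, p2, p3, zero_smul, add_zero, Fin.sum_univ_three, Pi.mul_apply]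
    ring
  have hdiv : SmoothField T B.pts (fun t x => deriv (fun τ => Q τ x) t + ∑ j, pd j (W j t) x) :=
    hQ.timeDeriv.add (.sum fun j => (hW j).pderiv j)
  constructor
  · unfold partsIntegrand
    exact (((((((SmoothField.sum fun i => (hM i).mul ((hη i).timeDeriv.add
      ((SmoothField.sum fun j => ((hη i).pderiv j).mul (hu j)).sub
        (.sum fun j => ((hu i).pderiv j).mul (hη j))))).sub
      (hr.mul (.sum fun j => (hρ.mul (hη j)).pderiv j))).sub
      (.sum fun i => .sum fun j => (hA i j).mul ((hη i).pderiv j))).sub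
      (hc.mul (.sum fun j => (hσ.mul (hη j)).pderiv j))).add
      (hd.mul (hθ.timeDeriv.add (.sum fun j => (hθ.pderiv j).mul (hu j))))).add
      (.sum fun i => SmoothField.mul (((((hM i).timeDeriv.add
        (.sum fun j => ((((hM i).pderiv j).mul (hu j)).add ((hM j).mul ((hu j).pderiv i))).add
          ((hM i).mul ((hu j).pderiv j)))).sub
        (hρ.mul (hr.pderiv i))).sub (hσ.mul (hc.pderiv i))).sub (.sum fun j => (hA i j).pderiv j))
        (hη i))).add
      ((hd.timeDeriv.add (.sum fun j => (hd.mul (hu j)).pderiv j)).mul hθ))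
  · rw [slabIntegral_congr hT key, slabIntegral_add hT hQ.timeDeriv
      (.sum fun j => (hW j).pderiv j), slabIntegral_deriv_eq_zero hT hQ]
    · simp only [Fin.sum_univ_three]
      rw [slabIntegral_add hT (((hW 0).pderiv 0).add ((hW 1).pderiv 1)) ((hW 2).pderiv 2),
        slabIntegral_add hT ((hW 0).pderiv 0) ((hW 1).pderiv 1)]
      have hW0 : ∀ j, slabIntegral T B (fun t x => pd j (W j t) x) = 0 := fun j =>
        slabIntegral_pd_eq_zero hT (hW j) (fun t ht x hx => by
          simp [W, η_bdry t ht x hx, θ_bdry t ht x hx]) j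
      simp [hW0]
    · intro x hx
      simp [Q, η_ends x hx, θ_ends x hx]
    · intro x hx
      simp [Q, η_ends x hx, θ_ends x hx]

end Parts

/-! ### Smooth families of states -/

open MeasureTheory

/-- A smooth time-dependent state on `[0,T] × B`. -/
structure SmoothStates (T : ℝ) (B : SmoothDomain) (X : ℝ → State) : Prop where
  u : ∀ k, SmoothField T B.pts (fun t => (X t).u k)
  ρ : ∀ k, SmoothField T B.pts (fun t => (X t).ρ k)
  s : ∀ k, SmoothField T B.pts (fun t => (X t).s k)
  b : SmoothField T B.pts (fun t => (X t).b)
  φ : SmoothField T B.pts (fun t => (X t).φ)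

section Families

variable {T : ℝ} {B : SmoothDomain} {X Y : ℝ → State}

/-- A field as a function of a parameter on which time depends smoothly. -/
theorem SmoothField.pullback {V W : Type*} [NormedAddCommGroup V] [NormedSpace ℝ V]
    [NormedAddCommGroup W] [NormedSpace ℝ W] {A : Set E3}
    {f : ℝ → E3 → V} (hf : SmoothField T A f) {τ : W → ℝ} (hτ : ContDiff ℝ ∞ τ) {q : W}
    (hq : τ q ∈ Icc 0 T) : SmoothNear (fun p : W × E3 => f (τ p.1) p.2) ({q} ×ˢ A) :=
  SmoothNear.comp hf (f := fun p : W × E3 => (τ p.1, p.2))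
    (.of_contDiff ((hτ.comp contDiff_fst).prodMk contDiff_snd))
    fun p hp => mk_mem_prod (by rw [show p.1 = q from hp.1]; exact hq) hp.2

/-- Perturbations of a smooth time-dependent state form a smooth family, in any smooth
parametrization of time and of the perturbation parameter. -/
theorem SmoothStates.perturb_comp (hX : SmoothStates T B X) (hY : SmoothStates T B Y)
    {τ e : ℝ × ℝ → ℝ} (hτ : ContDiff ℝ ∞ τ) (he : ContDiff ℝ ∞ e) {q : ℝ × ℝ}
    (hq : τ q ∈ Icc 0 T) :
    SmoothFamilyAt B (fun q => (X (τ q)).perturb (Y (τ q)) (e q)) q where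
  u k := ((hX.u k).pullback hτ hq).add
    ((SmoothNear.of_contDiff (he.comp contDiff_fst)).smul ((hY.u k).pullback hτ hq))
  ρ k := ((hX.ρ k).pullback hτ hq).add
    ((SmoothNear.of_contDiff (he.comp contDiff_fst)).mul ((hY.ρ k).pullback hτ hq))
  s k := ((hX.s k).pullback hτ hq).add
    ((SmoothNear.of_contDiff (he.comp contDiff_fst)).mul ((hY.s k).pullback hτ hq))
  b := ((hX.b).pullback hτ hq).add
    ((SmoothNear.of_contDiff (he.comp contDiff_fst)).smul ((hY.b).pullback hτ hq))
  φ := ((hX.φ).pullback hτ hq).add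
    ((SmoothNear.of_contDiff (he.comp contDiff_fst)).mul ((hY.φ).pullback hτ hq))

theorem derivState_perturb (X Y : State) (ε : ℝ) : derivState (fun h => X.perturb Y h) ε = Y := by
  have h : ∀ a b : ℝ, deriv (fun h : ℝ => a + h * b) ε = b := fun a b => by
    simp
  have hv : ∀ a b : E3, deriv (fun h : ℝ => a + h • b) ε = b := fun a b => by
    simpa using (((hasDerivAt_id ε).smul_const b).const_add a).deriv
  cases Y
  simp only [derivState, State.perturb, h, hv]

/-- Positive definiteness is an open condition on symmetric tensors. -/
theorem eventually_posDef {W : Type*} [TopologicalSpace W] {M : W → Mat3} {y₀ : W}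
    (hM : ContinuousAt M y₀) (hs : ∀ᶠ y in 𝓝 y₀, ∀ i j, M y i j = M y j i)
    (h0 : (Matrix.of (M y₀)).PosDef) : ∀ᶠ y in 𝓝 y₀, (Matrix.of (M y)).PosDef := by
  let q : W → (Fin 3 → ℝ) → ℝ := fun y v => ∑ i, ∑ j, v i * (M y i j * v j)
  have hq : ∀ y v, star v ⬝ᵥ (Matrix.of (M y)).mulVec v = q y v := by
    intro y v
    simp only [q, dotProduct, Matrix.mulVec, Matrix.of_apply, Pi.star_apply, star_trivial,
      Finset.mul_sum]
  have hpos : ∀ᶠ y in 𝓝 y₀, ∀ v ∈ Metric.sphere (0 : Fin 3 → ℝ) 1, 0 < q y v := by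
    refine (isCompact_sphere _ _).eventually_forall_of_forall_eventually fun v hv => ?_
    have hc : ContinuousAt (fun z : W × (Fin 3 → ℝ) => q z.1 z.2) (y₀, v) := by
      have hMij : ∀ i j, ContinuousAt (fun z : W × (Fin 3 → ℝ) => M z.1 i j) (y₀, v) :=
        fun i j => ContinuousAt.comp (f := fun z : W × (Fin 3 → ℝ) => z.1) (x := (y₀, v))
          (continuousAt_pi.1 (continuousAt_pi.1 hM i) j) continuousAt_fst
      have hvi : ∀ i, ContinuousAt (fun z : W × (Fin 3 → ℝ) => z.2 i) (y₀, v) :=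
        fun i => by fun_prop
      simp only [q, Fin.sum_univ_three]
      have h := fun i j => (hvi i).mul ((hMij i j).mul (hvi j))
      exact (((h 0 0).add (h 0 1)).add (h 0 2)).add (((h 1 0).add (h 1 1)).add (h 1 2)) |>.add
        (((h 2 0).add (h 2 1)).add (h 2 2))
    refine hc.eventually (lt_mem_nhds (b := q y₀ v) (a := 0) ?_)
    rw [← hq]
    refine h0.dotProduct_mulVec_pos fun hv0 => ?_
    simp [hv0] at hv
  filter_upwards [hpos, hs] with y hy hsy
  refine Matrix.PosDef.of_dotProduct_mulVec_pos ?_ fun v hv => ?_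
  · ext i j
    simpa using hsy j i
  · rw [hq]
    have hn : 0 < ‖v‖ := norm_pos_iff.2 hv
    have h1 := hy (‖v‖⁻¹ • v) (by simp [norm_smul, hn.ne'])
    have h2 : q y v = ‖v‖ ^ 2 * q y (‖v‖⁻¹ • v) := by
      simp only [q, Pi.smul_apply, smul_eq_mul, Finset.mul_sum]
      refine Finset.sum_congr rfl fun i _ => Finset.sum_congr rfl fun j _ => ?_
      field_simp
    rw [h2]
    positivity

/-- Admissibility is an open condition in smooth families of states with symmetric `b`. -/
theorem SmoothFamilyAt.eventually_admissible {Z : ℝ × ℝ → State} {q : ℝ × ℝ}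
    (hZ : SmoothFamilyAt B Z q) (hs : ∀ q, ∀ x ∈ B.pts, ∀ i j, (Z q).b x i j = (Z q).b x j i)
    (h0 : (Z q).Admissible B) : ∀ᶠ q in 𝓝 q, (Z q).Admissible B := by
  have hmem : ∀ x ∈ B.pts, (q, x) ∈ ({q} : Set (ℝ × ℝ)) ×ˢ B.pts := fun x hx =>
    mk_mem_prod rfl hx
  have hρ : ∀ k, ∀ᶠ q in 𝓝 q, ∀ x ∈ B.pts, 0 < (Z q).ρ k x := fun k =>
    B.isCompact_pts.eventually_forall_of_forall_eventually fun x hx =>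
      ((hZ.ρ k).continuousAt (hmem x hx)).eventually (lt_mem_nhds ((h0 x hx).1 k))
  have hφ0 : ∀ᶠ q in 𝓝 q, ∀ x ∈ B.pts, 0 < (Z q).φ x :=
    B.isCompact_pts.eventually_forall_of_forall_eventually fun x hx =>
      (hZ.φ.continuousAt (hmem x hx)).eventually (lt_mem_nhds (h0 x hx).2.1)
  have hφ1 : ∀ᶠ q in 𝓝 q, ∀ x ∈ B.pts, (Z q).φ x < 1 :=
    B.isCompact_pts.eventually_forall_of_forall_eventually fun x hx =>
      (hZ.φ.continuousAt (hmem x hx)).eventually (gt_mem_nhds (h0 x hx).2.2.1)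
  -- Symmetry of `b` is known on `B` only, but openness needs a neighbourhood of the points of `B`;
  -- the symmetric part of `b` is symmetric everywhere and agrees with `b` on `B`.
  have hb : ∀ᶠ q in 𝓝 q, ∀ x ∈ B.pts, (Matrix.of (fun i j =>
      ((Z q).b x i j + (Z q).b x j i) / 2)).PosDef := by
    refine B.isCompact_pts.eventually_forall_of_forall_eventually fun x hx => ?_
    refine eventually_posDef (M := fun z : (ℝ × ℝ) × E3 => fun i j =>
      ((Z z.1).b z.2 i j + (Z z.1).b z.2 j i) / 2) (y₀ := (q, x)) ?_ ?_ ?_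
    · have hb := hZ.b.continuousAt (hmem x hx)
      refine continuousAt_pi.2 fun i => continuousAt_pi.2 fun j => ?_
      have := fun i j => continuousAt_pi.1 (continuousAt_pi.1 hb i) j
      exact ((this i j).add (this j i)).div_const 2
    · exact .of_forall fun y i j => by ring
    · have hpd := (h0 x hx).2.2.2
      convert hpd using 2
      ext i j
      rw [hs q x hx j i]; ring
  filter_upwards [hρ .fluid, hρ .solid, hφ0, hφ1, hb] with y h1 h2 h3 h4 h5 x hx
  refine ⟨fun k => by cases k; exacts [h1 x hx, h2 x hx], h3 x hx, h4 x hx, ?_⟩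
  convert h5 x hx using 2
  ext i j
  rw [hs y x hx j i]; ring

/-- The density of the `L²` pairing. -/
def State.pairingDensity (D Y : State) (x : E3) : ℝ :=
  inner ℝ (D.u .fluid x) (Y.u .fluid x) + inner ℝ (D.u .solid x) (Y.u .solid x)
      + D.ρ .fluid x * Y.ρ .fluid x + D.ρ .solid x * Y.ρ .solid x
      + D.s .fluid x * Y.s .fluid x + D.s .solid x * Y.s .solid x
      + ddot (D.b x) (Y.b x) + D.φ x * Y.φ x

theorem SmoothNear.inner {E : Type*} [NormedAddCommGroup E] [NormedSpace ℝ E] {A : Set E}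
    {f g : E → E3} (hf : SmoothNear f A) (hg : SmoothNear g A) :
    SmoothNear (fun x => inner ℝ (f x) (g x)) A := by
  simp only [inner_eq_sum]
  exact .sum fun i => (smoothNear_euclidean.1 hf i).mul (smoothNear_euclidean.1 hg i)

theorem SmoothNear.ddot {E : Type*} [NormedAddCommGroup E] [NormedSpace ℝ E] {A : Set E}
    {f g : E → Mat3} (hf : SmoothNear f A) (hg : SmoothNear g A) :
    SmoothNear (fun x => PorousMedia.ddot (f x) (g x)) A :=
  .sum fun i => .sum fun j => (smoothNear_mat.1 hf i j).mul (smoothNear_mat.1 hg i j)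

theorem SmoothFamilyAt.pairingDensity {Z Z' : ℝ × ℝ → State} {q : ℝ × ℝ}
    (hZ : SmoothFamilyAt B Z q) (hZ' : SmoothFamilyAt B Z' q) :
    SmoothNear (fun p : (ℝ × ℝ) × E3 => (Z p.1).pairingDensity (Z' p.1) p.2) ({q} ×ˢ B.pts) :=
  (((((((hZ.u _).inner (hZ'.u _)).add ((hZ.u _).inner (hZ'.u _))).add
    ((hZ.ρ _).mul (hZ'.ρ _))).add ((hZ.ρ _).mul (hZ'.ρ _))).add
    ((hZ.s _).mul (hZ'.s _))).add ((hZ.s _).mul (hZ'.s _))).add (hZ.b.ddot hZ'.b) |>.add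
    (hZ.φ.mul hZ'.φ)

theorem SmoothStates.pairingDensity (hX : SmoothStates T B X) (hY : SmoothStates T B Y) :
    SmoothField T B.pts (fun t x => (X t).pairingDensity (Y t) x) :=
  ((((((((SmoothNear.inner (hX.u .fluid) (hY.u .fluid)).add
    (SmoothNear.inner (hX.u .solid) (hY.u .solid))).add
    ((hX.ρ .fluid).mul (hY.ρ .fluid))).add ((hX.ρ .solid).mul (hY.ρ .solid))).add
    ((hX.s .fluid).mul (hY.s .fluid))).add ((hX.s .solid).mul (hY.s .solid))).add
    (SmoothNear.ddot hX.b hY.b)).add (hX.φ.mul hY.φ))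

/-- A function of parameters and position that is smooth near `{q} × K` is continuous on `K` at
all `q'` close to `q`. -/
theorem SmoothNear.eventually_continuousOn {V W : Type*} [NormedAddCommGroup V] [NormedSpace ℝ V]
    [NormedAddCommGroup W] [NormedSpace ℝ W] {f : W × E3 → V} {K : Set E3} {q : W}
    (hf : SmoothNear f ({q} ×ˢ K)) (hK : IsCompact K) :
    ∀ᶠ q' in 𝓝 q, ContinuousOn (fun x => f (q', x)) K := by
  have := hK.eventually_forall_of_forall_eventually (x₀ := q)
    (P := fun q x => ContDiffAt ℝ ∞ f (q, x)) fun x hx =>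
      smoothNear_iff.1 hf (q, x) (mk_mem_prod rfl hx)
  filter_upwards [this] with q' hq' x hx
  exact ((hq' x hx).continuousAt.comp (f := fun x : E3 => (q', x))
    (by fun_prop)).continuousWithinAt

/-- Differentiability of the time integral of a Lagrangian along perturbations of a smooth
time-dependent state. -/
theorem hasDerivAt_integral_lagrangian (hT : 0 < T) {ℓ : State → ℝ} {dℓ : State → State}
    (hℓ : IsFunctionalDerivative B ℓ dℓ) (hX : SmoothStates T B X) (hY : SmoothStates T B Y)
    (hXb : ∀ t, ∀ x ∈ B.pts, ∀ i j, (X t).b x i j = (X t).b x j i)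
    (hYb : ∀ t, ∀ x ∈ B.pts, ∀ i j, (Y t).b x i j = (Y t).b x j i)
    (hadm : ∀ t ∈ Icc 0 T, (X t).Admissible B) :
    (∀ᶠ ε in 𝓝 (0 : ℝ),
      IntervalIntegrable (fun t => ℓ ((X t).perturb (Y t) ε)) volume 0 T) ∧
    HasDerivAt (fun ε => ∫ t in (0 : ℝ)..T, ℓ ((X t).perturb (Y t) ε))
      (slabIntegral T B (fun t x => (dℓ (X t)).pairingDensity (Y t) x)) 0 := by
  have hb : ∀ t ε : ℝ, ∀ x ∈ B.pts, ∀ i j, ((X t).perturb (Y t) ε).b x i j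
      = ((X t).perturb (Y t) ε).b x j i := fun t ε x hx i j => by
    simp only [State.perturb, hXb t x hx i j, hYb t x hx i j]
  -- The order `(t, ε)` of the parameters gives the derivative in `ε` at fixed `t`, the order `(ε, t)`
  -- the continuity of the Lagrangian in `t` at fixed `ε`.
  have hZ : ∀ t ∈ Icc 0 T, ∀ ε, SmoothFamilyAt B (fun q => (X q.1).perturb (Y q.1) q.2) (t, ε) :=
    fun t ht ε => hX.perturb_comp hY contDiff_fst contDiff_snd ht
  have hZ' : ∀ t ∈ Icc 0 T, ∀ ε, SmoothFamilyAt B (fun q => (X q.2).perturb (Y q.2) q.1) (ε, t) :=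
    fun t ht ε => hX.perturb_comp hY contDiff_snd contDiff_fst ht
  have hp0 : ∀ t, (X t).perturb (Y t) 0 = X t := fun t => by
    simp [State.perturb]
  have hev : ∀ᶠ ε in 𝓝 (0 : ℝ), ∀ t ∈ Icc 0 T, ∀ᶠ q in 𝓝 (ε, t),
      ((X q.2).perturb (Y q.2) q.1).Admissible B := by
    refine isCompact_Icc.eventually_forall_of_forall_eventually (x₀ := (0 : ℝ))
      (P := fun ε t => ∀ᶠ q in 𝓝 (ε, t), ((X q.2).perturb (Y q.2) q.1).Admissible B)
      fun t ht => ?_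
    refine ((hZ' t ht 0).eventually_admissible (fun q => hb q.2 q.1) ?_).eventually_nhds
    simpa only [hp0] using hadm t ht
  have hev' : ∀ᶠ ε in 𝓝 (0 : ℝ), ∀ t ∈ Icc 0 T, ∀ᶠ q in 𝓝 (t, ε),
      ((X q.1).perturb (Y q.1) q.2).Admissible B := by
    filter_upwards [hev] with ε hε t ht
    exact (continuous_swap.tendsto (t, ε)).eventually (hε t ht)
  have hcont : ∀ᶠ ε in 𝓝 (0 : ℝ), ContinuousOn (fun t => ℓ ((X t).perturb (Y t) ε)) (Icc 0 T) := by
    filter_upwards [hev] with ε hε t ht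
    exact ((hℓ _ ε t (hZ' t ht ε) (hε t ht)).1).continuousAt.continuousWithinAt
  refine ⟨?_, ?_⟩
  · filter_upwards [hcont] with ε hε
    exact ContinuousOn.intervalIntegrable (by rwa [uIcc_of_le hT.le])
  have hcg : ∀ t ∈ Icc 0 T, ContinuousAt (fun q : ℝ × ℝ => State.pairing B
      (dℓ ((X q.2).perturb (Y q.2) q.1)) (Y q.2)) (0, t) := by
    intro t ht
    have hY' : SmoothFamilyAt B (fun q => Y q.2) ((0 : ℝ), t) :=
      ⟨fun k => (hY.u k).pullback contDiff_snd ht, fun k => (hY.ρ k).pullback contDiff_snd ht,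
        fun k => (hY.s k).pullback contDiff_snd ht, hY.b.pullback contDiff_snd ht,
        hY.φ.pullback contDiff_snd ht⟩
    have hs := ((hℓ _ 0 t (hZ' t ht 0) (hev.self_of_nhds t ht)).2.1).pairingDensity hY'
    exact continuousAt_setIntegral_of_compact B.isCompact_pts B.measurableSet_pts
      (fun x hx => hs.continuousAt (mk_mem_prod rfl hx))
      (hs.eventually_continuousOn B.isCompact_pts)
  have hint : ∀ f : ℝ → ℝ, ∫ t in (0 : ℝ)..T, f t = ∫ t in Icc 0 T, f t := fun f => by
    rw [intervalIntegral.integral_of_le hT.le, integral_Icc_eq_integral_Ioc]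
  have key := hasDerivAt_setIntegral_of_compact (μ := (volume : Measure ℝ)) (K := Icc 0 T)
    isCompact_Icc measurableSet_Icc
    (G := fun ε t => ℓ ((X t).perturb (Y t) ε))
    (g := fun ε t => State.pairing B (dℓ ((X t).perturb (Y t) ε)) (Y t)) (ε₀ := 0) hcont ?_ hcg
    (fun t ht => ((hcg t ht).comp (f := fun t : ℝ => ((0 : ℝ), t))
      (by fun_prop)).continuousWithinAt)
  · simp only [slabIntegral, hint]
    simp only [hp0] at key
    exact key
  · filter_upwards [hev'] with ε hε t ht
    have := (hℓ _ t ε (hZ t ht ε) (hε t ht)).1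
    simpa only [derivState_perturb] using this

/-- Functional derivatives along a smooth time-dependent admissible state are smooth fields. -/
theorem IsFunctionalDerivative.smoothStates {ℓ : State → ℝ} {dℓ : State → State}
    (hℓ : IsFunctionalDerivative B ℓ dℓ) (hX : SmoothStates T B X)
    (hXb : ∀ t, ∀ x ∈ B.pts, ∀ i j, (X t).b x i j = (X t).b x j i)
    (hadm : ∀ t ∈ Icc 0 T, (X t).Admissible B) :
    SmoothStates T B (fun t => dℓ (X t)) ∧
      ∀ t ∈ Icc 0 T, ∀ x ∈ B.pts, ∀ i j, (dℓ (X t)).b x i j = (dℓ (X t)).b x j i := by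
  have h : ∀ t ∈ Icc 0 T, SmoothFamilyAt B (fun q => dℓ (X q.1)) (t, 0) ∧
      ∀ x ∈ B.pts, ∀ i j, (dℓ (X t)).b x i j = (dℓ (X t)).b x j i := by
    intro t ht
    have hZ : SmoothFamilyAt B (fun q => X q.1) (t, (0 : ℝ)) :=
      ⟨fun k => (hX.u k).pullback contDiff_fst ht, fun k => (hX.ρ k).pullback contDiff_fst ht,
        fun k => (hX.s k).pullback contDiff_fst ht, hX.b.pullback contDiff_fst ht,
        hX.φ.pullback contDiff_fst ht⟩
    exact (hℓ _ t 0 hZ (hZ.eventually_admissible (fun q => hXb q.1) (hadm t ht))).2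
  have hpull : ∀ {V : Type} [NormedAddCommGroup V] [NormedSpace ℝ V] {f : ℝ → E3 → V},
      (∀ t ∈ Icc 0 T, SmoothNear (fun p : (ℝ × ℝ) × E3 => f p.1.1 p.2) ({(t, 0)} ×ˢ B.pts)) →
        SmoothField T B.pts f := by
    intro V _ _ f hf
    refine smoothNear_iff.2 fun p hp => ?_
    have := SmoothNear.comp (hf p.1 hp.1) (A := {p}) (f := fun p : ℝ × E3 => ((p.1, 0), p.2))
      (.of_contDiff (by fun_prop)) (by
        rintro _ rfl
        exact mk_mem_prod rfl hp.2)
    exact smoothNear_iff.1 this p rfl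
  exact ⟨⟨fun k => hpull fun t ht => (h t ht).1.u k, fun k => hpull fun t ht => (h t ht).1.ρ k,
    fun k => hpull fun t ht => (h t ht).1.s k, hpull fun t ht => (h t ht).1.b,
    hpull fun t ht => (h t ht).1.φ⟩, fun t ht => (h t ht).2⟩

end Families

/-! ### The first variation of the action -/

open MeasureTheory

section Evolution

variable {T : ℝ} {R : Phase → SmoothDomain} {B : SmoothDomain}

theorem Evolution.smooth_u (P : Evolution T R B) (k : Phase) : SmoothField T B.pts (P.u k) :=
  (P.motion k).smooth_velocity

theorem Evolution.smooth_ρ (P : Evolution T R B) (hT : 0 < T) (k : Phase) :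
    SmoothField T B.pts (P.ρ k) := (P.motion k).smooth_density hT (P.smooth_ρ₀ k)

theorem Evolution.smooth_b (P : Evolution T R B) : SmoothField T B.pts P.b :=
  (P.motion .solid).smooth_finger

theorem Evolution.b_symm (P : Evolution T R B) (t : ℝ) (x : E3) (i j : Fin 3) :
    P.b t x i j = P.b t x j i := (P.motion .solid).finger_symm t x i j

theorem Evolution.smoothStates (P : Evolution T R B) (hT : 0 < T) :
    SmoothStates T B P.state :=
  ⟨P.smooth_u, P.smooth_ρ hT, P.smooth_s, P.smooth_b, P.smooth_φ⟩

theorem Evolution.admissible (P : Evolution T R B) (hT : 0 < T) {t : ℝ} (ht : t ∈ Icc 0 T) :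
    (P.state t).Admissible B := fun x hx =>
  ⟨fun k => (P.motion k).density_pos hT (P.pos_ρ₀ k) ht hx, (P.φ_mem t ht x hx).1,
    (P.φ_mem t ht x hx).2,
    (P.motion .solid).finger_posDef ((P.motion .solid).det_jac_map_ne_zero hT ht hx)⟩

/-- The conservation laws hold for every evolution. -/
theorem Evolution.continuityEquations (P : Evolution T R B) (hT : 0 < T) :
    ContinuityEquations P where
  mass _ ht _ hx k := (P.motion k).density_continuity hT (P.smooth_ρ₀ k) ht hx
  finger _ ht _ hx := (P.motion .solid).finger_transport hT ht hx

variable {bc : BoundaryCondition} {ℓ : State → ℝ} {dℓ : State → State} {F : Friction T B}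
  {P : Evolution T R B} {V : Variation}

theorem Variation.IsAllowed.smooth_η (hV : V.IsAllowed bc dℓ F P) (k : Phase) :
    SmoothField T B.pts (V.η P k) :=
  (P.motion k).smooth_comp_inv (hV.smooth_map k)

theorem SmoothField.dvg_smul {f : ℝ → E3 → ℝ} {v : ℝ → E3 → E3} {A : Set E3}
    (hf : SmoothField T A f) (hv : SmoothField T A v) :
    SmoothField T A (fun t x => dvg (fun y => f t y • v t y) x) :=
  .sum fun i => (hf.mul (hv.apply i)).pderiv i

theorem SmoothField.lieTensor {v : ℝ → E3 → E3} {b : ℝ → E3 → Mat3} {A : Set E3}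
    (hv : SmoothField T A v) (hb : SmoothField T A b) :
    SmoothField T A (fun t x => lieTensor (v t) (b t) x) :=
  smoothField_mat.2 fun i j => .sum fun k =>
    ((((hb.apply₂ i j).pderiv k).mul (hv.apply k)).sub
      ((hb.apply₂ k j).mul ((hv.apply i).pderiv k))).sub
      ((hb.apply₂ i k).mul ((hv.apply j).pderiv k))

theorem Variation.IsAllowed.smoothStates (hT : 0 < T) (hV : V.IsAllowed bc dℓ F P) :
    SmoothStates T B (V.state P) where
  u k := ((hV.smooth_η k).timeDeriv.add ((hV.smooth_η k).spaceDeriv (P.smooth_u k))).sub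
    ((P.smooth_u k).spaceDeriv (hV.smooth_η k))
  ρ k := ((P.smooth_ρ hT k).dvg_smul (hV.smooth_η k)).neg
  s := hV.smooth_s
  b := ((hV.smooth_η .solid).lieTensor P.smooth_b).neg
  φ := hV.smooth_φ

theorem lieTensor_symm (v : E3 → E3) {b : E3 → Mat3} (hb : ∀ x i j, b x i j = b x j i) (x : E3)
    (i j : Fin 3) : lieTensor v b x i j = lieTensor v b x j i := by
  have : (fun y => b y i j) = fun y => b y j i := funext fun y => hb y i j
  simp only [lieTensor, this]
  refine Finset.sum_congr rfl fun k _ => ?_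
  rw [hb x k j, hb x i k]; ring

theorem Variation.state_b_symm (V : Variation) (P : Evolution T R B) (t : ℝ) (x : E3)
    (i j : Fin 3) : (V.state P t).b x i j = (V.state P t).b x j i :=
  congrArg Neg.neg (lieTensor_symm _ (P.b_symm t) x i j)

theorem Variation.IsAllowed.state_u_apply (hV : V.IsAllowed bc dℓ F P) {t : ℝ}
    (ht : t ∈ Icc 0 T) {x : E3} (hx : x ∈ B.pts) (k : Phase) (i : Fin 3) :
    (V.state P t).u k x i = deriv (fun τ => V.η P k τ x i) t
      + (∑ j, pd j (fun y => V.η P k t y i) x * P.u k t x j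
        - ∑ j, pd j (fun y => P.u k t y i) x * V.η P k t x j) := by
  have hη := hV.smooth_η k
  simp only [Variation.state, PiLp.sub_apply, PiLp.add_apply]
  rw [deriv_comp_apply (hη.differentiableAt_time ht hx),
    fderiv_comp_eq_sum_pd (hη.differentiableAt_space ht hx),
    fderiv_comp_eq_sum_pd ((P.smooth_u k).differentiableAt_space ht hx)]
  ring

/-- The first-order part in `ε` of `(s - σ) D_t γ` along the perturbed fields. -/
def entropyVariation (P : Evolution T R B) (V : Variation) (k : Phase) (t : ℝ) (x : E3) : ℝ :=
  (V.δs k t x - V.δσ k t x) * matD (P.u k) (P.γ k) t x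
    + (P.s k t x - P.σ k t x) * (matD (P.u k) (V.δγ k) t x
      + fderiv ℝ (P.γ k t) x ((V.state P t).u k x))

theorem SmoothField.matD {u : ℝ → E3 → E3} {f : ℝ → E3 → ℝ} {A : Set E3}
    (hu : SmoothField T A u) (hf : SmoothField T A f) : SmoothField T A (matD u f) :=
  hf.timeDeriv.add (hf.spaceDeriv hu)

theorem Variation.IsAllowed.smooth_entropyVariation (hT : 0 < T) (hV : V.IsAllowed bc dℓ F P)
    (k : Phase) : SmoothField T B.pts (entropyVariation P V k) :=
  (((hV.smooth_s k).sub (hV.smooth_σ k)).mul ((P.smooth_u k).matD (P.smooth_γ k))).add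
    (((P.smooth_s k).sub (P.smooth_σ k)).mul (((P.smooth_u k).matD (hV.smooth_γ k)).add
      ((P.smooth_γ k).spaceDeriv ((hV.smoothStates hT).u k))))

/-- The entropy part of the action is a cubic polynomial in the perturbation parameter. -/
theorem Variation.IsAllowed.hasDerivAt_entropy (hT : 0 < T) (hV : V.IsAllowed bc dℓ F P)
    (k : Phase) :
    (∀ ε, IntervalIntegrable (fun t => ∫ x in B.pts, entropyDensity P V ε k t x) volume 0 T) ∧
    HasDerivAt (fun ε => slabIntegral T B (entropyDensity P V ε k))
      (slabIntegral T B (entropyVariation P V k)) 0 := by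
  have hδu := (hV.smoothStates hT).u k
  have ha0 := (P.smooth_s k).sub (P.smooth_σ k)
  have ha1 := (hV.smooth_s k).sub (hV.smooth_σ k)
  have hc0 := (P.smooth_u k).matD (P.smooth_γ k)
  have hc1 := ((P.smooth_u k).matD (hV.smooth_γ k)).add ((P.smooth_γ k).spaceDeriv hδu)
  have hc2 := (hV.smooth_γ k).spaceDeriv hδu
  -- On the cylinder the density is a cubic polynomial in `ε`.
  have key : ∀ ε, ∀ t ∈ Icc 0 T, ∀ x ∈ B.pts, entropyDensity P V ε k t x
      = (P.s k t x - P.σ k t x) * matD (P.u k) (P.γ k) t x + (ε * entropyVariation P V k t x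
        + (ε ^ 2 * ((V.δs k t x - V.δσ k t x) * (matD (P.u k) (V.δγ k) t x
            + fderiv ℝ (P.γ k t) x ((V.state P t).u k x))
          + (P.s k t x - P.σ k t x) * fderiv ℝ (V.δγ k t) x ((V.state P t).u k x))
        + ε ^ 3 * ((V.δs k t x - V.δσ k t x)
          * fderiv ℝ (V.δγ k t) x ((V.state P t).u k x)))) := by
    intro ε t ht x hx
    have h1 := (P.smooth_γ k).differentiableAt_time ht hx
    have h2 := (hV.smooth_γ k).differentiableAt_time ht hx
    have h3 := (P.smooth_γ k).differentiableAt_space ht hx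
    have h4 := (hV.smooth_γ k).differentiableAt_space ht hx
    have e1 : deriv (fun τ => P.γ k τ x + ε * V.δγ k τ x) t
        = deriv (fun τ => P.γ k τ x) t + ε * deriv (fun τ => V.δγ k τ x) t :=
      (h1.hasDerivAt.add (h2.hasDerivAt.const_mul ε)).deriv
    have e2 : fderiv ℝ (fun y => P.γ k t y + ε * V.δγ k t y) x
        = fderiv ℝ (P.γ k t) x + ε • fderiv ℝ (V.δγ k t) x :=
      (h3.hasFDerivAt.add (h4.hasFDerivAt.const_mul ε)).fderiv
    have e3 : ((P.state t).perturb (V.state P t) ε).u k x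
        = P.u k t x + ε • (V.state P t).u k x := rfl
    simp only [entropyDensity, entropyVariation, matD]
    rw [e1, e2, e3]
    simp only [add_apply, smul_apply, map_add, map_smul, smul_eq_mul]
    ring
  have hS2 := (ha1.mul hc1).add (ha0.mul hc2)
  have hS3 := ha1.mul hc2
  have hS1 := hV.smooth_entropyVariation hT k
  have hS : ∀ ε : ℝ, _ := fun ε => (ha0.mul hc0).add
    (((SmoothField.const ε).mul hS1).add (((SmoothField.const (ε ^ 2)).mul hS2).add
      ((SmoothField.const (ε ^ 3)).mul hS3)))
  refine ⟨fun ε => ?_, ?_⟩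
  · have hi := (hS ε).integrableOn
    rw [IntegrableOn, ← Measure.prod_restrict] at hi
    have := hi.integral_prod_left
    rw [intervalIntegrable_iff_integrableOn_Icc_of_le hT.le]
    refine IntegrableOn.congr_fun this (fun t ht => ?_) measurableSet_Icc
    exact (setIntegral_congr_fun B.measurableSet_pts fun x hx => key ε t ht x hx).symm
  · have hval : ∀ ε, slabIntegral T B (entropyDensity P V ε k) = _ := fun ε => by
      rw [slabIntegral_congr hT (key ε), slabIntegral_add hT (ha0.mul hc0)
        (((SmoothField.const ε).mul hS1).add (((SmoothField.const (ε ^ 2)).mul hS2).add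
          ((SmoothField.const (ε ^ 3)).mul hS3))),
        slabIntegral_add hT ((SmoothField.const ε).mul hS1) (((SmoothField.const (ε ^ 2)).mul
          hS2).add ((SmoothField.const (ε ^ 3)).mul hS3)),
        slabIntegral_add hT ((SmoothField.const (ε ^ 2)).mul hS2)
          ((SmoothField.const (ε ^ 3)).mul hS3),
        slabIntegral_const_mul, slabIntegral_const_mul, slabIntegral_const_mul]
    simp only [hval]
    refine (HasDerivAt.const_add _ (((hasDerivAt_id (0 : ℝ)).mul_const _).add
      ((((hasDerivAt_id (0 : ℝ)).pow 2).mul_const _).add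
        (((hasDerivAt_id (0 : ℝ)).pow 3).mul_const _)))).congr_deriv ?_
    simp

/-- Differentiability of the action along an allowed variation. -/
theorem Variation.IsAllowed.hasDerivAt_action (hT : 0 < T) (hℓ : IsFunctionalDerivative B ℓ dℓ)
    (hV : V.IsAllowed bc dℓ F P) :
    HasDerivAt (action ℓ P V)
      (slabIntegral T B (fun t x => (dℓ (P.state t)).pairingDensity (V.state P t) x
        + (entropyVariation P V .fluid t x + entropyVariation P V .solid t x))) 0 := by
  have hX := P.smoothStates hT
  have hY := hV.smoothStates hT
  obtain ⟨hi, hd⟩ := hasDerivAt_integral_lagrangian hT hℓ hX hY (fun t x _ => P.b_symm t x)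
    (fun t x _ => V.state_b_symm P t x) fun t ht => P.admissible hT ht
  have hdX := (hℓ.smoothStates hX (fun t x _ => P.b_symm t x) fun t ht => P.admissible hT ht).1
  have hf := hV.hasDerivAt_entropy hT .fluid
  have hs := hV.hasDerivAt_entropy hT .solid
  rw [slabIntegral_add hT (hdX.pairingDensity hY) ((hV.smooth_entropyVariation hT .fluid).add
      (hV.smooth_entropyVariation hT .solid)),
    slabIntegral_add hT (hV.smooth_entropyVariation hT .fluid)
      (hV.smooth_entropyVariation hT .solid)]
  refine (hd.add (hf.2.add hs.2)).congr_of_eventuallyEq ?_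
  filter_upwards [hi] with ε hε
  rw [action, intervalIntegral.integral_add hε ((hf.1 ε).add (hs.1 ε)),
    intervalIntegral.integral_add (hf.1 ε) (hs.1 ε)]
  rfl

end Evolution

/-! ### The first variation in terms of the defects of the equations of motion -/

section Defects

variable {T : ℝ} {R : Phase → SmoothDomain} {B : SmoothDomain}

/-- The elastic stress `2 δℓ/δb · b`, present only in the solid. -/
def elasticTensor (dℓ : State → State) (P : Evolution T R B) : Phase → ℝ → E3 → Mat3
  | .fluid => fun _ _ => 0
  | .solid => fun t x => (2 : ℝ) • mulT ((dℓ (P.state t)).b x) (P.b t x)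

/-- The covector `δℓ/δb : ∇ b`, present only in the solid. -/
def elasticForce (dℓ : State → State) (P : Evolution T R B) : Phase → ℝ → E3 → E3
  | .fluid => fun _ _ => 0
  | .solid => fun t x => contractGrad (dℓ (P.state t)).b (P.b t) x

/-- The components of the total momentum `δℓ/δu + (s - σ) ∇γ`. -/
def totalMomentum (dℓ : State → State) (P : Evolution T R B) (k : Phase) (i : Fin 3) (t : ℝ)
    (x : E3) : ℝ :=
  (dℓ (P.state t)).u k x i + (P.s k t x - P.σ k t x) * pd i (P.γ k t) x

/-- The momentum equation for the total momentum `M = δℓ/δu + (s - σ) ∇γ`, left side minus right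
side. -/
def momentumDefect (dℓ : State → State) (F : Friction T B) (P : Evolution T R B) (k : Phase)
    (i : Fin 3) (t : ℝ) (x : E3) : ℝ :=
  deriv (fun τ => totalMomentum dℓ P k i τ x) t
    + ∑ j, (pd j (totalMomentum dℓ P k i t) x * P.u k t x j
      + totalMomentum dℓ P k j t x * pd i (fun y => P.u k t y j) x
      + totalMomentum dℓ P k i t x * pd j (fun y => P.u k t y j) x)
    - P.ρ k t x * pd i ((dℓ (P.state t)).ρ k) x - P.σ k t x * pd i ((dℓ (P.state t)).s k) x
    - ∑ j, pd j (fun y => F.stress k t y i j - elasticTensor dℓ P k t y i j) x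
    - (F.f k t x i - elasticForce dℓ P k t x i)

/-- The difference `\bar D_t s - \bar D_t σ`. -/
def entropyDefect (P : Evolution T R B) (k : Phase) (t : ℝ) (x : E3) : ℝ :=
  deriv (fun τ => P.s k τ x - P.σ k τ x) t
    + ∑ j, pd j (fun y => (P.s k t y - P.σ k t y) * P.u k t y j) x

/-- The sum `δℓ/δs + D_t γ`. -/
def temperatureDefect (dℓ : State → State) (P : Evolution T R B) (k : Phase) (t : ℝ) (x : E3) : ℝ :=
  (dℓ (P.state t)).s k x + matD (P.u k) (P.γ k) t x

/-- The part of the first variation density that belongs to one constituent and is left after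
integration by parts. -/
def phaseVariation (dℓ : State → State) (F : Friction T B) (P : Evolution T R B) (V : Variation)
    (k : Phase) (t : ℝ) (x : E3) : ℝ :=
  temperatureDefect dℓ P k t x * (V.δs k t x - V.δσ k t x)
    - ∑ i, momentumDefect dℓ F P k i t x * V.η P k t x i
    - entropyDefect P k t x * V.δγ k t x

variable {bc : BoundaryCondition} {ℓ : State → ℝ} {dℓ : State → State} {F : Friction T B}
  {P : Evolution T R B} {V : Variation}

theorem Evolution.smooth_dℓ (P : Evolution T R B) (hT : 0 < T)
    (hℓ : IsFunctionalDerivative B ℓ dℓ) : SmoothStates T B (fun t => dℓ (P.state t)) :=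
  (hℓ.smoothStates (P.smoothStates hT) (fun t x _ => P.b_symm t x)
    fun _ ht => P.admissible hT ht).1

theorem Evolution.dℓ_b_symm (P : Evolution T R B) (hT : 0 < T)
    (hℓ : IsFunctionalDerivative B ℓ dℓ) {t : ℝ} (ht : t ∈ Icc 0 T) {x : E3} (hx : x ∈ B.pts)
    (i j : Fin 3) : (dℓ (P.state t)).b x i j = (dℓ (P.state t)).b x j i :=
  (hℓ.smoothStates (P.smoothStates hT) (fun t x _ => P.b_symm t x)
    fun _ ht => P.admissible hT ht).2 t ht x hx i j

theorem SmoothField.mulT {A : Set E3} {f g : ℝ → E3 → Mat3} (hf : SmoothField T A f)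
    (hg : SmoothField T A g) : SmoothField T A (fun t x => mulT (f t x) (g t x)) :=
  smoothField_mat.2 fun i j => .sum fun k => (hf.apply₂ i k).mul (hg.apply₂ k j)

theorem SmoothField.contractGrad {A : Set E3} {f g : ℝ → E3 → Mat3} (hf : SmoothField T A f)
    (hg : SmoothField T A g) : SmoothField T A (fun t x => contractGrad (f t) (g t) x) :=
  smoothField_euclidean.2 fun k => by
    have : SmoothField T A fun t x => ∑ i, ∑ j, f t x i j * pd k (fun y => g t y i j) x :=
      .sum fun i => .sum fun j => (hf.apply₂ i j).mul ((hg.apply₂ i j).pderiv k)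
    exact this

theorem smooth_elasticTensor (hD : SmoothStates T B (fun t => dℓ (P.state t))) (k : Phase) :
    SmoothField T B.pts (elasticTensor dℓ P k) := by
  cases k
  · exact SmoothField.const 0
  · exact (SmoothField.const (2 : ℝ)).smul (hD.b.mulT P.smooth_b)

theorem smooth_elasticForce (hD : SmoothStates T B (fun t => dℓ (P.state t))) (k : Phase) :
    SmoothField T B.pts (elasticForce dℓ P k) := by
  cases k
  · exact SmoothField.const 0
  · exact hD.b.contractGrad P.smooth_b

theorem smooth_totalMomentum (hD : SmoothStates T B (fun t => dℓ (P.state t))) (k : Phase)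
    (i : Fin 3) : SmoothField T B.pts (totalMomentum dℓ P k i) :=
  ((hD.u k).apply i).add (((P.smooth_s k).sub (P.smooth_σ k)).mul ((P.smooth_γ k).pderiv i))

theorem smooth_momentumDefect (hT : 0 < T) (hD : SmoothStates T B (fun t => dℓ (P.state t)))
    (k : Phase) (i : Fin 3) : SmoothField T B.pts (momentumDefect dℓ F P k i) := by
  have hM := smooth_totalMomentum hD k
  have hu := (P.smooth_u k).apply
  exact (((((hM i).timeDeriv.add (.sum fun j => ((((hM i).pderiv j).mul (hu j)).add
    ((hM j).mul ((hu j).pderiv i))).add ((hM i).mul ((hu j).pderiv j)))).sub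
    ((P.smooth_ρ hT k).mul ((hD.ρ k).pderiv i))).sub
    ((P.smooth_σ k).mul ((hD.s k).pderiv i))).sub
    (.sum fun j => SmoothField.pderiv (((F.smooth_stress k).apply₂ i j).sub
      ((smooth_elasticTensor hD k).apply₂ i j)) j)).sub
    (((F.smooth_f k).apply i).sub ((smooth_elasticForce hD k).apply i))

theorem smooth_entropyDefect (P : Evolution T R B) (k : Phase) :
    SmoothField T B.pts (entropyDefect P k) :=
  ((P.smooth_s k).sub (P.smooth_σ k)).timeDeriv.add (.sum fun j =>
    (((P.smooth_s k).sub (P.smooth_σ k)).mul ((P.smooth_u k).apply j)).pderiv j)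

theorem smooth_temperatureDefect (hD : SmoothStates T B (fun t => dℓ (P.state t))) (k : Phase) :
    SmoothField T B.pts (temperatureDefect dℓ P k) :=
  (hD.s k).add ((P.smooth_u k).matD (P.smooth_γ k))

theorem Variation.IsAllowed.smooth_phaseVariation (hT : 0 < T)
    (hD : SmoothStates T B (fun t => dℓ (P.state t))) (hV : V.IsAllowed bc dℓ F P) (k : Phase) :
    SmoothField T B.pts (phaseVariation dℓ F P V k) :=
  (((smooth_temperatureDefect hD k).mul ((hV.smooth_s k).sub (hV.smooth_σ k))).sub
    (.sum fun i => (smooth_momentumDefect hT hD k i).mul ((hV.smooth_η k).apply i))).sub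
    ((smooth_entropyDefect P k).mul (hV.smooth_γ k))

/-- The terms of constituent `k` that integrate to zero. -/
def phaseParts (dℓ : State → State) (F : Friction T B) (P : Evolution T R B) (V : Variation)
    (k : Phase) : ℝ → E3 → ℝ :=
  partsIntegrand (totalMomentum dℓ P k) (fun i t x => V.η P k t x i) (fun i t x => P.u k t x i)
    (fun i j t x => F.stress k t x i j - elasticTensor dℓ P k t x i j)
    (fun t => (dℓ (P.state t)).ρ k) (P.ρ k) (fun t => (dℓ (P.state t)).s k) (P.σ k)
    (fun t x => P.s k t x - P.σ k t x) (V.δγ k)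

/-- The displacement vanishes at the end times because the variation of the motion does. -/
theorem Variation.IsAllowed.slabIntegral_phaseParts (hT : 0 < T)
    (hD : SmoothStates T B (fun t => dℓ (P.state t))) (hV : V.IsAllowed bc dℓ F P) (k : Phase)
    (η_bdry : ∀ t ∈ Icc 0 T, ∀ x ∈ B.bdry, V.η P k t x = 0)
    (γ_bdry : ∀ t ∈ Icc 0 T, ∀ x ∈ B.bdry, P.u k t x = 0 ∨ V.δγ k t x = 0) :
    SmoothField T B.pts (phaseParts dℓ F P V k) ∧ slabIntegral T B (phaseParts dℓ F P V k) = 0 := by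
  refine slabIntegral_partsIntegrand hT (smooth_totalMomentum hD k) (hV.smooth_η k).apply
    (P.smooth_u k).apply (fun i j => ((F.smooth_stress k).apply₂ i j).sub
      ((smooth_elasticTensor hD k).apply₂ i j)) (hD.ρ k) (P.smooth_ρ hT k) (hD.s k) (P.smooth_σ k)
    ((P.smooth_s k).sub (P.smooth_σ k)) (hV.smooth_γ k) ?_ ?_ ?_ (hV.γ_ends k)
  · intro t ht x hx i
    simp [η_bdry t ht x hx]
  · intro t ht x hx i
    rcases γ_bdry t ht x hx with h | h <;> simp [h]
  · intro x hx i
    have h0 := (hV.map_ends k _ ((P.motion k).mapsTo_inv 0 ⟨le_rfl, hT.le⟩ hx)).1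
    have h1 := (hV.map_ends k _ ((P.motion k).mapsTo_inv T ⟨hT.le, le_rfl⟩ hx)).2
    simp [Variation.η, h0, h1]

/-- The terms of one constituent in the first variation, before the variational constraint is
used. -/
theorem Variation.IsAllowed.phase_split (hV : V.IsAllowed bc dℓ F P) {t : ℝ}
    (ht : t ∈ Icc 0 T) {x : E3} (hx : x ∈ B.pts) (k : Phase) :
    inner ℝ ((dℓ (P.state t)).u k x) ((V.state P t).u k x)
      + (dℓ (P.state t)).ρ k x * (V.state P t).ρ k x
      + (dℓ (P.state t)).s k x * (V.state P t).s k x + entropyVariation P V k t x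
    = phaseVariation dℓ F P V k t x + phaseParts dℓ F P V k t x
      + ((dℓ (P.state t)).s k x * densVar (V.η P k) (V.δσ k) (P.σ k) t x
        - inner ℝ (F.f k t x) (V.η P k t x) + ddot (F.stress k t x) (jac (V.η P k t) x))
      + (inner ℝ (elasticForce dℓ P k t x) (V.η P k t x)
        - ddot (elasticTensor dℓ P k t x) (jac (V.η P k t) x)) := by
  have h1 : (V.state P t).ρ k x = - ∑ j, pd j (fun y => P.ρ k t y * V.η P k t y j) x := rfl
  have h2 : (V.state P t).s k x = V.δs k t x := rfl
  have h3 : densVar (V.η P k) (V.δσ k) (P.σ k) t x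
      = V.δσ k t x + ∑ j, pd j (fun y => P.σ k t y * V.η P k t y j) x := rfl
  rw [h1, h2, h3]
  simp only [entropyVariation, phaseVariation, phaseParts, partsIntegrand, momentumDefect,
    entropyDefect, temperatureDefect, matD_eq_sum, fderiv_eq_sum_pd, inner_eq_sum,
    hV.state_u_apply ht hx k, totalMomentum, ddot, jac]
  generalize deriv (fun τ => P.s k τ x - P.σ k τ x) t = a1
  simp only [Fin.sum_univ_three]
  ring

/-- The variation of `b` is conjugate to the elastic stress and the elastic force. -/
theorem ddot_lieTensor (D b : E3 → Mat3) (η : E3 → E3) (x : E3)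
    (hD : ∀ i j, D x i j = D x j i) (hb : ∀ i j, b x i j = b x j i) :
    ddot (D x) (- lieTensor η b x)
      = ddot ((2 : ℝ) • mulT (D x) (b x)) (jac η x) - inner ℝ (contractGrad D b x) (η x) := by
  simp only [inner_eq_sum, ddot, lieTensor, mulT, jac, contractGrad, Pi.neg_apply, Pi.smul_apply,
    smul_eq_mul, Fin.sum_univ_three]
  rw [hD 1 0, hD 2 0, hD 2 1, hb 1 0, hb 2 0, hb 2 1]
  ring

/-- The first variation of the action, for displacements that vanish on the boundary. -/
theorem Variation.IsAllowed.hasDerivAt_action_defects (hT : 0 < T)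
    (hℓ : IsFunctionalDerivative B ℓ dℓ) (hV : V.IsAllowed bc dℓ F P)
    (η_bdry : ∀ t ∈ Icc 0 T, ∀ x ∈ B.bdry, ∀ k, V.η P k t x = 0)
    (γ_bdry : ∀ t ∈ Icc 0 T, ∀ x ∈ B.bdry, ∀ k, P.u k t x = 0 ∨ V.δγ k t x = 0) :
    HasDerivAt (action ℓ P V)
      (slabIntegral T B (fun t x => phaseVariation dℓ F P V .fluid t x
        + phaseVariation dℓ F P V .solid t x + (dℓ (P.state t)).φ x * V.δφ t x)) 0 := by
  have hD := P.smooth_dℓ hT hℓ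
  have hp := fun k => hV.slabIntegral_phaseParts hT hD k (fun t ht x hx => η_bdry t ht x hx k)
    fun t ht x hx => γ_bdry t ht x hx k
  have hsmooth := ((hV.smooth_phaseVariation hT hD .fluid).add
    (hV.smooth_phaseVariation hT hD .solid)).add (hD.φ.mul hV.smooth_φ)
  refine (hV.hasDerivAt_action hT hℓ).congr_deriv ?_
  rw [slabIntegral_congr hT (g := fun t x => (phaseVariation dℓ F P V .fluid t x
        + phaseVariation dℓ F P V .solid t x + (dℓ (P.state t)).φ x * V.δφ t x)
        + (phaseParts dℓ F P V .fluid t x + phaseParts dℓ F P V .solid t x)),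
    slabIntegral_add hT hsmooth ((hp .fluid).1.add (hp .solid).1),
    slabIntegral_add hT (hp .fluid).1 (hp .solid).1, (hp .fluid).2, (hp .solid).2, add_zero,
    add_zero]
  intro t ht x hx
  have hf := hV.phase_split ht hx .fluid
  have hs := hV.phase_split ht hx .solid
  -- The exchange fluxes cancel in the sum of the two constraints.
  have cf := hV.constraint t ht x hx .fluid
  have cs := hV.constraint t ht x hx .solid
  have hb : ddot ((dℓ (P.state t)).b x) ((V.state P t).b x) = _ :=
    ddot_lieTensor (dℓ (P.state t)).b (P.b t) (V.η P .solid t) x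
      (P.dℓ_b_symm hT hℓ ht hx) (P.b_symm t x)
  simp only [VariationalConstraint, Friction.J] at cf cs
  simp only [elasticForce, elasticTensor, inner_zero_left] at hf hs
  have h0 : ∀ C : Mat3, ddot 0 C = 0 := fun C => by simp [ddot]
  rw [h0] at hf
  have hφ : (V.state P t).φ x = V.δφ t x := rfl
  rw [State.pairingDensity, hb, hφ]
  linarith

end Defects

/-! ### Allowed variations with prescribed displacements -/

section Test

variable {T : ℝ} {R : Phase → SmoothDomain} {B : SmoothDomain} {bc : BoundaryCondition}
  {ℓ : State → ℝ} {dℓ : State → State} {F : Friction T B} {P : Evolution T R B}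

theorem BoundaryCondition.allows_zero (bc : BoundaryCondition) (k : Phase) (x : E3) :
    bc.Allows B k x 0 := by
  cases bc <;> cases k <;> simp [BoundaryCondition.Allows]

theorem Friction.smooth_J (F : Friction T B) (k l : Phase) : SmoothField T B.pts (F.J k l) := by
  cases k <;> cases l
  exacts [F.smooth_j.neg, F.smooth_j, F.smooth_j, F.smooth_j.neg]

theorem SmoothField.inner {A : Set E3} {f g : ℝ → E3 → E3} (hf : SmoothField T A f)
    (hg : SmoothField T A g) : SmoothField T A (fun t x => inner ℝ (f t x) (g t x)) :=
  SmoothNear.inner hf hg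

theorem SmoothField.ddot_jac {A : Set E3} {f : ℝ → E3 → Mat3} {v : ℝ → E3 → E3}
    (hf : SmoothField T A f) (hv : SmoothField T A v) :
    SmoothField T A (fun t x => ddot (f t x) (jac (v t) x)) :=
  .sum fun i => .sum fun j => (hf.apply₂ i j).mul ((hv.apply i).pderiv j)

/-- Displacements `η` that vanish on the boundary and at the end times, variations `δγ` that vanish
at the end times, and arbitrary differences `δs - δσ` and variations `δφ` are realized by an allowed
variation: since `δℓ/δs` has no zeros, the variational constraint can be solved for `δσ`. -/
theorem exists_isAllowed (hT : 0 < T) (hD : SmoothStates T B (fun t => dℓ (P.state t)))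
    (hne : ∀ t ∈ Icc 0 T, ∀ x ∈ B.pts, ∀ k, (dℓ (P.state t)).s k x ≠ 0)
    {η : Phase → ℝ → E3 → E3} {θ χ : Phase → ℝ → E3 → ℝ} {ψ : ℝ → E3 → ℝ}
    (hη : ∀ k, SmoothField T B.pts (η k)) (hθ : ∀ k, SmoothField T B.pts (θ k))
    (hχ : ∀ k, SmoothField T B.pts (χ k)) (hψ : SmoothField T B.pts ψ)
    (η_bdry : ∀ t ∈ Icc 0 T, ∀ x ∈ B.bdry, ∀ k, η k t x = 0)
    (η_ends : ∀ k, ∀ x ∈ B.pts, η k 0 x = 0 ∧ η k T x = 0)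
    (θ_ends : ∀ k, ∀ x ∈ B.pts, θ k 0 x = 0 ∧ θ k T x = 0) :
    ∃ V : Variation, V.IsAllowed bc dℓ F P ∧
      (∀ k, ∀ t ∈ Icc 0 T, ∀ x ∈ B.pts, V.η P k t x = η k t x) ∧ V.δγ = θ ∧ V.δφ = ψ ∧
      ∀ k t x, V.δs k t x - V.δσ k t x = χ k t x := by
  let rhs : Phase → ℝ → E3 → ℝ := fun k t x =>
    inner ℝ (F.f k t x) (η k t x) - ddot (F.stress k t x) (jac (η k t) x)
      + (F.J k .fluid t x * matVar (η .fluid) (θ .fluid) (P.γ .fluid) t x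
        + F.J k .solid t x * matVar (η .solid) (θ .solid) (P.γ .solid) t x)
  let δσ : Phase → ℝ → E3 → ℝ := fun k t x =>
    rhs k t x / (dℓ (P.state t)).s k x - dvg (fun y => P.σ k t y • η k t y) x
  have hmat : ∀ k, SmoothField T B.pts (matVar (η k) (θ k) (P.γ k)) := fun k =>
    (hθ k).add ((P.smooth_γ k).spaceDeriv (hη k))
  have hrhs : ∀ k, SmoothField T B.pts (rhs k) := fun k =>
    (((F.smooth_f k).inner (hη k)).sub ((F.smooth_stress k).ddot_jac (hη k))).add
      (((F.smooth_J k .fluid).mul (hmat .fluid)).add ((F.smooth_J k .solid).mul (hmat .solid)))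
  have hδσ : ∀ k, SmoothField T B.pts (δσ k) := fun k =>
    ((hrhs k).div (hD.s k) fun t ht x hx => hne t ht x hx k).sub ((P.smooth_σ k).dvg_smul (hη k))
  let V : Variation :=
    { δmap := fun k t X => η k t ((P.motion k).map t X)
      δs := fun k t x => δσ k t x + χ k t x
      δσ := δσ
      δγ := θ
      δφ := ψ }
  have hVη : ∀ k, ∀ t ∈ Icc 0 T, ∀ x ∈ B.pts, V.η P k t x = η k t x := fun k t ht x hx => by
    simp only [V, Variation.η, (P.motion k).map_inv ht hx]
  have hmap : ∀ k, SmoothField T (R k).pts (V.δmap k) := fun k => (P.motion k).smooth_comp_map (hη k)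
  have hsη : ∀ k, SmoothField T B.pts (V.η P k) := fun k => (P.motion k).smooth_comp_inv (hmap k)
  -- The displacement of `V` equals `η` on the cylinder only, hence so do its derivatives.
  refine ⟨V, ?_, hVη, rfl, rfl, fun k t x => by simp [V]⟩
  refine ⟨hmap, fun k => (hδσ k).add (hχ k), hδσ, hθ, hψ, ?_, ?_, θ_ends, ?_⟩
  · intro t ht x hx k
    rw [hVη k t ht x (B.bdry_subset hx), η_bdry t ht x hx k]
    exact bc.allows_zero k x
  · intro k X hX
    exact ⟨(η_ends k _ ((P.motion k).mapsTo_map 0 ⟨le_rfl, hT.le⟩ hX)).1,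
      (η_ends k _ ((P.motion k).mapsTo_map T ⟨hT.le, le_rfl⟩ hX)).2⟩
  · intro t ht x hx k
    have hjac : jac (V.η P k t) x = jac (η k t) x := by
      ext i j
      exact ((hsη k).apply i).pd_eq hT ((hη k).apply i)
        (fun t ht x hx => by rw [hVη k t ht x hx]) ht hx j
    have hdvg : dvg (fun y => P.σ k t y • V.η P k t y) x = dvg (fun y => P.σ k t y • η k t y) x :=
      Finset.sum_congr rfl fun i _ =>
        ((P.smooth_σ k).smul (hsη k)).apply i |>.pd_eq hT (((P.smooth_σ k).smul (hη k)).apply i)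
          (fun t ht x hx => by simp only [hVη k t ht x hx]) ht hx i
    have hD0 := hne t ht x hx k
    simp only [VariationalConstraint, densVar, matVar, hjac, hdvg, hVη _ t ht x hx]
    show (dℓ (P.state t)).s k x * (δσ k t x + dvg (fun y => P.σ k t y • η k t y) x) = rhs k t x
    simp only [δσ]
    field_simp
    ring

end Test

/-! ### Critical evolutions and the defects -/

section General

variable {T : ℝ} {R : Phase → SmoothDomain} {B : SmoothDomain} {bc : BoundaryCondition}
  {ℓ : State → ℝ} {dℓ : State → State} {F : Friction T B} {P : Evolution T R B}

/-- All coefficients of the first variation vanish. -/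
structure DefectFree (dℓ : State → State) (F : Friction T B) (P : Evolution T R B) : Prop where
  temperature : ∀ t ∈ Icc 0 T, ∀ x ∈ B.pts, ∀ k, temperatureDefect dℓ P k t x = 0
  entropy : ∀ t ∈ Icc 0 T, ∀ x ∈ B.pts, ∀ k, entropyDefect P k t x = 0
  momentum : ∀ t ∈ Icc 0 T, ∀ x ∈ B.pts, ∀ k i, momentumDefect dℓ F P k i t x = 0
  volume_fraction : ∀ t ∈ Icc 0 T, ∀ x ∈ B.pts, (dℓ (P.state t)).φ x = 0

/-- The weight `t (T - t) g²` is positive for `0 < t < T` and `g < 0`, on a dense subset of the cylinder. -/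
theorem eq_zero_of_weight_mul_eq_zero (hT : 0 < T) {f : ℝ → E3 → ℝ} (hf : SmoothField T B.pts f)
    (h : ∀ t ∈ Icc 0 T, ∀ x ∈ B.pts, t * (T - t) * B.g x ^ 2 * f t x ^ 2 = 0) :
    ∀ t ∈ Icc 0 T, ∀ x ∈ B.pts, f t x = 0 := by
  have hEq : EqOn (fun p : ℝ × E3 => f p.1 p.2) (fun _ => 0) (cyl T B) := by
    refine EqOn.of_subset_closure (s := Ioo 0 T ×ˢ {x | B.g x < 0}) ?_
      (SmoothNear.continuousOn hf) continuousOn_const ?_ ?_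
    · rintro ⟨t, x⟩ ⟨ht, hx⟩
      have hx' : B.g x < 0 := hx
      have h0 := h t (Ioo_subset_Icc_self ht) x hx'.le
      have ht0 : t ≠ 0 := ht.1.ne'
      have ht1 : T - t ≠ 0 := (sub_pos.2 ht.2).ne'
      simpa [ht0, ht1, hx'.ne] using h0
    · exact prod_mono Ioo_subset_Icc_self fun x hx => le_of_lt (α := ℝ) hx
    · rw [closure_prod_eq, closure_Ioo hT.ne]
      exact prod_mono le_rfl B.pts_subset_closure_neg
  intro t ht x hx
  exact hEq (mk_mem_prod ht hx)

/-- Testing with the defects themselves, weighted so as to vanish on the boundary and at the end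
times, shows that they vanish for a critical evolution. -/
theorem IsCritical.defectFree (hT : 0 < T) (hℓ : IsFunctionalDerivative B ℓ dℓ)
    (hne : ∀ t ∈ Icc 0 T, ∀ x ∈ B.pts, ∀ k, (dℓ (P.state t)).s k x ≠ 0)
    (hP : IsCritical bc ℓ dℓ F P) : DefectFree dℓ F P := by
  have hD := P.smooth_dℓ hT hℓ
  -- A smooth nonnegative weight that vanishes on the boundary and at the end times only.
  let w : ℝ → E3 → ℝ := fun t x => t * (T - t) * B.g x ^ 2
  have hw : SmoothField T B.pts w := by
    refine SmoothNear.of_contDiff ?_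
    have hg : ContDiff ℝ ∞ fun p : ℝ × E3 => B.g p.2 := B.smooth.comp contDiff_snd
    exact (contDiff_fst.mul (contDiff_const.sub contDiff_fst)).mul (hg.pow 2)
  have hw_bdry : ∀ t, ∀ x ∈ B.bdry, w t x = 0 := fun t x hx => by
    simp [w, show B.g x = 0 from hx]
  have hw_ends : ∀ x, w 0 x = 0 ∧ w T x = 0 := fun x => by simp [w]
  have hw_nn : ∀ t ∈ Icc 0 T, ∀ x, 0 ≤ w t x := fun t ht x =>
    mul_nonneg (mul_nonneg ht.1 (sub_nonneg.2 ht.2)) (sq_nonneg _)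
  have hE := fun k i => smooth_momentumDefect (F := F) hT hD k i
  have hG := fun k => smooth_entropyDefect P k
  have hΘ := fun k => smooth_temperatureDefect hD k
  obtain ⟨V, hV, hVη, hVγ, hVφ, hVs⟩ := exists_isAllowed (bc := bc) (F := F) hT hD hne
    (η := fun k t x => WithLp.toLp 2 fun i => - (w t x * momentumDefect dℓ F P k i t x))
    (θ := fun k t x => - (w t x * entropyDefect P k t x))
    (χ := fun k => temperatureDefect dℓ P k) (ψ := fun t => (dℓ (P.state t)).φ)
    (fun k => smoothField_euclidean.2 fun i => (hw.mul (hE k i)).neg)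
    (fun k => (hw.mul (hG k)).neg) hΘ hD.φ
    (fun t _ x hx k => by ext i; simp [hw_bdry t x hx])
    (fun k x _ => by constructor <;> ext i <;> simp [hw_ends x])
    (fun k x _ => by simp [hw_ends x])
  -- For this variation the first variation is the integral of these weighted squares.
  let q : Phase → ℝ → E3 → ℝ := fun k t x =>
    temperatureDefect dℓ P k t x * temperatureDefect dℓ P k t x
      + ∑ i, w t x * (momentumDefect dℓ F P k i t x * momentumDefect dℓ F P k i t x)
      + w t x * (entropyDefect P k t x * entropyDefect P k t x)
  have hq : ∀ k, SmoothField T B.pts (q k) := fun k =>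
    (((hΘ k).mul (hΘ k)).add (.sum fun i => hw.mul ((hE k i).mul (hE k i)))).add
      (hw.mul ((hG k).mul (hG k)))
  have hq_nn : ∀ k, ∀ t ∈ Icc 0 T, ∀ x ∈ B.pts, 0 ≤ q k t x := fun k t ht x _ =>
    add_nonneg (add_nonneg (mul_self_nonneg _) (Finset.sum_nonneg fun i _ =>
      mul_nonneg (hw_nn t ht x) (mul_self_nonneg _))) (mul_nonneg (hw_nn t ht x) (mul_self_nonneg _))
  have hder := hV.hasDerivAt_action_defects hT hℓ
    (fun t ht x hx k => by
      rw [hVη k t ht x (B.bdry_subset hx)]; ext i; simp [hw_bdry t x hx])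
    (fun t ht x hx k => Or.inr (by simp [hVγ, hw_bdry t x hx]))
  have hzero := hder.unique (hP.stationary V hV)
  rw [slabIntegral_congr hT (g := fun t x => q .fluid t x + q .solid t x
    + (dℓ (P.state t)).φ x * (dℓ (P.state t)).φ x)] at hzero
  · have hall := eq_zero_of_slabIntegral_eq_zero hT
      (((hq .fluid).add (hq .solid)).add (hD.φ.mul hD.φ))
      (fun t ht x hx => add_nonneg (add_nonneg (hq_nn _ t ht x hx) (hq_nn _ t ht x hx))
        (mul_self_nonneg _)) hzero
    have hqz : ∀ k, ∀ t ∈ Icc 0 T, ∀ x ∈ B.pts, q k t x = 0 := by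
      intro k t ht x hx
      have h0 := hall t ht x hx
      have h1 := hq_nn .fluid t ht x hx
      have h2 := hq_nn .solid t ht x hx
      have h3 := mul_self_nonneg ((dℓ (P.state t)).φ x)
      cases k <;> linarith
    have hterms : ∀ k, ∀ t ∈ Icc 0 T, ∀ x ∈ B.pts, temperatureDefect dℓ P k t x = 0
        ∧ (∀ i, w t x * (momentumDefect dℓ F P k i t x * momentumDefect dℓ F P k i t x) = 0)
        ∧ w t x * (entropyDefect P k t x * entropyDefect P k t x) = 0 := by
      intro k t ht x hx
      have h0 := hqz k t ht x hx
      have h1 := mul_self_nonneg (temperatureDefect dℓ P k t x)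
      have h2 : ∀ i, 0 ≤ w t x * (momentumDefect dℓ F P k i t x * momentumDefect dℓ F P k i t x) :=
        fun i => mul_nonneg (hw_nn t ht x) (mul_self_nonneg _)
      have h3 := mul_nonneg (hw_nn t ht x) (mul_self_nonneg (entropyDefect P k t x))
      have h4 := Finset.sum_nonneg fun i (_ : i ∈ Finset.univ) => h2 i
      refine ⟨mul_self_eq_zero.1 (by simp only [q] at h0; linarith), fun i => ?_,
        by simp only [q] at h0; linarith⟩
      exact (Finset.sum_eq_zero_iff_of_nonneg fun i _ => h2 i).1
        (by simp only [q] at h0; linarith) i (Finset.mem_univ i)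
    refine ⟨fun t ht x hx k => (hterms k t ht x hx).1, fun t ht x hx k => ?_,
      fun t ht x hx k i => ?_, fun t ht x hx => ?_⟩
    · refine eq_zero_of_weight_mul_eq_zero hT (hG k) (fun t ht x hx => ?_) t ht x hx
      rw [pow_two (entropyDefect P k t x)]
      exact (hterms k t ht x hx).2.2
    · refine eq_zero_of_weight_mul_eq_zero hT (hE k i) (fun t ht x hx => ?_) t ht x hx
      rw [pow_two (momentumDefect dℓ F P k i t x)]
      exact (hterms k t ht x hx).2.1 i
    · have h0 := hall t ht x hx
      rw [hqz _ t ht x hx, hqz _ t ht x hx] at h0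
      exact mul_self_eq_zero.1 (by linarith)
  · intro t ht x hx
    have hk : ∀ k, phaseVariation dℓ F P V k t x = q k t x := by
      intro k
      simp only [phaseVariation, hVs, hVγ, hVη k t ht x hx, q, Fin.sum_univ_three]
      ring
    rw [hk, hk, hVφ]

/-- An evolution without defects is stationary with respect to variations with `η = 0` on the
boundary, provided its velocities vanish there. -/
theorem DefectFree.stationary (hT : 0 < T) (hℓ : IsFunctionalDerivative B ℓ dℓ)
    (hbc : P.SatisfiesBC .noSlip) (h : DefectFree dℓ F P) {V : Variation}
    (hV : V.IsAllowed .noSlip dℓ F P) : HasDerivAt (action ℓ P V) 0 0 := by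
  refine (hV.hasDerivAt_action_defects hT hℓ (fun t ht x hx k => hV.boundary t ht x hx k)
    fun t ht x hx k => Or.inl (hbc t ht x hx k)).congr_deriv ?_
  rw [slabIntegral_congr hT (g := fun _ _ => 0)]
  · simp [slabIntegral]
  · intro t ht x hx
    simp [phaseVariation, h.temperature t ht x hx, h.momentum t ht x hx, h.entropy t ht x hx,
      h.volume_fraction t ht x hx]

/-! ### The defects and the general system -/

theorem densD_sub_densD (P : Evolution T R B) {t : ℝ} (ht : t ∈ Icc 0 T) {x : E3}
    (hx : x ∈ B.pts) (k : Phase) :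
    densD (P.u k) (P.s k) t x - densD (P.u k) (P.σ k) t x = entropyDefect P k t x := by
  have hs := P.smooth_s k
  have hσ := P.smooth_σ k
  have hu := (P.smooth_u k).apply
  have h1 : deriv (fun τ => P.s k τ x - P.σ k τ x) t = _ :=
    ((hs.differentiableAt_time ht hx).hasDerivAt.sub
      (hσ.differentiableAt_time ht hx).hasDerivAt).deriv
  have h2 : ∀ j, pd j (fun y => (P.s k t y - P.σ k t y) * P.u k t y j) x = _ := fun j =>
    (congrArg (fun f => pd j f x) (funext fun y => sub_mul _ _ _)).trans
      (pd_sub ((hs.mul (hu j)).differentiableAt_space ht hx)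
        ((hσ.mul (hu j)).differentiableAt_space ht hx))
  rw [entropyDefect, h1]
  simp only [h2, densD, dvg, Finset.sum_sub_distrib, PiLp.smul_apply, smul_eq_mul]
  ring

theorem matD_eq_neg_iff (dℓ : State → State) (P : Evolution T R B) (k : Phase) (t : ℝ) (x : E3) :
    matD (P.u k) (P.γ k) t x = - (dℓ (P.state t)).s k x ↔ temperatureDefect dℓ P k t x = 0 := by
  rw [temperatureDefect, add_comm, eq_neg_iff_add_eq_zero]

/-- If the temperature and entropy defects vanish, the contribution of `(s - σ) ∇γ` to the total
momentum turns `σ ∇ δℓ/δs` into `s ∇ δℓ/δs`. -/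
theorem momentumDefect_eq (hT : 0 < T) (hD : SmoothStates T B (fun t => dℓ (P.state t)))
    {k : Phase} (hΘ : ∀ t ∈ Icc 0 T, ∀ x ∈ B.pts, temperatureDefect dℓ P k t x = 0)
    (hG : ∀ t ∈ Icc 0 T, ∀ x ∈ B.pts, entropyDefect P k t x = 0) {t : ℝ} (ht : t ∈ Icc 0 T)
    {x : E3} (hx : x ∈ B.pts) (i : Fin 3) :
    momentumDefect dℓ F P k i t x
      = deriv (fun τ => (dℓ (P.state τ)).u k x) t i
        + lieMomentum (P.u k t) ((dℓ (P.state t)).u k) x i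
        - P.ρ k t x * pd i ((dℓ (P.state t)).ρ k) x - P.s k t x * pd i ((dℓ (P.state t)).s k) x
        - ∑ j, pd j (fun y => F.stress k t y i j - elasticTensor dℓ P k t y i j) x
        - (F.f k t x i - elasticForce dℓ P k t x i) := by
  have hd := (P.smooth_s k).sub (P.smooth_σ k)
  have hγ := P.smooth_γ k
  have hu := (P.smooth_u k).apply
  have hm := (hD.u k).apply
  have eT : ∀ i, deriv (fun τ => totalMomentum dℓ P k i τ x) t = _ := fun i =>
    (((hm i).differentiableAt_time ht hx).hasDerivAt.add
      ((hd.differentiableAt_time ht hx).hasDerivAt.mul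
        ((hγ.pderiv i).differentiableAt_time ht hx).hasDerivAt)).deriv
  have eX : ∀ j i, pd j (totalMomentum dℓ P k i t) x = _ := fun j i =>
    (((hm i).add (hd.mul (hγ.pderiv i))).hasDerivAt_pd ht hx j).unique
      (((hm i).hasDerivAt_pd ht hx j).add
        ((hd.hasDerivAt_pd ht hx j).mul ((hγ.pderiv i).hasDerivAt_pd ht hx j)))
  -- The gradient of `D_t γ = - δℓ/δs`.
  have hsum : SmoothField T B.pts (fun t x => ∑ j, pd j (P.γ k t) x * P.u k t x j) :=
    .sum fun j => (hγ.pderiv j).mul (hu j)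
  have hgrad := (hγ.timeDeriv.add hsum).pd_eq hT (hD.s k).neg (fun t ht x hx => by
    have := (matD_eq_neg_iff dℓ P k t x).2 (hΘ t ht x hx)
    rwa [matD_eq_sum] at this) ht hx i
  rw [pd_add (hγ.timeDeriv.differentiableAt_space ht hx) (hsum.differentiableAt_space ht hx),
    pd_sum (fun j => ((hγ.pderiv j).mul (hu j)).differentiableAt_space ht hx), pd_neg,
    ← hγ.deriv_pd ht hx] at hgrad
  have e1 : ∀ j, pd i (fun y => pd j (P.γ k t) y * P.u k t y j) x
      = pd j (pd i (P.γ k t)) x * P.u k t x j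
        + pd j (P.γ k t) x * pd i (fun y => P.u k t y j) x := by
    intro j
    rw [pd_mul ((hγ.pderiv j).differentiableAt_space ht hx)
      ((hu j).differentiableAt_space ht hx)]
    congr 2
    exact hγ.pd_pd ht hx i j
  have hG0 := hG t ht x hx
  have e2 : ∀ j, pd j (fun y => (P.s k t y - P.σ k t y) * P.u k t y j) x = _ := fun j =>
    pd_mul (hd.differentiableAt_space ht hx) ((hu j).differentiableAt_space ht hx)
  simp only [entropyDefect, e2] at hG0
  simp only [e1] at hgrad
  rw [deriv_comp_apply ((hD.u k).differentiableAt_time ht hx)]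
  rw [momentumDefect, eT]
  simp only [eX, lieMomentum, totalMomentum, add_zero, zero_smul]
  generalize (∑ j, pd j (fun y => F.stress k t y i j - elasticTensor dℓ P k t y i j) x) = S
  simp only [Fin.sum_univ_three] at hG0 hgrad ⊢
  linear_combination (pd i (P.γ k t) x) * hG0 + (P.s k t x - P.σ k t x) * hgrad

/-- The phenomenological constraints together with vanishing defects are the general system together
with the auxiliary conditions. -/
theorem phenomenological_and_defectFree_iff (hT : 0 < T) (hℓ : IsFunctionalDerivative B ℓ dℓ) :
    ((∀ t ∈ Icc 0 T, ∀ x ∈ B.pts, ∀ k, PhenomenologicalConstraint dℓ F P k t x) ∧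
      DefectFree dℓ F P) ↔ GeneralSystem dℓ F P ∧ AuxiliaryConditions dℓ P := by
  have hD := P.smooth_dℓ hT hℓ
  have haux : ((∀ t ∈ Icc 0 T, ∀ x ∈ B.pts, ∀ k, temperatureDefect dℓ P k t x = 0) ∧
      ∀ t ∈ Icc 0 T, ∀ x ∈ B.pts, ∀ k, entropyDefect P k t x = 0) ↔ AuxiliaryConditions dℓ P := by
    constructor
    · intro h t ht x hx k
      refine ⟨?_, (matD_eq_neg_iff dℓ P k t x).2 (h.1 t ht x hx k)⟩
      have := densD_sub_densD P ht hx k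
      rw [h.2 t ht x hx k] at this
      linarith
    · intro h
      refine ⟨fun t ht x hx k => (matD_eq_neg_iff dℓ P k t x).1 (h t ht x hx k).2,
        fun t ht x hx k => ?_⟩
      rw [← densD_sub_densD P ht hx k, (h t ht x hx k).1, sub_self]
  have hf : ∀ t x i, (∑ j, pd j (fun y => F.stress .fluid t y i j
      - elasticTensor dℓ P .fluid t y i j) x) = dvgT (F.stress .fluid t) x i := by
    intro t x i
    simp [elasticTensor, dvgT]
  have hs : ∀ t x i, (∑ j, pd j (fun y => F.stress .solid t y i j
      - elasticTensor dℓ P .solid t y i j) x) = dvgT (fun y => F.stress .solid t y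
            - (2 : ℝ) • mulT ((dℓ (P.state t)).b y) (P.b t y)) x i := fun t x i => rfl
  have hef : ∀ t x i, elasticForce dℓ P .fluid t x i = 0 := fun _ _ _ => rfl
  have hes : ∀ t x i, elasticForce dℓ P .solid t x i
      = contractGrad (dℓ (P.state t)).b (P.b t) x i := fun _ _ _ => rfl
  constructor
  · rintro ⟨hph, hdf⟩
    have hA := haux.1 ⟨hdf.temperature, hdf.entropy⟩
    have hmom := fun k t (ht : t ∈ Icc 0 T) x (hx : x ∈ B.pts) i =>
      (momentumDefect_eq (F := F) (k := k) hT hD (fun t ht x hx => hdf.temperature t ht x hx k)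
        (fun t ht x hx => hdf.entropy t ht x hx k) ht hx i).symm.trans (hdf.momentum t ht x hx k i)
    refine ⟨⟨fun t ht x hx => ?_, fun t ht x hx => ?_, P.continuityEquations hT,
      fun t ht x hx => ?_, fun t ht x hx => ?_, hdf.volume_fraction⟩, hA⟩
    · ext i
      have := hmom .fluid t ht x hx i
      rw [hf, hef] at this
      simp only [PiLp.add_apply, PiLp.smul_apply, smul_eq_mul, gradient_apply]
      linarith
    · ext i
      have := hmom .solid t ht x hx i
      rw [hs, hes] at this
      simp only [PiLp.add_apply, PiLp.sub_apply, PiLp.smul_apply, smul_eq_mul, gradient_apply]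
      linarith
    · have h := hph t ht x hx .fluid
      simp only [PhenomenologicalConstraint, (hA t ht x hx _).1, (hA t ht x hx _).2,
        Friction.J] at h
      simp only [Friction.J]
      linarith
    · have h := hph t ht x hx .solid
      simp only [PhenomenologicalConstraint, (hA t ht x hx _).1, (hA t ht x hx _).2,
        Friction.J] at h
      simp only [Friction.J]
      linarith
  · rintro ⟨hS, hA⟩
    obtain ⟨hΘ, hG⟩ := haux.2 hA
    refine ⟨fun t ht x hx k => ?_, hΘ, hG, fun t ht x hx k i => ?_, hS.volume_fraction⟩
    · simp only [PhenomenologicalConstraint, (hA t ht x hx _).1, (hA t ht x hx _).2]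
      cases k
      · have h := hS.entropy_fluid t ht x hx
        simp only [Friction.J] at h ⊢
        linarith
      · have h := hS.entropy_solid t ht x hx
        simp only [Friction.J] at h ⊢
        linarith
    · rw [momentumDefect_eq hT hD (fun t ht x hx => hΘ t ht x hx k)
        (fun t ht x hx => hG t ht x hx k) ht hx i]
      cases k
      · have h := congrArg (fun v : E3 => v i) (hS.momentum_fluid t ht x hx)
        simp only [PiLp.add_apply, PiLp.smul_apply, smul_eq_mul, gradient_apply] at h
        rw [hf, hef]
        linarith
      · have h := congrArg (fun v : E3 => v i) (hS.momentum_solid t ht x hx)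
        simp only [PiLp.add_apply, PiLp.sub_apply, PiLp.smul_apply, smul_eq_mul,
          gradient_apply] at h
        rw [hs, hes]
        linarith

/-- A critical evolution solves the general system. -/
theorem IsCritical.generalSystem (hT : 0 < T) (hℓ : IsFunctionalDerivative B ℓ dℓ)
    (hne : ∀ t ∈ Icc 0 T, ∀ x ∈ B.pts, ∀ k, (dℓ (P.state t)).s k x ≠ 0)
    (hP : IsCritical bc ℓ dℓ F P) : GeneralSystem dℓ F P ∧ AuxiliaryConditions dℓ P :=
  (phenomenological_and_defectFree_iff hT hℓ).1 ⟨hP.phenomenological, hP.defectFree hT hℓ hne⟩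

/-- Under the no-slip condition the solutions of the general system are critical. -/
theorem GeneralSystem.isCritical (hT : 0 < T) (hℓ : IsFunctionalDerivative B ℓ dℓ)
    (hbc : P.SatisfiesBC .noSlip) (h : GeneralSystem dℓ F P) (hA : AuxiliaryConditions dℓ P) :
    IsCritical .noSlip ℓ dℓ F P :=
  have h' := (phenomenological_and_defectFree_iff hT hℓ).2 ⟨h, hA⟩
  ⟨h'.1, fun _ hV => h'.2.stationary hT hℓ hbc hV⟩

end General

/-! ### Derivatives of the internal energies -/

section Energy

variable (e : InternalEnergies)

/-- The states at which the energy of the solid is smooth. -/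
abbrev solidDomain : Set (ℝ × ℝ × Mat3) := {p | 0 < p.1 ∧ (Matrix.of p.2.2).PosDef}

/-- The partial derivatives of the energy of the fluid, in terms of its total derivative. -/
theorem InternalEnergies.hasDerivAt_f_partial {q : ℝ × ℝ}
    (hF : DifferentiableAt ℝ (fun p : ℝ × ℝ => e.f p.1 p.2) q) :
    HasDerivAt (fun r => e.f r q.2) (fderiv ℝ (fun p : ℝ × ℝ => e.f p.1 p.2) q (1, 0)) q.1 ∧
    HasDerivAt (fun h => e.f q.1 h) (fderiv ℝ (fun p : ℝ × ℝ => e.f p.1 p.2) q (0, 1)) q.2 :=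
  ⟨HasFDerivAt.comp_hasDerivAt (f := fun r : ℝ => (r, q.2)) q.1 hF.hasFDerivAt
    ((hasDerivAt_id _).prodMk (hasDerivAt_const _ _)),
  HasFDerivAt.comp_hasDerivAt (f := fun h : ℝ => (q.1, h)) q.2 hF.hasFDerivAt
    ((hasDerivAt_const _ _).prodMk (hasDerivAt_id _))⟩

/-- The partial derivatives of the energy of the solid, in terms of its total derivative. -/
theorem InternalEnergies.hasDerivAt_s_partial {q : ℝ × ℝ × Mat3}
    (hF : DifferentiableAt ℝ (fun p : ℝ × ℝ × Mat3 => e.s p.1 p.2.1 p.2.2) q) :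
    HasDerivAt (fun r => e.s r q.2.1 q.2.2)
      (fderiv ℝ (fun p : ℝ × ℝ × Mat3 => e.s p.1 p.2.1 p.2.2) q (1, 0, 0)) q.1 ∧
    HasDerivAt (fun h => e.s q.1 h q.2.2)
      (fderiv ℝ (fun p : ℝ × ℝ × Mat3 => e.s p.1 p.2.1 p.2.2) q (0, 1, 0)) q.2.1 ∧
    ∀ c, fderiv ℝ (fun b => e.s q.1 q.2.1 b) q.2.2 c
      = fderiv ℝ (fun p : ℝ × ℝ × Mat3 => e.s p.1 p.2.1 p.2.2) q (0, 0, c) := by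
  refine ⟨?_, ?_, fun c => ?_⟩
  · exact HasFDerivAt.comp_hasDerivAt (f := fun r : ℝ => (r, q.2)) q.1 hF.hasFDerivAt
      ((hasDerivAt_id _).prodMk (hasDerivAt_const _ _))
  · exact HasFDerivAt.comp_hasDerivAt (f := fun h : ℝ => (q.1, h, q.2.2)) q.2.1 hF.hasFDerivAt
      ((hasDerivAt_const _ _).prodMk ((hasDerivAt_id _).prodMk (hasDerivAt_const _ _)))
  · have h1 : HasFDerivAt (fun b : Mat3 => (q.1, q.2.1, b))
        ((0 : Mat3 →L[ℝ] ℝ).prod ((0 : Mat3 →L[ℝ] ℝ).prod (ContinuousLinearMap.id ℝ Mat3))) q.2.2 :=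
      (hasFDerivAt_const _ _).prodMk ((hasFDerivAt_const _ _).prodMk (hasFDerivAt_id _))
    have h2 := HasFDerivAt.comp (f := fun b : Mat3 => (q.1, q.2.1, b)) q.2.2 hF.hasFDerivAt h1
    have h3 : fderiv ℝ (fun b => e.s q.1 q.2.1 b) q.2.2 = _ := h2.fderiv
    rw [h3]
    simp

/-- The chain rule for the energy of the fluid. -/
theorem InternalEnergies.hasDerivAt_f {r h : ℝ → ℝ} {r' h' a : ℝ} (hr : HasDerivAt r r' a)
    (hh : HasDerivAt h h' a) (h0 : 0 < r a) :
    HasDerivAt (fun s => e.f (r s) (h s))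
      (deriv (fun q => e.f q (h a)) (r a) * r' + deriv (fun q => e.f (r a) q) (h a) * h') a := by
  have hF : DifferentiableAt ℝ (fun p : ℝ × ℝ => e.f p.1 p.2) (r a, h a) :=
    e.smooth_f.differentiableAt (show (0 : ℝ) < (r a, h a).1 from h0)
  obtain ⟨h1, h2⟩ := e.hasDerivAt_f_partial hF
  have h3 := HasFDerivAt.comp_hasDerivAt (f := fun s : ℝ => (r s, h s)) a hF.hasFDerivAt
    (hr.prodMk hh)
  refine h3.congr_deriv ?_
  rw [h1.deriv, h2.deriv]
  have : ((r', h') : ℝ × ℝ) = r' • (1, 0) + h' • (0, 1) := by simp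
  rw [this, map_add, map_smul, map_smul, smul_eq_mul, smul_eq_mul]
  ring

/-- The chain rule for the energy of the solid. -/
theorem InternalEnergies.hasDerivAt_s {r h : ℝ → ℝ} {b : ℝ → Mat3} {r' h' a : ℝ} {b' : Mat3}
    (hr : HasDerivAt r r' a) (hh : HasDerivAt h h' a) (hb : HasDerivAt b b' a) (h0 : 0 < r a)
    (hpd : (Matrix.of (b a)).PosDef) :
    HasDerivAt (fun s => e.s (r s) (h s) (b s))
      (deriv (fun q => e.s q (h a) (b a)) (r a) * r' + deriv (fun q => e.s (r a) q (b a)) (h a) * h'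
        + fderiv ℝ (fun c => e.s (r a) (h a) c) (b a) b') a := by
  have hF := e.smooth_s.differentiableAt (x := (r a, h a, b a)) ⟨h0, hpd⟩
  obtain ⟨h1, h2, h3⟩ := e.hasDerivAt_s_partial hF
  have h4 := HasFDerivAt.comp_hasDerivAt (f := fun s : ℝ => (r s, h s, b s)) a
    hF.hasFDerivAt (hr.prodMk (hh.prodMk hb))
  refine h4.congr_deriv ?_
  rw [h1.deriv, h2.deriv, h3]
  have : ((r', h', b') : ℝ × ℝ × Mat3) = r' • (1, 0, 0) + h' • (0, 1, 0) + (0, 0, b') := by simp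
  rw [this, map_add, map_add, map_smul, map_smul, smul_eq_mul, smul_eq_mul]
  ring

theorem InternalEnergies.smooth_f_r :
    SmoothNear (fun p : ℝ × ℝ => deriv (fun r => e.f r p.2) p.1) {p | 0 < p.1} := by
  refine (e.smooth_f.fderiv_apply (SmoothNear.const ((1, 0) : ℝ × ℝ))).congr fun p hp => ?_
  filter_upwards [smoothNear_iff.1 e.smooth_f p hp] with q hq
  exact (e.hasDerivAt_f_partial (hq.differentiableAt (by simp))).1.deriv.symm

theorem InternalEnergies.smooth_f_h :
    SmoothNear (fun p : ℝ × ℝ => deriv (fun h => e.f p.1 h) p.2) {p | 0 < p.1} := by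
  refine (e.smooth_f.fderiv_apply (SmoothNear.const ((0, 1) : ℝ × ℝ))).congr fun p hp => ?_
  filter_upwards [smoothNear_iff.1 e.smooth_f p hp] with q hq
  exact (e.hasDerivAt_f_partial (hq.differentiableAt (by simp))).2.deriv.symm

theorem InternalEnergies.smooth_s_r :
    SmoothNear (fun p : ℝ × ℝ × Mat3 => deriv (fun r => e.s r p.2.1 p.2.2) p.1) solidDomain := by
  refine (e.smooth_s.fderiv_apply (SmoothNear.const ((1, 0, 0) : ℝ × ℝ × Mat3))).congr
    fun p hp => ?_
  filter_upwards [smoothNear_iff.1 e.smooth_s p hp] with q hq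
  exact (e.hasDerivAt_s_partial (hq.differentiableAt (by simp))).1.deriv.symm

theorem InternalEnergies.smooth_s_h :
    SmoothNear (fun p : ℝ × ℝ × Mat3 => deriv (fun h => e.s p.1 h p.2.2) p.2.1) solidDomain := by
  refine (e.smooth_s.fderiv_apply (SmoothNear.const ((0, 1, 0) : ℝ × ℝ × Mat3))).congr
    fun p hp => ?_
  filter_upwards [smoothNear_iff.1 e.smooth_s p hp] with q hq
  exact (e.hasDerivAt_s_partial (hq.differentiableAt (by simp))).2.1.deriv.symm

theorem InternalEnergies.smooth_s_b (c : Mat3) :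
    SmoothNear (fun p : ℝ × ℝ × Mat3 => fderiv ℝ (fun b => e.s p.1 p.2.1 b) p.2.2 c)
      solidDomain := by
  refine (e.smooth_s.fderiv_apply (SmoothNear.const ((0, 0, c) : ℝ × ℝ × Mat3))).congr
    fun p hp => ?_
  filter_upwards [smoothNear_iff.1 e.smooth_s p hp] with q hq
  exact ((e.hasDerivAt_s_partial (hq.differentiableAt (by simp))).2.2 c).symm

theorem dedb_symm (X : State) (x : E3) (i j : Fin 3) : dedb e X x i j = dedb e X x j i := by
  simp only [dedb]
  congr 1
  ext k l
  rw [add_comm]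

/-- In symmetric directions the tensor `∂e_s/∂b` represents the derivative of `e_s`. -/
theorem fderiv_eq_ddot_dedb (X : State) (x : E3) {c : Mat3} (hc : ∀ i j, c i j = c j i) :
    fderiv ℝ (fun c : Mat3 => e.s (X.bars x) (X.spec .solid x) c) (X.b x) c
      = ddot (dedb e X x) c := by
  -- A symmetric tensor is a combination of the symmetrized unit tensors used to define `∂e_s/∂b`.
  have h : c = ∑ i, ∑ j, c i j • (fun k l => (1 / 2 : ℝ) *
      ((if k = i ∧ l = j then 1 else 0) + (if k = j ∧ l = i then 1 else 0)) : Mat3) := by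
    ext k l
    simp only [Finset.sum_apply, Fin.sum_univ_three]
    fin_cases k <;> fin_cases l <;> simp [hc 1 0, hc 2 0, hc 2 1] <;> ring
  conv_lhs => rw [h]
  simp only [map_sum, map_smul, ddot, dedb, smul_eq_mul]
  exact Finset.sum_congr rfl fun i _ => Finset.sum_congr rfl fun j _ => mul_comm _ _

end Energy

/-! ### The functional derivatives of the porous Lagrangian -/

/-- The integrand of the Lagrangian of the porous medium. -/
def porousDensity (e : InternalEnergies) (X : State) (x : E3) : ℝ :=
  (1 / 2 : ℝ) * X.ρ .fluid x * ‖X.u .fluid x‖ ^ 2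
    - X.ρ .fluid x * e.f (X.barf x) (X.spec .fluid x)
    + (1 / 2 : ℝ) * X.ρ .solid x * ‖X.u .solid x‖ ^ 2
    - X.ρ .solid x * e.s (X.bars x) (X.spec .solid x) (X.b x)

/-- The derivative of the Lagrangian density with respect to `ρ_k`. -/
def porousDerivDensity (e : InternalEnergies) (X : State) : Phase → E3 → ℝ
  | .fluid => fun x => (1 / 2 : ℝ) * inner ℝ (X.u .fluid x) (X.u .fluid x)
      - e.f (X.barf x) (X.spec .fluid x)
      - X.barf x * deriv (fun r => e.f r (X.spec .fluid x)) (X.barf x)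
      + X.spec .fluid x * temperature e X x .fluid
  | .solid => fun x => (1 / 2 : ℝ) * inner ℝ (X.u .solid x) (X.u .solid x)
      - e.s (X.bars x) (X.spec .solid x) (X.b x)
      - X.bars x * deriv (fun r => e.s r (X.spec .solid x) (X.b x)) (X.bars x)
      + X.spec .solid x * temperature e X x .solid

/-- The functional derivatives of the Lagrangian of the porous medium. -/
def porousDeriv (e : InternalEnergies) (X : State) : State where
  u k x := X.ρ k x • X.u k x
  ρ := porousDerivDensity e X
  s k x := - temperature e X x k
  b x := - (X.ρ .solid x • dedb e X x)
  φ x := pressureFluid e X x - pressureSolid e X x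

/-- A family of states and a family of points such that the fields of the states at the points
depend smoothly on the parameter and take admissible values. -/
structure AdmissibleFields {E : Type*} [NormedAddCommGroup E] [NormedSpace ℝ E] (Z : E → State)
    (x : E → E3) (A : Set E) : Prop where
  u : ∀ k, SmoothNear (fun p => (Z p).u k (x p)) A
  ρ : ∀ k, SmoothNear (fun p => (Z p).ρ k (x p)) A
  s : ∀ k, SmoothNear (fun p => (Z p).s k (x p)) A
  b : SmoothNear (fun p => (Z p).b (x p)) A
  φ : SmoothNear (fun p => (Z p).φ (x p)) A
  pos : ∀ p ∈ A, ∀ k, 0 < (Z p).ρ k (x p)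
  φ_pos : ∀ p ∈ A, 0 < (Z p).φ (x p)
  φ_lt : ∀ p ∈ A, (Z p).φ (x p) < 1
  posDef : ∀ p ∈ A, (Matrix.of ((Z p).b (x p))).PosDef

section Smooth

variable {E : Type*} [NormedAddCommGroup E] [NormedSpace ℝ E] {Z : E → State} {x : E → E3}
  {A : Set E} (e : InternalEnergies)

theorem AdmissibleFields.barf (h : AdmissibleFields Z x A) :
    SmoothNear (fun p => (Z p).barf (x p)) A :=
  (h.ρ .fluid).div h.φ fun p hp => (h.φ_pos p hp).ne'

theorem AdmissibleFields.bars (h : AdmissibleFields Z x A) :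
    SmoothNear (fun p => (Z p).bars (x p)) A :=
  (h.ρ .solid).div ((SmoothNear.const 1).sub h.φ) fun p hp => (sub_pos.2 (h.φ_lt p hp)).ne'

theorem AdmissibleFields.spec (h : AdmissibleFields Z x A) (k : Phase) :
    SmoothNear (fun p => (Z p).spec k (x p)) A :=
  (h.s k).div (h.ρ k) fun p hp => (h.pos p hp k).ne'

theorem AdmissibleFields.barf_pos (h : AdmissibleFields Z x A) {p : E} (hp : p ∈ A) :
    0 < (Z p).barf (x p) := div_pos (h.pos p hp _) (h.φ_pos p hp)

theorem AdmissibleFields.bars_pos (h : AdmissibleFields Z x A) {p : E} (hp : p ∈ A) :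
    0 < (Z p).bars (x p) := div_pos (h.pos p hp _) (sub_pos.2 (h.φ_lt p hp))

theorem AdmissibleFields.comp_f (h : AdmissibleFields Z x A) {G : ℝ × ℝ → ℝ}
    (hG : SmoothNear G {p | 0 < p.1}) :
    SmoothNear (fun p => G ((Z p).barf (x p), (Z p).spec .fluid (x p))) A :=
  hG.comp (h.barf.prodMk (h.spec .fluid)) fun _ hp => h.barf_pos hp

/-- At admissible states the arguments of the energy of the solid lie where it is smooth. -/
theorem AdmissibleFields.comp_s (h : AdmissibleFields Z x A) {G : ℝ × ℝ × Mat3 → ℝ}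
    (hG : SmoothNear G solidDomain) :
    SmoothNear (fun p => G ((Z p).bars (x p), (Z p).spec .solid (x p), (Z p).b (x p))) A :=
  hG.comp (h.bars.prodMk ((h.spec .solid).prodMk h.b)) fun _ hp => ⟨h.bars_pos hp, h.posDef _ hp⟩

theorem AdmissibleFields.temperature (h : AdmissibleFields Z x A) (k : Phase) :
    SmoothNear (fun p => temperature e (Z p) (x p) k) A := by
  cases k
  · exact h.comp_f e.smooth_f_h
  · exact h.comp_s e.smooth_s_h

theorem AdmissibleFields.pressureFluid (h : AdmissibleFields Z x A) :
    SmoothNear (fun p => pressureFluid e (Z p) (x p)) A := by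
  simp only [PorousMedia.pressureFluid, pow_two]
  exact (h.barf.mul h.barf).mul (h.comp_f e.smooth_f_r)

theorem AdmissibleFields.pressureSolid (h : AdmissibleFields Z x A) :
    SmoothNear (fun p => pressureSolid e (Z p) (x p)) A := by
  simp only [PorousMedia.pressureSolid, pow_two]
  exact (h.bars.mul h.bars).mul (h.comp_s e.smooth_s_r)

theorem AdmissibleFields.dedb (h : AdmissibleFields Z x A) :
    SmoothNear (fun p => dedb e (Z p) (x p)) A :=
  smoothNear_mat.2 fun _ _ => h.comp_s (e.smooth_s_b _)

theorem AdmissibleFields.porousDerivDensity (h : AdmissibleFields Z x A) (k : Phase) :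
    SmoothNear (fun p => porousDerivDensity e (Z p) k (x p)) A := by
  cases k
  · exact ((((SmoothNear.const _).mul ((h.u _).inner (h.u _))).sub (h.comp_f e.smooth_f)).sub
      (h.barf.mul (h.comp_f e.smooth_f_r))).add ((h.spec _).mul (h.temperature e _))
  · exact ((((SmoothNear.const _).mul ((h.u _).inner (h.u _))).sub (h.comp_s e.smooth_s)).sub
      (h.bars.mul (h.comp_s e.smooth_s_r))).add ((h.spec _).mul (h.temperature e _))

theorem AdmissibleFields.porousDensity (h : AdmissibleFields Z x A) :
    SmoothNear (fun p => porousDensity e (Z p) (x p)) A := by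
  simp only [PorousMedia.porousDensity, ← real_inner_self_eq_norm_sq]
  exact (((((SmoothNear.const _).mul (h.ρ _)).mul ((h.u _).inner (h.u _))).sub
    ((h.ρ _).mul (h.comp_f e.smooth_f))).add
    (((SmoothNear.const _).mul (h.ρ _)).mul ((h.u _).inner (h.u _)))).sub
    ((h.ρ _).mul (h.comp_s e.smooth_s))

theorem SmoothFamilyAt.admissibleFields {B : SmoothDomain} {Z : ℝ × ℝ → State} {q : ℝ × ℝ}
    (hZ : SmoothFamilyAt B Z q) (h : (Z q).Admissible B) :
    AdmissibleFields (fun p : (ℝ × ℝ) × E3 => Z p.1) (fun p => p.2) ({q} ×ˢ B.pts) := by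
  have h' : ∀ p ∈ ({q} : Set (ℝ × ℝ)) ×ˢ B.pts, Z p.1 = Z q ∧ p.2 ∈ B.pts := fun p hp =>
    ⟨congrArg Z hp.1, hp.2⟩
  refine ⟨hZ.u, hZ.ρ, hZ.s, hZ.b, hZ.φ, fun p hp k => ?_, fun p hp => ?_, fun p hp => ?_,
    fun p hp => ?_⟩ <;> rw [(h' p hp).1]
  exacts [(h _ hp.2).1 k, (h _ hp.2).2.1, (h _ hp.2).2.2.1, (h _ hp.2).2.2.2]

theorem Evolution.admissibleFields {T : ℝ} {R : Phase → SmoothDomain} {B : SmoothDomain}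
    (P : Evolution T R B) (hT : 0 < T) :
    AdmissibleFields (fun p : ℝ × E3 => P.state p.1) (fun p => p.2) (cyl T B) :=
  ⟨P.smooth_u, P.smooth_ρ hT, P.smooth_s, P.smooth_b, P.smooth_φ,
    fun _ hp => (P.admissible hT hp.1 _ hp.2).1, fun _ hp => (P.admissible hT hp.1 _ hp.2).2.1,
    fun _ hp => (P.admissible hT hp.1 _ hp.2).2.2.1,
    fun _ hp => (P.admissible hT hp.1 _ hp.2).2.2.2⟩

/-- The partial derivatives of the Lagrangian density. -/
theorem hasDerivAt_porousDensity {Z : ℝ → State} {x : E3} {a : ℝ}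
    (hu : ∀ k, DifferentiableAt ℝ (fun h => (Z h).u k x) a)
    (hρ : ∀ k, DifferentiableAt ℝ (fun h => (Z h).ρ k x) a)
    (hs : ∀ k, DifferentiableAt ℝ (fun h => (Z h).s k x) a)
    (hb : ∀ i j, DifferentiableAt ℝ (fun h => (Z h).b x i j) a)
    (hφ : DifferentiableAt ℝ (fun h => (Z h).φ x) a)
    (hsymm : ∀ᶠ h in 𝓝 a, ∀ i j, (Z h).b x i j = (Z h).b x j i)
    (h0 : (∀ k, 0 < (Z a).ρ k x) ∧ 0 < (Z a).φ x ∧ (Z a).φ x < 1 ∧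
      (Matrix.of ((Z a).b x)).PosDef) :
    HasDerivAt (fun h => porousDensity e (Z h) x)
      ((porousDeriv e (Z a)).pairingDensity (derivState Z a) x) a := by
  obtain ⟨hpos, hφ0, hφ1, hpd⟩ := h0
  have hφ1' : 0 < 1 - (Z a).φ x := sub_pos.2 hφ1
  have dρ := fun k => (hρ k).hasDerivAt
  have ds := fun k => (hs k).hasDerivAt
  have dφ := hφ.hasDerivAt
  have dspec : ∀ k, HasDerivAt (fun h => (Z h).spec k x) _ a := fun k =>
    (ds k).div (dρ k) (hpos k).ne'
  have dbarf : HasDerivAt (fun h => (Z h).barf x) _ a := (dρ .fluid).div dφ hφ0.ne'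
  have dbars : HasDerivAt (fun h => (Z h).bars x) _ a :=
    (dρ .solid).div (dφ.const_sub 1) hφ1'.ne'
  have db : HasDerivAt (fun h => (Z h).b x) (fun i j => deriv (fun h => (Z h).b x i j) a) a :=
    hasDerivAt_pi.2 fun i => hasDerivAt_pi.2 fun j => (hb i j).hasDerivAt
  have dK : ∀ k, HasDerivAt (fun h => (1 / 2 : ℝ) * (Z h).ρ k x * ‖(Z h).u k x‖ ^ 2) _ a :=
    fun k => ((dρ k).const_mul (1 / 2 : ℝ)).mul (hu k).hasDerivAt.norm_sq
  have dF := (dρ .fluid).mul (e.hasDerivAt_f dbarf (dspec .fluid) (div_pos (hpos _) hφ0))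
  have dS := (dρ .solid).mul (e.hasDerivAt_s dbars (dspec .solid) db (div_pos (hpos _) hφ1') hpd)
  have hsym : ∀ i j, deriv (fun h => (Z h).b x i j) a = deriv (fun h => (Z h).b x j i) a :=
    fun i j => Filter.EventuallyEq.deriv_eq (by filter_upwards [hsymm] with h hh using hh i j)
  rw [fderiv_eq_ddot_dedb e (Z a) x hsym] at dS
  have hneg : ∀ (c : ℝ) (C D : Mat3), ddot (-(c • C)) D = - (c * ddot C D) := fun c C D => by
    simp [ddot, Finset.mul_sum, mul_assoc]
  refine ((((dK .fluid).sub dF).add (dK .solid)).sub dS).congr_deriv ?_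
  simp only [State.pairingDensity, porousDeriv, derivState, hneg, porousDerivDensity, temperature,
    pressureFluid, pressureSolid, real_inner_smul_left, real_inner_self_eq_norm_sq]
  -- What remains is an identity of rational functions in the values of the fields and derivatives.
  generalize ddot (dedb e (Z a) x) _ = X1
  generalize (inner ℝ ((Z a).u .fluid x) (deriv (fun h => (Z h).u .fluid x) a) : ℝ) = X2
  generalize (inner ℝ ((Z a).u .solid x) (deriv (fun h => (Z h).u .solid x) a) : ℝ) = X3
  generalize deriv (fun r => e.f r ((Z a).spec .fluid x)) ((Z a).barf x) = y1
  generalize deriv (fun r => e.f ((Z a).barf x) r) ((Z a).spec .fluid x) = y2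
  generalize deriv (fun r => e.s r ((Z a).spec .solid x) ((Z a).b x)) ((Z a).bars x) = y3
  generalize deriv (fun r => e.s ((Z a).bars x) r ((Z a).b x)) ((Z a).spec .solid x) = y4
  generalize e.f ((Z a).barf x) ((Z a).spec .fluid x) = y5
  generalize e.s ((Z a).bars x) ((Z a).spec .solid x) ((Z a).b x) = y6
  have n1 := (hpos .fluid).ne'
  have n2 := (hpos .solid).ne'
  have n3 := hφ0.ne'
  have n4 := hφ1'.ne'
  simp only [State.spec, State.barf, State.bars]
  field_simp
  ring

end Smooth

open MeasureTheory

section FunctionalDerivative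

variable {B : SmoothDomain} (e : InternalEnergies)

/-- The derivative of a smooth two-parameter family with respect to the second parameter. -/
theorem SmoothFamilyAt.derivState {Z : ℝ × ℝ → State} {q : ℝ × ℝ} (hZ : SmoothFamilyAt B Z q) :
    SmoothFamilyAt B (fun q => derivState (fun h => Z (q.1, h)) q.2) q := by
  have key : ∀ {V : Type} [NormedAddCommGroup V] [NormedSpace ℝ V] {f : (ℝ × ℝ) × E3 → V},
      SmoothNear f ({q} ×ˢ B.pts) →
        SmoothNear (fun p : (ℝ × ℝ) × E3 => deriv (fun h => f ((p.1.1, h), p.2)) p.1.2)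
          ({q} ×ˢ B.pts) := by
    intro V _ _ f hf
    refine (hf.fderiv_apply (SmoothNear.const (((0, 1), 0) : (ℝ × ℝ) × E3))).congr fun p hp => ?_
    filter_upwards [smoothNear_iff.1 hf p hp] with r hr
    exact (HasFDerivAt.comp_hasDerivAt (f := fun h : ℝ => (((r.1.1, h), r.2) : (ℝ × ℝ) × E3)) r.1.2
      (hr.differentiableAt (by simp)).hasFDerivAt
      (((hasDerivAt_const _ _).prodMk (hasDerivAt_id _)).prodMk
        (hasDerivAt_const _ _))).deriv.symm
  exact ⟨fun k => key (hZ.u k), fun k => key (hZ.ρ k), fun k => key (hZ.s k),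
    smoothNear_mat.2 fun i j => key (smoothNear_mat.1 hZ.b i j), key hZ.φ⟩

theorem SmoothFamilyAt.porousDeriv {Z : ℝ × ℝ → State} {q : ℝ × ℝ} (hZ : SmoothFamilyAt B Z q)
    (h : (Z q).Admissible B) : SmoothFamilyAt B (fun q => porousDeriv e (Z q)) q := by
  have hA := hZ.admissibleFields h
  exact ⟨fun k => (hA.ρ k).smul (hA.u k), hA.porousDerivDensity e,
    fun k => (hA.temperature e k).neg, ((hA.ρ _).smul (hA.dedb e)).neg,
    (hA.pressureFluid e).sub (hA.pressureSolid e)⟩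

/-- Differentiability in the second parameter, uniformly over a compact set of positions. -/
theorem SmoothNear.eventually_differentiableAt {V : Type*} [NormedAddCommGroup V]
    [NormedSpace ℝ V] {f : (ℝ × ℝ) × E3 → V} {q : ℝ × ℝ} {K : Set E3}
    (hf : SmoothNear f ({q} ×ˢ K)) (hK : IsCompact K) :
    ∀ᶠ q' in 𝓝 q, ∀ x ∈ K, DifferentiableAt ℝ (fun h => f ((q'.1, h), x)) q'.2 := by
  have := hK.eventually_forall_of_forall_eventually (x₀ := q)
    (P := fun q x => ContDiffAt ℝ ∞ f (q, x)) fun x hx =>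
      smoothNear_iff.1 hf (q, x) (mk_mem_prod rfl hx)
  filter_upwards [this] with q' hq' x hx
  exact ((hq' x hx).differentiableAt (by simp)).comp q'.2
    (f := fun h : ℝ => (((q'.1, h), x) : (ℝ × ℝ) × E3)) (by fun_prop)

/-- A positive definite tensor is symmetric. -/
theorem posDef_symm {M : Mat3} (h : (Matrix.of M).PosDef) (i j : Fin 3) : M i j = M j i := by
  simpa using (h.isHermitian.apply i j).symm

/-- The Lagrangian of the porous medium has functional derivatives. -/
theorem isFunctionalDerivative_porousDeriv :
    IsFunctionalDerivative B (porousLagrangian B e) (porousDeriv e) := by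
  intro Z t ε hZ hadm
  have hA := hZ.admissibleFields hadm.self_of_nhds
  have hD := hZ.porousDeriv e hadm.self_of_nhds
  refine ⟨?_, hD, fun x _ i j => by simp only [porousDeriv, Pi.neg_apply, Pi.smul_apply,
    dedb_symm e (Z (t, ε)) x i j]⟩
  have hline : Filter.Tendsto (fun h : ℝ => (t, h)) (𝓝 ε) (𝓝 (t, ε)) :=
    Continuous.tendsto (by fun_prop) ε
  have hcd := (hD.pairingDensity hZ.derivState)
  have hpair : ∀ x ∈ B.pts, ContinuousAt (fun p : ℝ × E3 => (porousDeriv e (Z (t, p.1))).pairingDensity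
      (derivState (fun h => Z (t, h)) p.1) p.2) (ε, x) := fun x hx =>
    ContinuousAt.comp (f := fun p : ℝ × E3 => (((t, p.1), p.2) : (ℝ × ℝ) × E3)) (x := (ε, x))
      (hcd.continuousAt (mk_mem_prod rfl hx)) (by fun_prop)
  refine hasDerivAt_setIntegral_of_compact (μ := volume) (K := B.pts) B.isCompact_pts
    B.measurableSet_pts (G := fun h x => porousDensity e (Z (t, h)) x)
    (g := fun h x => (porousDeriv e (Z (t, h))).pairingDensity (derivState (fun h => Z (t, h)) h) x)
    ?_ ?_ hpair fun x hx => (ContinuousAt.comp (f := fun x : E3 => (ε, x)) (hpair x hx)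
      (by fun_prop)).continuousWithinAt
  · exact hline.eventually ((hA.porousDensity e).eventually_continuousOn B.isCompact_pts)
  · have hu := fun k => (hZ.u k).eventually_differentiableAt B.isCompact_pts
    have hρ := fun k => (hZ.ρ k).eventually_differentiableAt B.isCompact_pts
    have hs := fun k => (hZ.s k).eventually_differentiableAt B.isCompact_pts
    have hb := fun i j => (smoothNear_mat.1 hZ.b i j).eventually_differentiableAt B.isCompact_pts
    have hφ := hZ.φ.eventually_differentiableAt B.isCompact_pts
    have hb' := Filter.eventually_all.2 fun i => Filter.eventually_all.2 (hb i)
    have hall := (((((((hu .fluid).and (hu .solid)).and (hρ .fluid)).and (hρ .solid)).and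
      (hs .fluid)).and (hs .solid)).and (hφ.and hb')).and hadm.eventually_nhds
    filter_upwards [hline.eventually hall] with h hh x hx
    obtain ⟨⟨⟨⟨⟨⟨⟨h1, h2⟩, h3⟩, h4⟩, h5⟩, h6⟩, h7, h8⟩, h9⟩ := hh
    have hlh : Filter.Tendsto (fun h : ℝ => (t, h)) (𝓝 h) (𝓝 (t, h)) :=
      Continuous.tendsto (by fun_prop) h
    refine hasDerivAt_porousDensity e (fun k => ?_) (fun k => ?_) (fun k => ?_)
      (fun i j => h8 i j x hx) (h7 x hx) ?_ (h9.self_of_nhds x hx)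
    · cases k; exacts [h1 x hx, h2 x hx]
    · cases k; exacts [h3 x hx, h4 x hx]
    · cases k; exacts [h5 x hx, h6 x hx]
    · filter_upwards [hlh.eventually h9] with h' hh' i j
      exact posDef_symm (hh' x hx).2.2.2 i j

end FunctionalDerivative

/-! ### Uniqueness of functional derivatives -/

section Unique

variable {T : ℝ} {R : Phase → SmoothDomain} {B : SmoothDomain} {ℓ : State → ℝ}
  {dℓ dℓ' : State → State}

/-- The difference of two states. -/
def State.diff (X Y : State) : State where
  u k x := X.u k x - Y.u k x
  ρ k x := X.ρ k x - Y.ρ k x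
  s k x := X.s k x - Y.s k x
  b x := X.b x - Y.b x
  φ x := X.φ x - Y.φ x

/-- Two states have the same values on the domain. -/
structure State.EqOn (B : SmoothDomain) (X Y : State) : Prop where
  u : ∀ x ∈ B.pts, ∀ k, X.u k x = Y.u k x
  ρ : ∀ x ∈ B.pts, ∀ k, X.ρ k x = Y.ρ k x
  s : ∀ x ∈ B.pts, ∀ k, X.s k x = Y.s k x
  b : ∀ x ∈ B.pts, X.b x = Y.b x
  φ : ∀ x ∈ B.pts, X.φ x = Y.φ x

theorem State.pairingDensity_diff (X Y W : State) (x : E3) :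
    (X.diff Y).pairingDensity W x = X.pairingDensity W x - Y.pairingDensity W x := by
  simp only [State.pairingDensity, State.diff, inner_sub_left, ddot, Pi.sub_apply, sub_mul,
    Finset.sum_sub_distrib]
  ring

theorem State.pairingDensity_self_nonneg (X : State) (x : E3) : 0 ≤ X.pairingDensity X x := by
  have h1 : 0 ≤ ddot (X.b x) (X.b x) :=
    Finset.sum_nonneg fun i _ => Finset.sum_nonneg fun j _ => mul_self_nonneg _
  have h2 := fun k => real_inner_self_nonneg (x := X.u k x)
  have h3 := fun k => mul_self_nonneg (X.ρ k x)
  have h4 := fun k => mul_self_nonneg (X.s k x)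
  have h5 := mul_self_nonneg (X.φ x)
  unfold State.pairingDensity
  linarith [h2 .fluid, h2 .solid, h3 .fluid, h3 .solid, h4 .fluid, h4 .solid]

theorem State.eq_zero_of_pairingDensity_self {X : State} {x : E3}
    (h : X.pairingDensity X x = 0) :
    (∀ k, X.u k x = 0) ∧ (∀ k, X.ρ k x = 0) ∧ (∀ k, X.s k x = 0) ∧ X.b x = 0 ∧ X.φ x = 0 := by
  have h0 : ∀ i, 0 ≤ ∑ j, X.b x i j * X.b x i j := fun i =>
    Finset.sum_nonneg fun j _ => mul_self_nonneg _
  have h1 : 0 ≤ ddot (X.b x) (X.b x) := Finset.sum_nonneg fun i _ => h0 i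
  have h2 := fun k => real_inner_self_nonneg (x := X.u k x)
  have h3 := fun k => mul_self_nonneg (X.ρ k x)
  have h4 := fun k => mul_self_nonneg (X.s k x)
  have h5 := mul_self_nonneg (X.φ x)
  unfold State.pairingDensity at h
  have f2 := h2 .fluid; have s2 := h2 .solid
  have f3 := h3 .fluid; have s3 := h3 .solid
  have f4 := h4 .fluid; have s4 := h4 .solid
  have hb : ddot (X.b x) (X.b x) = 0 := by linarith
  refine ⟨fun k => inner_self_eq_zero (𝕜 := ℝ).1 (by cases k <;> linarith),
    fun k => mul_self_eq_zero.1 (by cases k <;> linarith),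
    fun k => mul_self_eq_zero.1 (by cases k <;> linarith), ?_,
    mul_self_eq_zero.1 (by linarith)⟩
  ext i j
  have hi := (Finset.sum_eq_zero_iff_of_nonneg fun i _ => h0 i).1 hb i (Finset.mem_univ i)
  exact mul_self_eq_zero.1 ((Finset.sum_eq_zero_iff_of_nonneg fun j _ => mul_self_nonneg _).1 hi j
    (Finset.mem_univ j))

/-- Functional derivatives are unique on the domain: their difference, used as a direction of
perturbation, has vanishing `L²` norm. -/
theorem IsFunctionalDerivative.eqOn (hT : 0 < T) (P : Evolution T R B)
    (h : IsFunctionalDerivative B ℓ dℓ) (h' : IsFunctionalDerivative B ℓ dℓ') {t : ℝ}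
    (ht : t ∈ Icc 0 T) : State.EqOn B (dℓ (P.state t)) (dℓ' (P.state t)) := by
  have hc : ∀ {X : ℝ → State}, SmoothStates T B X → SmoothStates T B (fun _ => X t) := fun hX =>
    ⟨fun k => .of_space ((hX.u k).slice ht), fun k => .of_space ((hX.ρ k).slice ht),
      fun k => .of_space ((hX.s k).slice ht), .of_space (hX.b.slice ht),
      .of_space (hX.φ.slice ht)⟩
  have hX := hc (P.smoothStates hT)
  have hd := hc (P.smooth_dℓ hT h)
  have hd' := hc (P.smooth_dℓ hT h')
  let Y : State := (dℓ (P.state t)).diff (dℓ' (P.state t))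
  have hY : SmoothStates T B (fun _ => Y) :=
    ⟨fun k => (hd.u k).sub (hd'.u k), fun k => (hd.ρ k).sub (hd'.ρ k),
      fun k => (hd.s k).sub (hd'.s k), hd.b.sub hd'.b, hd.φ.sub hd'.φ⟩
  have hYs : ∀ x ∈ B.pts, ∀ i j, Y.b x i j = Y.b x j i := fun x hx i j => by
    simp only [Y, State.diff, Pi.sub_apply, P.dℓ_b_symm hT h ht hx i j,
      P.dℓ_b_symm hT h' ht hx i j]
  have hp0 : (P.state t).perturb Y 0 = P.state t := by simp [State.perturb]
  have hZ := hX.perturb_comp hY contDiff_fst contDiff_snd (q := (t, (0 : ℝ))) ht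
  have hadm := hZ.eventually_admissible (fun q x hx i j => by
    simp only [State.perturb, hYs x hx i j]
    rw [show (P.state t).b x i j = (P.state t).b x j i from P.b_symm t x i j])
    (by simpa only [hp0] using P.admissible hT ht)
  have e1 := (h _ t 0 hZ hadm).1.unique (h' _ t 0 hZ hadm).1
  simp only [derivState_perturb, hp0] at e1
  have hs : ∀ {X : State}, SmoothStates T B (fun _ => X) →
      SmoothNear (X.pairingDensity Y) B.pts := fun hX =>
    (hX.pairingDensity hY).slice ht
  have hint : ∀ {X : State}, SmoothStates T B (fun _ => X) →
      IntegrableOn (X.pairingDensity Y) B.pts := fun hX =>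
    (hs hX).continuousOn.integrableOn_compact B.isCompact_pts
  have hzero : ∫ x in B.pts, Y.pairingDensity Y x = 0 := by
    have : ∀ x, Y.pairingDensity Y x = (dℓ (P.state t)).pairingDensity Y x
        - (dℓ' (P.state t)).pairingDensity Y x := fun x => State.pairingDensity_diff _ _ _ _
    simp only [this]
    rw [integral_sub (hint hd) (hint hd')]
    exact sub_eq_zero.2 e1
  have hpt := B.eq_zero_of_integral_eq_zero (hs hY)
    (fun x _ => State.pairingDensity_self_nonneg Y x) hzero
  have hcomp := fun x hx => State.eq_zero_of_pairingDensity_self (hpt x hx)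
  exact ⟨fun x hx k => sub_eq_zero.1 ((hcomp x hx).1 k),
    fun x hx k => sub_eq_zero.1 ((hcomp x hx).2.1 k),
    fun x hx k => sub_eq_zero.1 ((hcomp x hx).2.2.1 k),
    fun x hx => sub_eq_zero.1 (hcomp x hx).2.2.2.1,
    fun x hx => sub_eq_zero.1 (hcomp x hx).2.2.2.2⟩

theorem SmoothField.dvgT_eq (hT : 0 < T) {f g : ℝ → E3 → Mat3} (hf : SmoothField T B.pts f)
    (hg : SmoothField T B.pts g) (h : ∀ t ∈ Icc 0 T, ∀ x ∈ B.pts, f t x = g t x) {t : ℝ}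
    (ht : t ∈ Icc 0 T) {x : E3} (hx : x ∈ B.pts) : dvgT (f t) x = dvgT (g t) x := by
  have := fun i j => (hf.apply₂ i j).pd_eq hT (hg.apply₂ i j)
    (fun t ht x hx => by rw [h t ht x hx]) ht hx j
  simp only [dvgT, this]

/-- The general system depends only on the values of the functional derivatives on the domain. -/
theorem GeneralSystem.congr (hT : 0 < T) {F : Friction T B} {P : Evolution T R B}
    (hd : SmoothStates T B (fun t => dℓ (P.state t)))
    (hd' : SmoothStates T B (fun t => dℓ' (P.state t)))
    (h : ∀ t ∈ Icc 0 T, State.EqOn B (dℓ (P.state t)) (dℓ' (P.state t)))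
    (hS : GeneralSystem dℓ F P) : GeneralSystem dℓ' F P := by
  have hdt : ∀ k, ∀ t ∈ Icc 0 T, ∀ x ∈ B.pts, deriv (fun τ => (dℓ (P.state τ)).u k x) t
      = deriv (fun τ => (dℓ' (P.state τ)).u k x) t := fun k t ht x hx =>
    (hd.u k).deriv_eq hT (hd'.u k) (fun t ht x hx => (h t ht).u x hx k) ht hx
  have hlie : ∀ k, ∀ t ∈ Icc 0 T, ∀ x ∈ B.pts, lieMomentum (P.u k t) ((dℓ (P.state t)).u k) x
      = lieMomentum (P.u k t) ((dℓ' (P.state t)).u k) x := fun k t ht x hx => by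
    have := fun i j => ((hd.u k).apply i).pd_eq hT ((hd'.u k).apply i)
      (fun t ht x hx => by rw [(h t ht).u x hx k]) ht hx j
    simp only [lieMomentum, this, (h t ht).u x hx k]
  have hgρ : ∀ k, ∀ t ∈ Icc 0 T, ∀ x ∈ B.pts, gradient ((dℓ (P.state t)).ρ k) x
      = gradient ((dℓ' (P.state t)).ρ k) x := fun k t ht x hx => by
    simp only [gradient, (hd.ρ k).fderiv_eq hT (hd'.ρ k)
      (fun t ht x hx => (h t ht).ρ x hx k) ht hx]
  have hgs : ∀ k, ∀ t ∈ Icc 0 T, ∀ x ∈ B.pts, gradient ((dℓ (P.state t)).s k) x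
      = gradient ((dℓ' (P.state t)).s k) x := fun k t ht x hx => by
    simp only [gradient, (hd.s k).fderiv_eq hT (hd'.s k)
      (fun t ht x hx => (h t ht).s x hx k) ht hx]
  have hdiv : ∀ t ∈ Icc 0 T, ∀ x ∈ B.pts,
      dvgT (fun y => F.stress .solid t y - (2 : ℝ) • mulT ((dℓ (P.state t)).b y) (P.b t y)) x
      = dvgT (fun y => F.stress .solid t y - (2 : ℝ) • mulT ((dℓ' (P.state t)).b y) (P.b t y)) x :=
    fun t ht x hx => by
      have hs : ∀ {d : State → State}, SmoothStates T B (fun t => d (P.state t)) →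
          SmoothField T B.pts (fun t y => F.stress .solid t y
            - (2 : ℝ) • mulT ((d (P.state t)).b y) (P.b t y)) := fun hd =>
        (F.smooth_stress .solid).sub
          ((SmoothField.const (2 : ℝ)).smul (hd.b.mulT P.smooth_b))
      exact (hs hd).dvgT_eq hT (hs hd') (fun t ht x hx => by rw [(h t ht).b x hx]) ht hx
  have hcg : ∀ t ∈ Icc 0 T, ∀ x ∈ B.pts, contractGrad (dℓ (P.state t)).b (P.b t) x
      = contractGrad (dℓ' (P.state t)).b (P.b t) x := fun t ht x hx => by
    simp only [contractGrad, (h t ht).b x hx]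
  refine ⟨fun t ht x hx => ?_, fun t ht x hx => ?_, hS.continuity, fun t ht x hx => ?_,
    fun t ht x hx => ?_, fun t ht x hx => ?_⟩
  · rw [← hdt _ t ht x hx, ← hlie _ t ht x hx, ← hgρ _ t ht x hx, ← hgs _ t ht x hx]
    exact hS.momentum_fluid t ht x hx
  · rw [← hdt _ t ht x hx, ← hlie _ t ht x hx, ← hgρ _ t ht x hx, ← hgs _ t ht x hx,
      ← hdiv t ht x hx, ← hcg t ht x hx]
    exact hS.momentum_solid t ht x hx
  · rw [← (h t ht).s x hx, ← (h t ht).s x hx]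
    exact hS.entropy_fluid t ht x hx
  · rw [← (h t ht).s x hx, ← (h t ht).s x hx]
    exact hS.entropy_solid t ht x hx
  · rw [← (h t ht).φ x hx]
    exact hS.volume_fraction t ht x hx

end Unique

/-! ### The system for the porous medium -/

section Porous

variable {T : ℝ} {R : Phase → SmoothDomain} {B : SmoothDomain} {F : Friction T B}
  {P : Evolution T R B} (e : InternalEnergies)

/-- The Gibbs relation: with `p = r² ∂e/∂r`, temperature `∂e/∂h` and `w = |u|²`, the gradient of
`w / 2 - e - r ∂e/∂r + h ∂e/∂h` combines with that of the temperature into a pressure gradient; `c`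
collects the dependence of `e` on further variables. -/
theorem gibbs_identity {w en r h er eh : E3 → ℝ} {x : E3} {i : Fin 3} {c φ ρ s : ℝ}
    (hw : DifferentiableAt ℝ w x) (hen : DifferentiableAt ℝ en x) (hr : DifferentiableAt ℝ r x)
    (hh : DifferentiableAt ℝ h x) (her : DifferentiableAt ℝ er x) (heh : DifferentiableAt ℝ eh x)
    (hchain : pd i en x = er x * pd i r x + eh x * pd i h x + c)
    (hρ : ρ = r x * φ) (hs : s = h x * ρ) :
    ρ * pd i (fun y => (1 / 2 : ℝ) * w y - en y - r y * er y + h y * eh y) x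
        + s * pd i (fun y => - eh y) x
      = ρ * ((1 / 2 : ℝ) * pd i w x) - φ * pd i (fun y => r y ^ 2 * er y) x - ρ * c := by
  have h1 : pd i (fun y => (1 / 2 : ℝ) * w y - en y - r y * er y + h y * eh y) x
      = (1 / 2 : ℝ) * pd i w x - pd i en x - (pd i r x * er x + r x * pd i er x)
        + (pd i h x * eh x + h x * pd i eh x) := by
    rw [pd_add (((hw.const_mul _).fun_sub hen).fun_sub (hr.fun_mul her)) (hh.fun_mul heh),
      pd_sub ((hw.const_mul _).fun_sub hen) (hr.fun_mul her), pd_sub (hw.const_mul _) hen,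
      pd_const_mul _ hw, pd_mul hr her, pd_mul hh heh]
  have h2 : pd i (fun y => r y ^ 2 * er y) x
      = (pd i r x * r x + r x * pd i r x) * er x + r x * r x * pd i er x := by
    simp only [pow_two]
    rw [pd_mul (hr.fun_mul hr) her, pd_mul hr hr]
  rw [h1, h2, pd_neg, hchain, hs, hρ]
  ring

/-- The Lie derivative of the momentum `ρ u` along `u` itself. -/
theorem lieMomentum_smul {ρ : E3 → ℝ} {u : E3 → E3} {x : E3} (hρ : DifferentiableAt ℝ ρ x)
    (hu : DifferentiableAt ℝ u x) (i : Fin 3) :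
    lieMomentum u (fun y => ρ y • u y) x i
      = dvg (fun y => ρ y • u y) x * u x i + ρ x * fderiv ℝ u x (u x) i
        + ρ x * ((1 / 2 : ℝ) * pd i (fun y => inner ℝ (u y) (u y)) x) := by
  have hui := fun j => differentiableAt_euclidean.1 hu j
  have h1 : ∀ j k, pd j (fun y => ρ y * u y k) x = _ := fun j k => pd_mul hρ (hui k)
  have h2 : pd i (fun y => (inner ℝ (u y) (u y) : ℝ)) x = ∑ j, (pd i (fun y => u y j) x * u x j
      + u x j * pd i (fun y => u y j) x) := by
    simp only [inner_eq_sum]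
    rw [pd_sum fun j => (hui j).fun_mul (hui j)]
    exact Finset.sum_congr rfl fun j _ => pd_mul (hui j) (hui j)
  rw [h2, fderiv_comp_eq_sum_pd hu]
  simp only [lieMomentum, dvg, PiLp.smul_apply, smul_eq_mul, h1, Fin.sum_univ_three]
  ring

/-- For the momentum `ρ u`, conservation of mass turns the left side of the momentum equation into
`ρ (∂_t u + u · ∇ u) + ρ ∇ (|u|² / 2)`. -/
theorem kinetic_identity (hT : 0 < T) (P : Evolution T R B) (k : Phase) {t : ℝ}
    (ht : t ∈ Icc 0 T) {x : E3} (hx : x ∈ B.pts) (i : Fin 3) :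
    deriv (fun τ => (porousDeriv e (P.state τ)).u k x) t i
        + lieMomentum (P.u k t) ((porousDeriv e (P.state t)).u k) x i
      = P.ρ k t x * (deriv (fun τ => P.u k τ x) t + fderiv ℝ (P.u k t) x (P.u k t x)) i
        + P.ρ k t x * ((1 / 2 : ℝ) * pd i (fun y => inner ℝ (P.u k t y) (P.u k t y)) x) := by
  have hρ := P.smooth_ρ hT k
  have hu := P.smooth_u k
  have hmass := (P.continuityEquations hT).mass t ht x hx k
  have hd : deriv (fun τ => (porousDeriv e (P.state τ)).u k x) t = _ :=
    ((hρ.differentiableAt_time ht hx).hasDerivAt.smul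
      (hu.differentiableAt_time ht hx).hasDerivAt).deriv
  have hl := lieMomentum_smul (hρ.differentiableAt_space ht hx) (hu.differentiableAt_space ht hx) i
  have hl' : lieMomentum (P.u k t) ((porousDeriv e (P.state t)).u k) x i = _ := hl
  rw [hd, hl']
  simp only [PiLp.add_apply, PiLp.smul_apply, smul_eq_mul]
  linear_combination (P.u k t x i) * hmass

/-- The thermodynamic forces on the fluid. -/
theorem thermo_fluid (hT : 0 < T) (P : Evolution T R B) {t : ℝ} (ht : t ∈ Icc 0 T) {x : E3}
    (hx : x ∈ B.pts) (i : Fin 3) :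
    P.ρ .fluid t x * pd i ((porousDeriv e (P.state t)).ρ .fluid) x
        + P.s .fluid t x * pd i ((porousDeriv e (P.state t)).s .fluid) x
      = P.ρ .fluid t x * ((1 / 2 : ℝ) * pd i (fun y => inner ℝ (P.u .fluid t y) (P.u .fluid t y)) x)
        - P.φ t x * pd i (pressureFluid e (P.state t)) x := by
  have hA := P.admissibleFields hT
  have hmem : (t, x) ∈ cyl T B := mk_mem_prod ht hx
  have hr : SmoothField T B.pts (fun t => (P.state t).barf) := hA.barf
  have hh : SmoothField T B.pts (fun t => (P.state t).spec .fluid) := hA.spec .fluid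
  have hen : SmoothField T B.pts
      (fun t x => e.f ((P.state t).barf x) ((P.state t).spec .fluid x)) := hA.comp_f e.smooth_f
  have her : SmoothField T B.pts (fun t x => deriv (fun r => e.f r ((P.state t).spec .fluid x))
    ((P.state t).barf x)) := hA.comp_f e.smooth_f_r
  have heh : SmoothField T B.pts (fun t x => temperature e (P.state t) x .fluid) :=
    hA.temperature e .fluid
  have hchain := (hen.hasDerivAt_pd ht hx i).unique
    (e.hasDerivAt_f (hr.hasDerivAt_pd ht hx i) (hh.hasDerivAt_pd ht hx i)
      (by simpa using hA.barf_pos hmem))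
  simp only [zero_smul, add_zero] at hchain
  have key := gibbs_identity (i := i) (c := 0) (φ := P.φ t x) (ρ := P.ρ .fluid t x)
    (s := P.s .fluid t x)
    (((P.smooth_u .fluid).inner (P.smooth_u .fluid)).differentiableAt_space ht hx)
    (hen.differentiableAt_space ht hx) (hr.differentiableAt_space ht hx)
    (hh.differentiableAt_space ht hx) (her.differentiableAt_space ht hx)
    (heh.differentiableAt_space ht hx) (by rw [add_zero]; exact hchain)
    (div_mul_cancel₀ _ (P.φ_mem t ht x hx).1.ne').symm
    (div_mul_cancel₀ _ (hA.pos _ hmem .fluid).ne').symm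
  rw [mul_zero, sub_zero] at key
  exact key

/-- The thermodynamic and elastic forces on the solid. -/
theorem thermo_solid (hT : 0 < T) (P : Evolution T R B) {t : ℝ} (ht : t ∈ Icc 0 T) {x : E3}
    (hx : x ∈ B.pts) (i : Fin 3) :
    P.ρ .solid t x * pd i ((porousDeriv e (P.state t)).ρ .solid) x
        + P.s .solid t x * pd i ((porousDeriv e (P.state t)).s .solid) x
        - contractGrad (porousDeriv e (P.state t)).b (P.b t) x i
      = P.ρ .solid t x * ((1 / 2 : ℝ) * pd i (fun y => inner ℝ (P.u .solid t y) (P.u .solid t y)) x)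
        - (1 - P.φ t x) * pd i (pressureSolid e (P.state t)) x := by
  have hA := P.admissibleFields hT
  have hmem : (t, x) ∈ cyl T B := mk_mem_prod ht hx
  have hr : SmoothField T B.pts (fun t => (P.state t).bars) := hA.bars
  have hh : SmoothField T B.pts (fun t => (P.state t).spec .solid) := hA.spec .solid
  have hen : SmoothField T B.pts (fun t x => e.s ((P.state t).bars x) ((P.state t).spec .solid x)
    ((P.state t).b x)) := hA.comp_s e.smooth_s
  have her : SmoothField T B.pts (fun t x => deriv (fun r => e.s r ((P.state t).spec .solid x)
    ((P.state t).b x)) ((P.state t).bars x)) := hA.comp_s e.smooth_s_r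
  have heh : SmoothField T B.pts (fun t x => temperature e (P.state t) x .solid) :=
    hA.temperature e .solid
  have hb : HasDerivAt (fun h : ℝ => P.b t (x + h • EuclideanSpace.single i (1 : ℝ)))
      (fun j k => pd i (fun y => P.b t y j k) x) 0 :=
    hasDerivAt_pi.2 fun j => hasDerivAt_pi.2 fun k => (P.smooth_b.apply₂ j k).hasDerivAt_pd ht hx i
  have hchain := (hen.hasDerivAt_pd ht hx i).unique
    (e.hasDerivAt_s (hr.hasDerivAt_pd ht hx i) (hh.hasDerivAt_pd ht hx i) hb
      (by simpa using hA.bars_pos hmem) (by simpa using hA.posDef _ hmem))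
  simp only [zero_smul, add_zero] at hchain
  have hbs : ∀ j k, pd i (fun y => P.b t y j k) x = pd i (fun y => P.b t y k j) x := fun j k => by
    simp only [P.b_symm t _ j k]
  have hdedb := fderiv_eq_ddot_dedb e (P.state t) x hbs
  rw [hdedb] at hchain
  have key := gibbs_identity (i := i) (φ := 1 - P.φ t x) (ρ := P.ρ .solid t x)
    (s := P.s .solid t x)
    (((P.smooth_u .solid).inner (P.smooth_u .solid)).differentiableAt_space ht hx)
    (hen.differentiableAt_space ht hx) (hr.differentiableAt_space ht hx)
    (hh.differentiableAt_space ht hx) (her.differentiableAt_space ht hx)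
    (heh.differentiableAt_space ht hx) hchain
    (div_mul_cancel₀ _ (sub_pos.2 (P.φ_mem t ht x hx).2).ne').symm
    (div_mul_cancel₀ _ (hA.pos _ hmem .solid).ne').symm
  have hcg : contractGrad (porousDeriv e (P.state t)).b (P.b t) x i
      = - (P.ρ .solid t x * ddot (dedb e (P.state t) x)
        (fun j k => pd i (fun y => P.b t y j k) x)) := by
    have hρ : (P.state t).ρ .solid x = P.ρ .solid t x := rfl
    simp only [contractGrad, porousDeriv, ddot, Pi.neg_apply, Pi.smul_apply, smul_eq_mul, hρ,
      Fin.sum_univ_three]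
    ring
  rw [hcg, sub_neg_eq_add, ← eq_sub_iff_add_eq]
  exact key

/-- For internal friction the general system for the explicit functional derivatives is the system
for the porous medium. -/
theorem generalSystem_porousDeriv_iff (hT : 0 < T) (hF : F.IsInternal) :
    GeneralSystem (porousDeriv e) F P ↔ PorousSystem e F P := by
  have hA := P.admissibleFields hT
  have hD := P.smooth_dℓ hT (isFunctionalDerivative_porousDeriv (B := B) e)
  have hpf : SmoothField T B.pts (fun t => pressureFluid e (P.state t)) := hA.pressureFluid e
  have hps : SmoothField T B.pts (fun t => pressureSolid e (P.state t)) := hA.pressureSolid e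
  have hφ : ∀ t x, (porousDeriv e (P.state t)).φ x
      = pressureFluid e (P.state t) x - pressureSolid e (P.state t) x := fun _ _ => rfl
  have hs : ∀ t x k, (porousDeriv e (P.state t)).s k x = - temperature e (P.state t) x k :=
    fun _ _ _ => rfl
  -- The stresses on the solid agree on the cylinder.
  have hel : SmoothField T B.pts (fun t y => elasticStress e (P.state t) y) :=
    ((SmoothField.const (2 : ℝ)).mul (P.smooth_ρ hT .solid)).smul
      (SmoothField.mulT (f := fun t x => dedb e (P.state t) x) (hA.dedb e) P.smooth_b)
  have hdiv : ∀ t ∈ Icc 0 T, ∀ x ∈ B.pts,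
      dvgT (fun y => F.stress .solid t y
        - (2 : ℝ) • mulT ((porousDeriv e (P.state t)).b y) (P.b t y)) x
      = dvgT (fun y => elasticStress e (P.state t) y - F.stress .fluid t y) x := by
    intro t ht x hx
    refine SmoothField.dvgT_eq hT (f := fun t y => F.stress .solid t y
        - (2 : ℝ) • mulT ((porousDeriv e (P.state t)).b y) (P.b t y))
      (g := fun t y => elasticStress e (P.state t) y - F.stress .fluid t y)
      ((F.smooth_stress .solid).sub ((SmoothField.const (2 : ℝ)).smul (hD.b.mulT P.smooth_b)))
      (hel.sub (F.smooth_stress .fluid)) (fun t ht x hx => ?_) ht hx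
    rw [(hF t ht x hx).2]
    have hb : (P.state t).b x = P.b t x := rfl
    ext i j
    simp only [elasticStress, porousDeriv, mulT, Pi.sub_apply, Pi.neg_apply, Pi.smul_apply,
      smul_eq_mul, hb, Fin.sum_univ_three]
    ring
  have hgrad : (∀ t ∈ Icc 0 T, ∀ x ∈ B.pts, pressureFluid e (P.state t) x
      = pressureSolid e (P.state t) x) → ∀ t ∈ Icc 0 T, ∀ x ∈ B.pts, ∀ i,
      pd i (pressureFluid e (P.state t)) x = pd i (pressureSolid e (P.state t)) x :=
    fun h t ht x hx i => hpf.pd_eq hT hps h ht hx i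
  have key_f := fun t (ht : t ∈ Icc 0 T) x (hx : x ∈ B.pts) i =>
    And.intro (kinetic_identity e hT P .fluid ht hx i) (thermo_fluid e hT P ht hx i)
  have key_s := fun t (ht : t ∈ Icc 0 T) x (hx : x ∈ B.pts) i =>
    And.intro (kinetic_identity e hT P .solid ht hx i) (thermo_solid e hT P ht hx i)
  constructor
  · intro h
    have hp : ∀ t ∈ Icc 0 T, ∀ x ∈ B.pts, pressureFluid e (P.state t) x
        = pressureSolid e (P.state t) x := fun t ht x hx =>
      sub_eq_zero.1 (h.volume_fraction t ht x hx)
    refine ⟨fun t ht x hx => ?_, fun t ht x hx => ?_, h.continuity, fun t ht x hx => ?_,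
      fun t ht x hx => ?_, hp⟩
    · ext i
      have h1 := congrArg (fun v : E3 => v i) (h.momentum_fluid t ht x hx)
      obtain ⟨h2, h3⟩ := key_f t ht x hx i
      simp only [PiLp.add_apply, PiLp.neg_apply, PiLp.smul_apply, smul_eq_mul,
        gradient_apply] at h1 h2 ⊢
      linarith
    · ext i
      have h1 := congrArg (fun v : E3 => v i) (h.momentum_solid t ht x hx)
      obtain ⟨h2, h3⟩ := key_s t ht x hx i
      rw [hdiv t ht x hx, (hF t ht x hx).1] at h1
      simp only [PiLp.add_apply, PiLp.sub_apply, PiLp.neg_apply, PiLp.smul_apply, smul_eq_mul,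
        gradient_apply, hgrad hp t ht x hx i] at h1 h2 ⊢
      linarith
    · have h1 := h.entropy_fluid t ht x hx
      rw [hs, hs] at h1
      linarith
    · have h1 := h.entropy_solid t ht x hx
      rw [hs, hs, (hF t ht x hx).1, (hF t ht x hx).2] at h1
      have h2 : ∀ C D : Mat3, ddot (-C) D = - ddot C D := fun C D => by simp [ddot]
      rw [h2, inner_neg_left] at h1
      linarith
  · intro h
    refine ⟨fun t ht x hx => ?_, fun t ht x hx => ?_, h.continuity, fun t ht x hx => ?_,
      fun t ht x hx => ?_, fun t ht x hx => ?_⟩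
    · ext i
      have h1 := congrArg (fun v : E3 => v i) (h.momentum_fluid t ht x hx)
      obtain ⟨h2, h3⟩ := key_f t ht x hx i
      simp only [PiLp.add_apply, PiLp.neg_apply, PiLp.smul_apply, smul_eq_mul,
        gradient_apply] at h1 h2 ⊢
      linarith
    · ext i
      have h1 := congrArg (fun v : E3 => v i) (h.momentum_solid t ht x hx)
      obtain ⟨h2, h3⟩ := key_s t ht x hx i
      rw [hdiv t ht x hx, (hF t ht x hx).1]
      simp only [PiLp.add_apply, PiLp.sub_apply, PiLp.neg_apply, PiLp.smul_apply, smul_eq_mul,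
        gradient_apply, hgrad h.pressure t ht x hx i] at h1 h2 ⊢
      linarith
    · have h1 := h.entropy_fluid t ht x hx
      rw [hs, hs]
      linarith
    · have h1 := h.entropy_solid t ht x hx
      rw [hs, hs, (hF t ht x hx).1, (hF t ht x hx).2]
      have h2 : ∀ C D : Mat3, ddot (-C) D = - ddot C D := fun C D => by simp [ddot]
      rw [h2, inner_neg_left]
      linarith
    · rw [hφ, h.pressure t ht x hx, sub_self]

/-- The same equivalence for arbitrary functional derivatives, by their uniqueness on the domain. -/
theorem generalSystem_iff_porousSystem (hT : 0 < T) (hF : F.IsInternal) {dℓ : State → State}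
    (hℓ : IsFunctionalDerivative B (porousLagrangian B e) dℓ) :
    GeneralSystem dℓ F P ↔ PorousSystem e F P := by
  have h0 := isFunctionalDerivative_porousDeriv (B := B) e
  rw [← generalSystem_porousDeriv_iff e hT hF]
  exact ⟨fun h => h.congr hT (P.smooth_dℓ hT hℓ) (P.smooth_dℓ hT h0)
      fun t ht => hℓ.eqOn hT P h0 ht,
    fun h => h.congr hT (P.smooth_dℓ hT h0) (P.smooth_dℓ hT hℓ)
      fun t ht => h0.eqOn hT P hℓ ht⟩

end Porous

end PorousMedia

end

theorem mainTheorem2 (T : ℝ) (hT : 0 < T) (B : SmoothDomain) (R : Phase → SmoothDomain)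
    (bc : BoundaryCondition) (P : Evolution T R B) (hbc : P.SatisfiesBC bc) (F : Friction T B) :
    (∀ (ℓ : State → ℝ) (dℓ : State → State), IsFunctionalDerivative B ℓ dℓ →
      (∀ t ∈ Set.Icc 0 T, ∀ x ∈ B.pts, ∀ k, (dℓ (P.state t)).s k x ≠ 0) →
        (IsCritical bc ℓ dℓ F P → GeneralSystem dℓ F P ∧ AuxiliaryConditions dℓ P) ∧
        (bc = .noSlip →
          GeneralSystem dℓ F P ∧ AuxiliaryConditions dℓ P → IsCritical bc ℓ dℓ F P)) ∧
    (∀ e : InternalEnergies,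
      (∃ dℓ, IsFunctionalDerivative B (porousLagrangian B e) dℓ) ∧
      ∀ dℓ, IsFunctionalDerivative B (porousLagrangian B e) dℓ →
        (∀ t ∈ Set.Icc 0 T, ∀ x ∈ B.pts, ∀ k,
          temperature e (P.state t) x k = - (dℓ (P.state t)).s k x) ∧
        ((∀ t ∈ Set.Icc 0 T, ∀ x ∈ B.pts, ∀ k, temperature e (P.state t) x k ≠ 0) →
          F.IsInternal →
          (IsCritical bc (porousLagrangian B e) dℓ F P →
            PorousSystem e F P ∧ AuxiliaryConditions dℓ P) ∧
          (bc = .noSlip → PorousSystem e F P ∧ AuxiliaryConditions dℓ P →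
            IsCritical bc (porousLagrangian B e) dℓ F P))) := by
  refine ⟨fun ℓ dℓ hℓ hne => ⟨fun h => h.generalSystem hT hℓ hne, ?_⟩, fun e =>
    ⟨⟨_, isFunctionalDerivative_porousDeriv e⟩, fun dℓ hℓ => ?_⟩⟩
  · rintro rfl ⟨h, hA⟩
    exact h.isCritical hT hℓ hbc hA
  · have htemp : ∀ t ∈ Set.Icc 0 T, ∀ x ∈ B.pts, ∀ k,
        temperature e (P.state t) x k = - (dℓ (P.state t)).s k x := fun t ht x hx k => by
      rw [(hℓ.eqOn hT P (isFunctionalDerivative_porousDeriv e) ht).s x hx k]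
      exact (neg_neg _).symm
    refine ⟨htemp, fun hne hF => ?_⟩
    have hiff := generalSystem_iff_porousSystem (P := P) e hT hF hℓ
    refine ⟨fun h => ?_, ?_⟩
    · have hne' : ∀ t ∈ Set.Icc 0 T, ∀ x ∈ B.pts, ∀ k, (dℓ (P.state t)).s k x ≠ 0 :=
        fun t ht x hx k h0 => hne t ht x hx k (by rw [htemp t ht x hx k, h0, neg_zero])
      have hS := h.generalSystem hT hℓ hne'
      exact ⟨hiff.1 hS.1, hS.2⟩
    · rintro rfl ⟨h, hA⟩
      exact (hiff.2 h).isCritical hT hℓ hbc hA
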